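/- Let $X$ be a finite CW complex and let $\mu\colon H_1(X)\to\mathbb{C}^\times$ be a homomorphism, where $H_1(X)$ is integral singular homology. Let $R\subset\mathbb{C}$ be the subring generated by the image of $\mu$, and let $h\colon R\to P$ be a ring homomorphism to a field $P$ such that $h(\mu(a))=1$ for every $a\in H_1(X)$. Let $\mathbb{C}^\mu$ be the local coefficient system on $X$ with fibre $\mathbb{C}$ and monodromy $\mu$, that is, parallel transport along a loop is multiplication by the value of $\mu$ on the homology class of the loop. Then all the vector spaces $H_s(X;\mathbb{C}^\mu)$ (twisted singular homology) and $H_s(X;P)$ (untwisted singular homology) are finite-dimensional, over $\mathbb{C}$ and over $P$ respectively, and for every integer $n\ge 0$ and every integer $r$ $$\sum_{s=r}^{2n+r}(-1)^{s-r}\dim_{\mathbb{C}}H_s(X;\mathbb{C}^\mu)\;\le\;\sum_{s=r}^{2n+r}(-1)^{s-r}\dim_{P}H_s(X;P),$$ where homology in negative degrees is zero. -/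

import Mathlib

open CategoryTheory AlgebraicTopology Simplicial

universe u v w

noncomputable section

namespace TwistedHomology

/-! ## Singular chains twisted by a local coefficient system -/

section Chains

variable {X : Type u} [TopologicalSpace X]

/-- The topological `n`-simplex. -/
abbrev Simp (n : ℕ) : Type := stdSimplex ℝ (Fin (n + 1))

instance simplyConnectedSpace_simp (n : ℕ) : SimplyConnectedSpace (Simp n) :=
  haveI : ContractibleSpace (Simp n) :=
    (convex_stdSimplex ℝ (Fin (n + 1))).contractibleSpace
      ⟨_, single_mem_stdSimplex ℝ (0 : Fin (n + 1))⟩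
  inferInstance

/-- The barycenter of the topological `n`-simplex. -/
def center (n : ℕ) : Simp n := stdSimplex.barycenter

/-- The homotopy class of paths in the topological `n`-simplex from `a` to `b`; it is unique,
because the simplex is simply connected. -/
def simpPath {n : ℕ} (a b : Simp n) : Path.Homotopic.Quotient a b :=
  Path.Homotopic.Quotient.mk (PathConnectedSpace.somePath a b)

/-- A local coefficient system of `R`-modules on `X`: a module `ξ.obj ⟨x⟩` (the fibre) for each
point `x`, and for each homotopy class of paths a parallel transport between the fibres over
its end points, compatible with composition of paths. -/
abbrev LocalSystem (R : Type w) [Ring R] (X : Type u) [TopologicalSpace X] :=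
  FundamentalGroupoid X ⥤ ModuleCat.{v} R

variable {R : Type w} [Ring R] (ξ : LocalSystem.{u, v, w} R X)

/-- The fibre of `ξ` over `x`. -/
abbrev fibre (x : X) : ModuleCat.{v} R := ξ.obj ⟨x⟩

/-- Parallel transport along a homotopy class of paths. -/
def parallel {x y : X} (p : Path.Homotopic.Quotient x y) : fibre ξ x →ₗ[R] fibre ξ y :=
  (ξ.map (FundamentalGroupoid.fromPath p)).hom

theorem parallel_refl (x : X) :
    parallel ξ (Path.Homotopic.Quotient.refl x) = LinearMap.id :=
  congrArg ModuleCat.Hom.hom (ξ.map_id ⟨x⟩)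

theorem parallel_trans {x y z : X} (p : Path.Homotopic.Quotient x y)
    (q : Path.Homotopic.Quotient y z) :
    parallel ξ (p.trans q) = parallel ξ q ∘ₗ parallel ξ p :=
  congrArg ModuleCat.Hom.hom
    (ξ.map_comp (FundamentalGroupoid.fromPath p) (FundamentalGroupoid.fromPath q))

/-- Parallel transport from the fibre over `σ a` to the fibre over `σ b`, along the image under
the singular simplex `σ` of any path in the simplex from `a` to `b`. -/
def transport {n : ℕ} (σ : C(Simp n, X)) (a b : Simp n) : fibre ξ (σ a) →ₗ[R] fibre ξ (σ b) :=
  parallel ξ ((simpPath a b).map σ)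

theorem transport_self {n : ℕ} (σ : C(Simp n, X)) (a : Simp n) :
    transport ξ σ a a = LinearMap.id := by
  have h : simpPath a a = Path.Homotopic.Quotient.refl a := Subsingleton.elim _ _
  rw [transport, h]
  exact parallel_refl ξ (σ a)

theorem transport_comp {m n : ℕ} (σ : C(Simp n, X)) (φ : C(Simp m, Simp n)) (a : Simp n)
    (b c : Simp m) :
    transport ξ σ a (φ c) = transport ξ (σ.comp φ) b c ∘ₗ transport ξ σ a (φ b) := by
  have h : simpPath a (φ c) = (simpPath a (φ b)).trans ((simpPath b c).map φ) :=
    Subsingleton.elim _ _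
  have h' : (simpPath a (φ c)).map σ =
      ((simpPath a (φ b)).map σ).trans ((simpPath b c).map (σ.comp φ)) := by
    rw [h, Path.Homotopic.Quotient.map_comp]
    exact (FundamentalGroupoid.map σ).map_comp (FundamentalGroupoid.fromPath (simpPath a (φ b)))
      (FundamentalGroupoid.fromPath ((simpPath b c).map φ))
  rw [transport, h']
  exact parallel_trans ξ _ _

/-- Singular `n`-chains with coefficients in `ξ`: finite formal sums of singular simplices `σ`
with coefficients in the fibre of `ξ` over the image under `σ` of the barycenter. -/
abbrev TwistedChains (n : ℕ) : Type (max u v) :=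
  DirectSum C(Simp n, X) fun σ => fibre ξ (σ (center n))

open Classical in
/-- The chain `z · σ` with a single term. -/
def single {n : ℕ} (σ : C(Simp n, X)) : fibre ξ (σ (center n)) →ₗ[R] TwistedChains ξ n :=
  DirectSum.lof R _ (fun σ : C(Simp n, X) => fibre ξ (σ (center n))) σ

theorem twistedChains_hom_ext {n : ℕ} {M : Type*} [AddCommGroup M] [Module R M]
    {f g : TwistedChains ξ n →ₗ[R] M} (h : ∀ σ, f ∘ₗ single ξ σ = g ∘ₗ single ξ σ) : f = g := by
  classical
  refine DirectSum.linearMap_ext R fun σ => ?_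
  have e : DirectSum.lof R C(Simp n, X) (fun σ => fibre ξ (σ (center n))) σ = single ξ σ := by
    unfold single
    congr!
  rw [e]
  exact h σ

open Classical in
/-- Restriction of chains along a map of simplices `φ`: the chain `z · σ` is sent to
`z' · (σ ∘ φ)`, where `z'` is obtained from `z` by parallel transport inside `σ`. -/
def restrict {m n : ℕ} (φ : C(Simp m, Simp n)) : TwistedChains ξ n →ₗ[R] TwistedChains ξ m :=
  DirectSum.toModule R _ _ fun σ =>
    (single ξ (σ.comp φ)) ∘ₗ (transport ξ σ (center n) (φ (center m)))

theorem restrict_single {m n : ℕ} (φ : C(Simp m, Simp n)) (σ : C(Simp n, X)) :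
    restrict ξ φ ∘ₗ single ξ σ =
      (single ξ (σ.comp φ)) ∘ₗ (transport ξ σ (center n) (φ (center m))) := by
  classical
  ext z
  simp only [restrict, single, LinearMap.comp_apply, DirectSum.toModule_lof]

theorem restrict_id (n : ℕ) : restrict ξ (ContinuousMap.id (Simp n)) = LinearMap.id := by
  refine twistedChains_hom_ext ξ fun σ => ?_
  rw [restrict_single]
  exact congrArg (fun t => (single ξ σ) ∘ₗ t) (transport_self ξ σ (center n))

theorem restrict_comp {l m n : ℕ} (φ : C(Simp m, Simp n)) (ψ : C(Simp l, Simp m)) :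
    restrict ξ (φ.comp ψ) = restrict ξ ψ ∘ₗ restrict ξ φ := by
  refine twistedChains_hom_ext ξ fun σ => ?_
  rw [restrict_single, LinearMap.comp_assoc, restrict_single, ← LinearMap.comp_assoc,
    restrict_single, LinearMap.comp_assoc]
  exact congrArg (fun t => (single ξ ((σ.comp φ).comp ψ)) ∘ₗ t)
    (transport_comp ξ σ φ (center n) (center m) (ψ (center l)))

/-- The affine map of topological simplices given by a monotone map of vertices. -/
def simpMap {a b : SimplexCategory} (f : a ⟶ b) : C(Simp a.len, Simp b.len) :=
  ⟨stdSimplex.map f, stdSimplex.continuous_map f⟩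

theorem simpMap_id (a : SimplexCategory) : simpMap (𝟙 a) = ContinuousMap.id _ := by
  ext1 x
  exact stdSimplex.map_id_apply x

theorem simpMap_comp {a b c : SimplexCategory} (f : a ⟶ b) (g : b ⟶ c) :
    simpMap (f ≫ g) = (simpMap g).comp (simpMap f) := by
  ext1 x
  exact (stdSimplex.map_comp_apply f g x).symm

/-- The simplicial module of singular chains with coefficients in `ξ`. -/
def twistedSimplicialModule : SimplicialObject (ModuleCat.{max u v} R) where
  obj a := ModuleCat.of R (TwistedChains ξ a.unop.len)
  map f := ModuleCat.ofHom (restrict ξ (simpMap f.unop))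
  map_id a := by
    rw [unop_id, simpMap_id, restrict_id]
    rfl
  map_comp f g := by
    rw [unop_comp, simpMap_comp, restrict_comp]
    rfl

/-- The singular chain complex of `X` with coefficients in `ξ`; its differential is the
alternating sum of the faces. -/
def twistedChainComplex : ChainComplex (ModuleCat.{max u v} R) ℕ :=
  (alternatingFaceMapComplex (ModuleCat.{max u v} R)).obj (twistedSimplicialModule ξ)

/-- The homology of `X` with coefficients in the local system `ξ`. -/
def twistedHomology (n : ℕ) : ModuleCat.{max u v} R := (twistedChainComplex ξ).homology n

end Chains

/-! ## The first homology group and the classes of loops in it -/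

section Hurewicz

/-- The integral singular chain complex of `X`. -/
abbrev singularChains (X : Type u) [TopologicalSpace X] : ChainComplex (ModuleCat.{u} ℤ) ℕ :=
  ((singularChainComplexFunctor.{u} (ModuleCat.{u} ℤ)).obj (ModuleCat.of ℤ (ULift.{u} ℤ))).obj
    (TopCat.of X)

/-- The first integral singular homology group `H_1(X)`. -/
abbrev H1 (X : Type u) [TopologicalSpace X] : ModuleCat.{u} ℤ := (singularChains X).homology 1

variable {X : Type u} [TopologicalSpace X]

/-- A continuous map from the topological `n`-simplex to `X`, as an element of the singular
simplicial set of `X`. -/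
def toSing {n : ℕ} (σ : C(Simp n, X)) : (TopCat.toSSet.obj (TopCat.of X)) _⦋n⦌ :=
  ((TopCat.of X).toSSetObjEquiv (Opposite.op ⦋n⦌)).symm σ

theorem toSing_δ {n : ℕ} (σ : C(Simp (n + 1), X)) (i : Fin (n + 2)) :
    (TopCat.toSSet.obj (TopCat.of X)).δ i (toSing σ) =
      toSing (σ.comp (simpMap (SimplexCategory.δ i))) :=
  rfl

/-- A path, as a singular `1`-simplex that runs from its vertex `0` to its vertex `1`. -/
def pathSimplex {x y : X} (p : Path x y) : C(Simp 1, X) :=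
  p.toContinuousMap.comp ⟨stdSimplexHomeomorphUnitInterval, by fun_prop⟩

/-- The singular chain `1 · σ`, as a map from the coefficient module. -/
def chain {n : ℕ} (σ : C(Simp n, X)) :
    ModuleCat.of ℤ (ULift.{u} ℤ) ⟶ (singularChains X).X n :=
  SSet.ιChainComplex _ (toSing σ)

theorem chain_d {n : ℕ} (σ : C(Simp (n + 1), X)) :
    chain σ ≫ (singularChains X).d (n + 1) n =
      ∑ i : Fin (n + 2), (-1) ^ i.val • chain (σ.comp (simpMap (SimplexCategory.δ i))) :=
  SSet.ιChainComplex_d _ _ (toSing σ)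

/-- The affine map from the topological `n`-simplex to a vector space with vertices `v`. -/
def affine {E : Type*} [AddCommGroup E] [Module ℝ E] [TopologicalSpace E] [ContinuousAdd E]
    [ContinuousSMul ℝ E] {n : ℕ} (v : Fin (n + 1) → E) : C(Simp n, E) :=
  ⟨fun s => ∑ i, s.1 i • v i, continuous_finsetSum _ fun i _ =>
    ((continuous_apply i).comp continuous_subtype_val).smul continuous_const⟩

theorem affine_comp {E : Type*} [AddCommGroup E] [Module ℝ E] [TopologicalSpace E]
    [ContinuousAdd E] [ContinuousSMul ℝ E] {n m : ℕ} (v : Fin (n + 1) → E)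
    (f : ⦋m⦌ ⟶ ⦋n⦌) :
    (affine v).comp (simpMap f) = affine fun i => v (f i) := by
  classical
  ext s
  change ∑ i, (FunOnFinite.linearMap ℝ ℝ f s.1) i • v i = ∑ i, s.1 i • v (f i)
  simp only [FunOnFinite.linearMap_apply_apply, Finset.sum_smul]
  rw [← Finset.sum_fiberwise Finset.univ f (fun i => s.1 i • v (f i))]
  refine Finset.sum_congr rfl fun i _ => Finset.sum_congr rfl fun j hj => ?_
  rw [(Finset.mem_filter.mp hj).2]

theorem affine_one {E : Type*} [AddCommGroup E] [Module ℝ E] [TopologicalSpace E]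
    [ContinuousAdd E] [ContinuousSMul ℝ E] (a b : E) (s : Simp 1) :
    affine ![a, b] s = s.1 0 • a + s.1 1 • b :=
  Fin.sum_univ_two (fun i => s.1 i • ![a, b] i)

theorem simp_one_add (s : Simp 1) : s.1 0 + s.1 1 = 1 := stdSimplex.add_eq_one s

/-- The class of a singular `1`-simplex modulo boundaries. -/
def chainClass (σ : C(Simp 1, X)) :
    ModuleCat.of ℤ (ULift.{u} ℤ) ⟶ (singularChains X).opcycles 1 :=
  chain σ ≫ (singularChains X).pOpcycles 1

theorem chainClass_triangle {E : Type*} [AddCommGroup E] [Module ℝ E] [TopologicalSpace E]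
    [ContinuousAdd E] [ContinuousSMul ℝ E] (F : C(E, X)) (a b c : E) :
    chainClass (F.comp (affine ![a, c])) =
      chainClass (F.comp (affine ![a, b])) + chainClass (F.comp (affine ![b, c])) := by
  have h : (chain (F.comp (affine ![a, b, c])) ≫ (singularChains X).d 2 1) ≫
      (singularChains X).pOpcycles 1 = 0 := by
    rw [Category.assoc, HomologicalComplex.d_pOpcycles, Limits.comp_zero]
  have e0 : (affine ![a, b, c]).comp (simpMap (SimplexCategory.δ (0 : Fin 3))) =
      affine ![b, c] :=
    (affine_comp _ _).trans (congrArg affine (by funext i; fin_cases i <;> rfl))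
  have e1 : (affine ![a, b, c]).comp (simpMap (SimplexCategory.δ (1 : Fin 3))) =
      affine ![a, c] :=
    (affine_comp _ _).trans (congrArg affine (by funext i; fin_cases i <;> rfl))
  have e2 : (affine ![a, b, c]).comp (simpMap (SimplexCategory.δ (2 : Fin 3))) =
      affine ![a, b] :=
    (affine_comp _ _).trans (congrArg affine (by funext i; fin_cases i <;> rfl))
  have hd : chain (F.comp (affine ![a, b, c])) ≫ (singularChains X).d 2 1 =
      chain (F.comp (affine ![b, c])) - chain (F.comp (affine ![a, c])) +
        chain (F.comp (affine ![a, b])) := by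
    rw [← e0, ← e1, ← e2]
    refine (chain_d (F.comp (affine ![a, b, c]))).trans ((Fin.sum_univ_three _).trans ?_)
    change (1 : ℤ) • _ + (-1 : ℤ) • _ + (1 : ℤ) • _ = _
    rw [one_smul, one_smul, neg_one_smul, ← sub_eq_add_neg]
    rfl
  rw [hd, Preadditive.add_comp, Preadditive.sub_comp] at h
  unfold chainClass
  rw [← sub_eq_zero, ← neg_eq_zero, ← h]
  abel

theorem pathSimplex_eq {x y : X} (p : Path x y) :
    pathSimplex p = p.extend.comp (affine ![0, 1]) := by
  ext s
  change p (stdSimplexHomeomorphUnitInterval s) = p.extend (affine ![(0 : ℝ), 1] s)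
  rw [affine_one, smul_zero, zero_add, smul_eq_mul, mul_one]
  rw [Path.extend_apply p (t := s.1 1) (stdSimplexHomeomorphUnitInterval s).2]
  rfl

theorem chainClass_const (x : X) : chainClass (ContinuousMap.const (Simp 1) x) = 0 := by
  have h := chainClass_triangle (ContinuousMap.const ℝ x) 0 0 0
  have e : (ContinuousMap.const ℝ x).comp (affine ![(0 : ℝ), 0]) =
      ContinuousMap.const (Simp 1) x := rfl
  rw [e] at h
  simpa using h

theorem chainClass_refl (x : X) : chainClass (pathSimplex (Path.refl x)) = 0 :=
  chainClass_const x

theorem chainClass_trans {x y z : X} (p : Path x y) (q : Path y z) :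
    chainClass (pathSimplex (p.trans q)) =
      chainClass (pathSimplex p) + chainClass (pathSimplex q) := by
  rw [pathSimplex_eq, chainClass_triangle _ 0 (1 / 2) 1]
  congr 2
  · rw [pathSimplex_eq]
    ext s
    have h1 : s.1 1 ≤ 1 := (stdSimplexHomeomorphUnitInterval s).2.2
    change (p.trans q).extend (affine ![(0 : ℝ), 1 / 2] s) = p.extend (affine ![(0 : ℝ), 1] s)
    simp only [affine_one, smul_eq_mul, mul_zero, mul_one, zero_add]
    rw [Path.extend_trans_of_le_half _ _ (by linarith)]
    congr 1
    ring
  · rw [pathSimplex_eq]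
    ext s
    have h0 : 0 ≤ s.1 1 := (stdSimplexHomeomorphUnitInterval s).2.1
    have h01 := simp_one_add s
    change (p.trans q).extend (affine ![(1 / 2 : ℝ), 1] s) = q.extend (affine ![(0 : ℝ), 1] s)
    simp only [affine_one, smul_eq_mul, mul_zero, mul_one, zero_add]
    rw [Path.extend_trans_of_half_le _ _ (by linarith)]
    congr 1
    linarith

theorem chainClass_homotopic {x y : X} {p q : Path x y} (h : p.Homotopic q) :
    chainClass (pathSimplex p) = chainClass (pathSimplex q) := by
  obtain ⟨H⟩ := h
  let F : C(ℝ × ℝ, X) :=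
    ⟨fun t => H (Set.projIcc 0 1 zero_le_one t.1, Set.projIcc 0 1 zero_le_one t.2), by fun_prop⟩
  have h1 := chainClass_triangle F (0, 0) (0, 1) (1, 1)
  have h2 := chainClass_triangle F (0, 0) (1, 0) (1, 1)
  have hF (t : ℝ × ℝ) :
      F t = H (Set.projIcc 0 1 zero_le_one t.1, Set.projIcc 0 1 zero_le_one t.2) := rfl
  have e1 : F.comp (affine ![(0, 0), (0, 1)]) = pathSimplex p := by
    rw [pathSimplex_eq]
    ext s
    change F (affine ![((0 : ℝ), (0 : ℝ)), (0, 1)] s) =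
      p (Set.projIcc 0 1 zero_le_one (affine ![(0 : ℝ), 1] s))
    rw [hF, affine_one, affine_one]
    simp
  have e2 : F.comp (affine ![(1, 0), (1, 1)]) = pathSimplex q := by
    rw [pathSimplex_eq]
    ext s
    change F (affine ![((1 : ℝ), (0 : ℝ)), (1, 1)] s) =
      q (Set.projIcc 0 1 zero_le_one (affine ![(0 : ℝ), 1] s))
    rw [hF, affine_one, affine_one]
    simp [simp_one_add s]
  have e3 : F.comp (affine ![(0, 1), (1, 1)]) = ContinuousMap.const _ y := by
    ext s
    change F (affine ![((0 : ℝ), (1 : ℝ)), (1, 1)] s) = y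
    rw [hF, affine_one]
    simp [simp_one_add s]
  have e4 : F.comp (affine ![(0, 0), (1, 0)]) = ContinuousMap.const _ x := by
    ext s
    change F (affine ![((0 : ℝ), (0 : ℝ)), (1, 0)] s) = x
    rw [hF, affine_one]
    simp
  rw [e1, e3, chainClass_const, add_zero] at h1
  rw [e2, e4, chainClass_const, zero_add] at h2
  exact h1.symm.trans h2

theorem chain_pathSimplex_d {x y : X} (h : x = y) (p : Path x y) :
    chain (pathSimplex p) ≫ (singularChains X).d 1 0 = 0 := by
  subst h
  have c0 : (affine ![(0 : ℝ), 1]).comp (simpMap (SimplexCategory.δ (0 : Fin 2))) =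
      ContinuousMap.const (Simp 0) 1 := by
    refine (affine_comp _ _).trans ?_
    ext s
    have hs : s.1 0 = 1 := stdSimplex.eq_one_of_unique (X := Fin 1) s 0
    refine (Fin.sum_univ_one
      fun i => s.1 i • (![(0 : ℝ), 1] (SimplexCategory.δ (0 : Fin 2) i) : ℝ)).trans ?_
    change s.1 0 • (1 : ℝ) = 1
    rw [hs, one_smul]
  have c1 : (affine ![(0 : ℝ), 1]).comp (simpMap (SimplexCategory.δ (1 : Fin 2))) =
      ContinuousMap.const (Simp 0) 0 := by
    refine (affine_comp _ _).trans ?_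
    ext s
    refine (Fin.sum_univ_one
      fun i => s.1 i • (![(0 : ℝ), 1] (SimplexCategory.δ (1 : Fin 2) i) : ℝ)).trans ?_
    exact smul_zero (s.1 0)
  have f0 : (pathSimplex p).comp (simpMap (SimplexCategory.δ (0 : Fin 2))) =
      ContinuousMap.const (Simp 0) x := by
    rw [pathSimplex_eq, ContinuousMap.comp_assoc, c0]
    ext s
    exact p.extend_one
  have f1 : (pathSimplex p).comp (simpMap (SimplexCategory.δ (1 : Fin 2))) =
      ContinuousMap.const (Simp 0) x := by
    rw [pathSimplex_eq, ContinuousMap.comp_assoc, c1]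
    ext s
    exact p.extend_zero
  refine (chain_d (pathSimplex p)).trans ((Fin.sum_univ_two _).trans ?_)
  rw [f0, f1]
  change (1 : ℤ) • _ + (-1 : ℤ) • _ = _
  rw [one_smul, neg_one_smul, add_neg_cancel]

/-- The homology class in `H_1(X)` of a loop (a path whose end points `x` and `y` coincide):
the class of the cycle which consists of the loop regarded as a singular `1`-simplex. -/
def loopClassHom {x y : X} (h : x = y) (p : Path x y) :
    ModuleCat.of ℤ (ULift.{u} ℤ) ⟶ H1 X :=
  (singularChains X).liftCycles (chain (pathSimplex p)) 0 (by simp) (chain_pathSimplex_d h p) ≫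
    (singularChains X).homologyπ 1

theorem loopClassHom_ι {x y : X} (h : x = y) (p : Path x y) :
    loopClassHom h p ≫ (singularChains X).homologyι 1 = chainClass (pathSimplex p) := by
  unfold loopClassHom chainClass
  rw [Category.assoc, HomologicalComplex.homology_π_ι, HomologicalComplex.liftCycles_i_assoc]

/-- The Hurewicz map: the homology class in `H_1(X)` of a homotopy class of loops. -/
def loopClass {x y : X} (h : x = y) (p : Path.Homotopic.Quotient x y) : H1 X :=
  Quotient.lift (fun p : Path x y => (loopClassHom h p).hom (ULift.up 1)) (by
    intro p q hpq
    have e : loopClassHom h p = loopClassHom h q := by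
      rw [← cancel_mono ((singularChains X).homologyι 1)]
      exact (loopClassHom_ι h p).trans
        ((chainClass_homotopic hpq).trans (loopClassHom_ι h q).symm)
    exact congrArg (fun t => t.hom (ULift.up 1)) e) p

/-- The class of a homotopy class of paths modulo boundaries. -/
def pathClass {x y : X} (p : Path.Homotopic.Quotient x y) : (singularChains X).opcycles 1 :=
  Quotient.lift (fun p : Path x y => (chainClass (pathSimplex p)).hom (ULift.up 1))
    (fun _ _ hpq => congrArg (fun t => t.hom (ULift.up 1)) (chainClass_homotopic hpq)) p

theorem pathClass_refl (x : X) : pathClass (Path.Homotopic.Quotient.refl x) = 0 :=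
  congrArg (fun t => t.hom (ULift.up 1)) (chainClass_refl x)

theorem pathClass_trans {x y z : X} (p : Path.Homotopic.Quotient x y)
    (q : Path.Homotopic.Quotient y z) : pathClass (p.trans q) = pathClass p + pathClass q := by
  induction p using Path.Homotopic.Quotient.ind with | mk p =>
  induction q using Path.Homotopic.Quotient.ind with | mk q =>
  exact congrArg (fun t => t.hom (ULift.up 1)) (chainClass_trans p q)

theorem pathClass_symm {x y : X} (p : Path.Homotopic.Quotient x y) :
    pathClass p.symm = - pathClass p := by
  have h := pathClass_trans p p.symm
  rw [Path.Homotopic.Quotient.trans_symm, pathClass_refl] at h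
  exact (neg_eq_of_add_eq_zero_right h.symm).symm

theorem loopClass_ι {x y : X} (h : x = y) (p : Path.Homotopic.Quotient x y) :
    ((singularChains X).homologyι 1).hom (loopClass h p) = pathClass p := by
  induction p using Path.Homotopic.Quotient.ind with | mk p =>
  exact congrArg (fun t => t.hom (ULift.up 1)) (loopClassHom_ι h p)

theorem loopClass_ext {a b : H1 X} (h : ((singularChains X).homologyι 1).hom a =
    ((singularChains X).homologyι 1).hom b) : a = b :=
  (ModuleCat.mono_iff_injective ((singularChains X).homologyι 1)).mp inferInstance h

end Hurewicz

/-! ## The local coefficient system with a given monodromy -/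

section Monodromy

variable {X : Type u} [TopologicalSpace X]

/-- The chosen base point of the path component of `x`. -/
def basePoint (x : X) : X := (Quotient.mk (pathSetoid X) x).out

theorem basePoint_eq {x y : X} (p : Path.Homotopic.Quotient x y) : basePoint x = basePoint y := by
  induction p using Path.Homotopic.Quotient.ind with | mk p =>
  exact congrArg Quotient.out (Quotient.sound ⟨p⟩)

/-- A chosen homotopy class of paths to `x` from the base point of its path component. -/
def basePath (x : X) : Path.Homotopic.Quotient (basePoint x) x :=
  Path.Homotopic.Quotient.mk (Quotient.mk_out (s := pathSetoid X) x : Joined _ _).somePath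

/-- The homology class of the loop that goes from the base point to `x`, then along `p` to `y`,
then back to the base point. -/
def closedUpClass {x y : X} (p : Path.Homotopic.Quotient x y) : H1 X :=
  loopClass (basePoint_eq p) (((basePath x).trans p).trans (basePath y).symm)

theorem closedUpClass_ι {x y : X} (p : Path.Homotopic.Quotient x y) :
    ((singularChains X).homologyι 1).hom (closedUpClass p) =
      pathClass (basePath x) + pathClass p - pathClass (basePath y) := by
  rw [closedUpClass, loopClass_ι, pathClass_trans, pathClass_trans, pathClass_symm, sub_eq_add_neg]

theorem closedUpClass_refl (x : X) : closedUpClass (Path.Homotopic.Quotient.refl x) = 0 := by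
  apply loopClass_ext
  rw [closedUpClass_ι, pathClass_refl, map_zero]
  abel

theorem closedUpClass_trans {x y z : X} (p : Path.Homotopic.Quotient x y)
    (q : Path.Homotopic.Quotient y z) :
    closedUpClass (p.trans q) = closedUpClass p + closedUpClass q := by
  apply loopClass_ext
  rw [map_add, closedUpClass_ι, closedUpClass_ι, closedUpClass_ι, pathClass_trans]
  abel

theorem closedUpClass_loop {x : X} (p : Path.Homotopic.Quotient x x) :
    closedUpClass p = loopClass rfl p := by
  apply loopClass_ext
  rw [closedUpClass_ι, loopClass_ι]
  abel

variable {K : Type v} [CommRing K] (μ : Multiplicative (H1 X) →* Kˣ)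

/-- The local coefficient system `K^μ` with fibre `K` and monodromy `μ : H_1(X) → Kˣ`. -/
def monodromySystem : LocalSystem.{u, v, v} K X where
  obj _ := ModuleCat.of K K
  map {x y} p := ModuleCat.ofHom
    (((μ (Multiplicative.ofAdd (closedUpClass (x := x.as) (y := y.as) p)) : Kˣ) : K) •
      (LinearMap.id : K →ₗ[K] K))
  map_id x := by
    have h : μ (Multiplicative.ofAdd (closedUpClass (x := x.as) (y := x.as) (𝟙 x))) = 1 := by
      rw [show closedUpClass (x := x.as) (y := x.as) (𝟙 x) = 0 from closedUpClass_refl x.as]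
      exact map_one μ
    rw [h, Units.val_one, one_smul]
    rfl
  map_comp {x y z} p q := by
    have h : μ (Multiplicative.ofAdd (closedUpClass (x := x.as) (y := z.as) (p ≫ q))) =
        μ (Multiplicative.ofAdd (closedUpClass (x := y.as) (y := z.as) q)) *
          μ (Multiplicative.ofAdd (closedUpClass (x := x.as) (y := y.as) p)) := by
      rw [show closedUpClass (x := x.as) (y := z.as) (p ≫ q) =
        closedUpClass (x := x.as) (y := y.as) p + closedUpClass (x := y.as) (y := z.as) q from
        closedUpClass_trans (x := x.as) p q, ofAdd_add, map_mul, mul_comm]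
    rw [h, Units.val_mul, ← ModuleCat.ofHom_comp]
    congr 1
    ext
    simp [mul_comm]

/-- Parallel transport along a loop is multiplication by the value of `μ` on its class. -/
theorem monodromySystem_loop {x : X} (p : Path.Homotopic.Quotient x x) (z : K) :
    parallel (monodromySystem μ) p z =
      ((μ (Multiplicative.ofAdd (loopClass rfl p)) : Kˣ) : K) * z := by
  rw [← closedUpClass_loop]
  rfl

end Monodromy

/-! ## Betti numbers -/

section Betti

variable (X : Type u) [TopologicalSpace X]

/-- `H_s(X; ℂ^μ)`, the homology of `X` with coefficients in the local system `ℂ^μ`. -/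
abbrev complexTwistedHomology (μ : Multiplicative (H1 X) →* ℂˣ) (s : ℕ) : ModuleCat.{u} ℂ :=
  twistedHomology (monodromySystem μ) s

/-- `H_s(X; P)`, the untwisted singular homology of `X` with coefficients in `P`. -/
abbrev untwistedHomology (P : Type v) [Field P] (s : ℕ) : ModuleCat.{max u v} P :=
  ((singularHomologyFunctor.{u} (ModuleCat.{max u v} P) s).obj
    (ModuleCat.of P (ULift.{u} P))).obj (TopCat.of X)

/-- The twisted Betti number `dim_ℂ H_s(X; ℂ^μ)`, which is zero in negative degrees. -/
def twistedBetti (μ : Multiplicative (H1 X) →* ℂˣ) (s : ℤ) : ℕ :=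
  if 0 ≤ s then Module.finrank ℂ (complexTwistedHomology X μ s.toNat) else 0

/-- The Betti number `dim_P H_s(X; P)`, which is zero in negative degrees. -/
def untwistedBetti (P : Type v) [Field P] (s : ℤ) : ℕ :=
  if 0 ≤ s then Module.finrank P (untwistedHomology X P s.toNat) else 0

end Betti

end TwistedHomology

end

noncomputable section

namespace TwistedHomology

/-! ## Complexes homotopy equivalent to degreewise finite free ones -/

section FiniteFree

open Limits Pretriangulated HomologicalComplex ZeroObject

variable {R : Type w} [CommRing R]

/-! Let `R` be the ring generated by the values of `μ`. Both homologies come from one complex over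
`R`: the free modules on the singular simplices of `X`, with differential twisted by `μ`. Extension
of scalars along `R ⊂ ℂ` turns it into the chains of `ℂ^μ`; along `h`, which sends every value of
`μ` to `1`, it becomes the untwisted complex over `P` (`Piece.baseChangeIso`, `twisted_d`,
`untwisted_d`).

Over `R` this complex is homotopy equivalent to a complex `F` of finite free modules
(`Piece.isFiniteFree_univ`). Homotopy equivalences survive every base change, so the two homologies
are those of `F ⊗ ℂ` and `F ⊗ P`, hence finite-dimensional. In degree `s` both complexes have the
same dimension `c s`, and the homology has dimension `c s - ρ s - ρ (s + 1)`, with `ρ s` the rank of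
the differential leaving degree `s`. A minor that is nonzero in `P` is nonzero in `R`, hence in `ℂ`,
so the ranks over `P` are at most those over `ℂ` (`rank_map_le`). In an alternating sum with an odd
number of terms the ranks telescope to minus the two end ones (`alternating_sum_betti`), which gives
the inequality.

The complex `F` is obtained without cellular chains. Being homotopy equivalent to a finite free
complex passes through degreewise split exact sequences, by mapping cones. Relative singular chains
are shown contractible by an operator `T` with `dT + Td = 1 - ρ` and `ρ` locally nilpotent
(`Piece.isFiniteFree_of_homotopy`); this yields invariance under deformation
(`Piece.IsFiniteFree.of_deformation`) and Mayer-Vietoris (`Piece.IsFiniteFree.of_cover`). The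
operators come from universal chains in prisms, constructed by coning. Finally the cells are
attached one at a time (`Piece.IsFiniteFree.union_cell`). -/

/-- All the terms of the complex are finite free modules. -/
def DegreewiseFiniteFree (F : CochainComplex (ModuleCat.{v} R) ℤ) : Prop :=
  ∀ i, Module.Finite R (F.X i) ∧ Module.Free R (F.X i)

/-- Objects of the homotopy category which are represented by degreewise finite free complexes. -/
def IsFiniteFree (K : HomotopyCategory (ModuleCat.{v} R) (ComplexShape.up ℤ)) : Prop :=
  ∃ F : CochainComplex (ModuleCat.{v} R) ℤ, DegreewiseFiniteFree F ∧
    Nonempty (K ≅ (HomotopyCategory.quotient _ _).obj F)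

theorem IsFiniteFree.shift {K : HomotopyCategory (ModuleCat.{v} R) (ComplexShape.up ℤ)}
    (hK : IsFiniteFree K) (n : ℤ) : IsFiniteFree (K⟦n⟧) := by
  obtain ⟨F, hF, ⟨i⟩⟩ := hK
  exact ⟨F⟦n⟧, fun j => hF (j + n),
    ⟨(shiftFunctor _ n).mapIso i ≪≫ ((HomotopyCategory.quotient _ _).commShiftIso n).symm.app F⟩⟩

theorem isFiniteFree_of_isZero {K : HomotopyCategory (ModuleCat.{v} R) (ComplexShape.up ℤ)}
    (hK : IsZero K) : IsFiniteFree K := by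
  refine ⟨0, fun i => ?_, ⟨hK.iso ((HomotopyCategory.quotient _ _).map_isZero (isZero_zero _))⟩⟩
  have h : IsZero ((0 : CochainComplex (ModuleCat.{v} R) ℤ).X i) :=
    (HomologicalComplex.eval _ _ i).map_isZero (isZero_zero _)
  have := ModuleCat.subsingleton_of_isZero h
  exact ⟨inferInstance, inferInstance⟩

/-- The quotient functor is full, so the first morphism is represented by a chain map between finite
free complexes; the third vertex is then its mapping cone, with terms `F.X (n + 1) ⊞ G.X n`. -/
theorem IsFiniteFree.obj₃ {T : Triangle (HomotopyCategory (ModuleCat.{v} R) (ComplexShape.up ℤ))}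
    (hT : T ∈ distTriang _) (h₁ : IsFiniteFree T.obj₁) (h₂ : IsFiniteFree T.obj₂) :
    IsFiniteFree T.obj₃ := by
  obtain ⟨F, hF, ⟨i⟩⟩ := h₁
  obtain ⟨G, hG, ⟨j⟩⟩ := h₂
  obtain ⟨f, hf⟩ := (HomotopyCategory.quotient _ _).map_surjective (i.inv ≫ T.mor₁ ≫ j.hom)
  refine ⟨CochainComplex.mappingCone f, fun n => ?_, ?_⟩
  · have e := (homotopyCofiber.XIsoBiprod f n (n + 1) rfl ≪≫
      ModuleCat.biprodIsoProd _ _).toLinearEquiv.symm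
    have h1 := hF (n + 1)
    have h2 := hG n
    have := h1.1
    have := h1.2
    have := h2.1
    have := h2.2
    exact ⟨Module.Finite.equiv e, Module.Free.of_equiv e⟩
  · have h := HomotopyCategory.mappingCone_triangleh_distinguished f
    exact ⟨Triangle.π₃.mapIso (isoTriangleOfIso₁₂ T _ hT h i j (by
      change T.mor₁ ≫ j.hom = i.hom ≫ (HomotopyCategory.quotient _ _).map f
      rw [hf, Iso.hom_inv_id_assoc]))⟩

/-- Rotation makes the middle vertex the third one of a triangle starting at `T.obj₃⟦-1⟧`. -/
theorem IsFiniteFree.obj₂ {T : Triangle (HomotopyCategory (ModuleCat.{v} R) (ComplexShape.up ℤ))}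
    (hT : T ∈ distTriang _) (h₁ : IsFiniteFree T.obj₁) (h₃ : IsFiniteFree T.obj₃) :
    IsFiniteFree T.obj₂ :=
  IsFiniteFree.obj₃ (T := T.invRotate) (inv_rot_of_distTriang _ hT) (h₃.shift (-1)) h₁

/-- A chain complex which is homotopy equivalent to a degreewise finite free complex. -/
def IsFiniteFreeUpToHomotopy (K : ChainComplex (ModuleCat.{v} R) ℕ) : Prop :=
  IsFiniteFree ((HomotopyCategory.quotient _ _).obj (K.extend ComplexShape.embeddingDownNat))

/-- Triangles are attached to degreewise split sequences of complexes indexed by `ℤ`. In degrees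
reached by the embedding the splitting is transported; elsewhere every term vanishes and zero maps
split. -/
theorem exists_splitting_eval_extend (S : ShortComplex (ChainComplex (ModuleCat.{v} R) ℕ))
    (σ : ∀ n, (S.map (HomologicalComplex.eval _ _ n)).Splitting) (i : ℤ) :
    Nonempty (((S.map (ComplexShape.embeddingDownNat.extendFunctor (ModuleCat.{v} R))).map
      (HomologicalComplex.eval _ _ i)).Splitting) := by
  by_cases hi : ∃ n, ComplexShape.embeddingDownNat.f n = i
  · obtain ⟨n, hn⟩ := hi
    exact ⟨(σ n).ofIso (ShortComplex.isoMk (S.X₁.extendXIso _ hn).symm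
      (S.X₂.extendXIso _ hn).symm (S.X₃.extendXIso _ hn).symm
      (by
        change (S.X₁.extendXIso _ hn).inv ≫ (HomologicalComplex.extendMap S.f _).f i = _
        rw [HomologicalComplex.extendMap_f S.f _ hn, Iso.inv_hom_id_assoc]
        rfl)
      (by
        change (S.X₂.extendXIso _ hn).inv ≫ (HomologicalComplex.extendMap S.g _).f i = _
        rw [HomologicalComplex.extendMap_f S.g _ hn, Iso.inv_hom_id_assoc]
        rfl))⟩
  · have h (K : ChainComplex (ModuleCat.{v} R) ℕ) :
        IsZero ((K.extend ComplexShape.embeddingDownNat).X i) :=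
      K.isZero_extend_X _ i fun n hn => hi ⟨n, hn⟩
    exact ⟨{ r := 0, s := 0, f_r := (h S.X₁).eq_of_src _ _, s_g := (h S.X₃).eq_of_src _ _,
             id := (h S.X₂).eq_of_src _ _ }⟩

theorem trianglehExtend_distinguished (S : ShortComplex (ChainComplex (ModuleCat.{v} R) ℕ))
    (σ : ∀ n, (S.map (HomologicalComplex.eval _ _ n)).Splitting) :
    CochainComplex.trianglehOfDegreewiseSplit
      (S.map (ComplexShape.embeddingDownNat.extendFunctor (ModuleCat.{v} R)))
      (fun i => (exists_splitting_eval_extend S σ i).some) ∈ distTriang _ :=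
  (HomotopyCategory.distinguished_iff_iso_trianglehOfDegreewiseSplit _).mpr
    ⟨_, _, ⟨Iso.refl _⟩⟩

theorem IsFiniteFreeUpToHomotopy.X₃ (S : ShortComplex (ChainComplex (ModuleCat.{v} R) ℕ))
    (σ : ∀ n, (S.map (HomologicalComplex.eval _ _ n)).Splitting)
    (h₁ : IsFiniteFreeUpToHomotopy S.X₁) (h₂ : IsFiniteFreeUpToHomotopy S.X₂) :
    IsFiniteFreeUpToHomotopy S.X₃ :=
  IsFiniteFree.obj₃ (trianglehExtend_distinguished S σ) h₁ h₂

theorem IsFiniteFreeUpToHomotopy.X₂ (S : ShortComplex (ChainComplex (ModuleCat.{v} R) ℕ))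
    (σ : ∀ n, (S.map (HomologicalComplex.eval _ _ n)).Splitting)
    (h₁ : IsFiniteFreeUpToHomotopy S.X₁) (h₃ : IsFiniteFreeUpToHomotopy S.X₃) :
    IsFiniteFreeUpToHomotopy S.X₂ :=
  IsFiniteFree.obj₂ (trianglehExtend_distinguished S σ) h₁ h₃

theorem isFiniteFreeUpToHomotopy_of_finite_free (K : ChainComplex (ModuleCat.{v} R) ℕ)
    (h : ∀ n, Module.Finite R (K.X n) ∧ Module.Free R (K.X n)) : IsFiniteFreeUpToHomotopy K := by
  refine ⟨_, fun i => ?_, ⟨Iso.refl _⟩⟩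
  by_cases hi : ∃ n, ComplexShape.embeddingDownNat.f n = i
  · obtain ⟨n, hn⟩ := hi
    have e := (K.extendXIso _ hn).symm.toLinearEquiv
    have := (h n).1
    have := (h n).2
    exact ⟨Module.Finite.equiv e, Module.Free.of_equiv e⟩
  · have := ModuleCat.subsingleton_of_isZero
      (K.isZero_extend_X ComplexShape.embeddingDownNat i fun n hn => hi ⟨n, hn⟩)
    exact ⟨inferInstance, inferInstance⟩

/-- A complex with a null-homotopic automorphism is contractible. -/
theorem isFiniteFreeUpToHomotopy_of_homotopy {K : ChainComplex (ModuleCat.{v} R) ℕ} (f : K ⟶ K)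
    [IsIso f] (h : Homotopy f 0) : IsFiniteFreeUpToHomotopy K := by
  apply isFiniteFree_of_isZero
  rw [HomotopyCategory.isZero_quotient_obj_iff]
  -- From `f ≃ 0` follows `𝟙 K = inv f ≫ f ≃ 0`.
  have h' : Homotopy (𝟙 K) 0 :=
    (Homotopy.ofEq (IsIso.inv_hom_id f).symm).trans
      ((h.compLeft (inv f)).trans (Homotopy.ofEq comp_zero))
  exact ⟨(Homotopy.ofEq (HomologicalComplex.extendMap_id K _).symm).trans
    ((h'.extend _).trans (Homotopy.ofEq (HomologicalComplex.extendMap_zero _ _ _)))⟩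

/-- A complex is contractible if it has a homotopy operator `T` for which `dT + Td` is bijective
in all degrees. -/
theorem isFiniteFreeUpToHomotopy_of_bijective {K : ChainComplex (ModuleCat.{v} R) ℕ}
    (T : ∀ n, K.X n ⟶ K.X (n + 1)) (h0 : Function.Bijective (T 0 ≫ K.d 1 0).hom)
    (hs : ∀ n, Function.Bijective (K.d (n + 1) n ≫ T n + T (n + 1) ≫ K.d (n + 2) (n + 1)).hom) :
    IsFiniteFreeUpToHomotopy K := by
  let t (i j : ℕ) (hij : (ComplexShape.down ℕ).Rel j i) : K.X i ⟶ K.X j :=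
    T i ≫ eqToHom (by rw [← hij])
  have iso (n : ℕ) : IsIso ((Homotopy.nullHomotopicMap' t).f n) := by
    rw [ConcreteCategory.isIso_iff_bijective]
    cases n with
    | zero =>
      rw [Homotopy.nullHomotopicMap'_f_of_not_rel_left (k₁ := 1) (k₀ := 0) rfl (by simp)]
      simpa [t] using h0
    | succ n =>
      rw [Homotopy.nullHomotopicMap'_f (k₂ := n + 2) (k₁ := n + 1) (k₀ := n) rfl rfl]
      simpa [t] using hs n
  have : IsIso (Homotopy.nullHomotopicMap' t) := HomologicalComplex.Hom.isIso_of_components _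
  exact isFiniteFreeUpToHomotopy_of_homotopy _ (Homotopy.nullHomotopy' t)

end FiniteFree

end TwistedHomology

end

noncomputable section

namespace TwistedHomology

/-! ## Compression of linear maps to subsets of bases -/

section Compress

variable {R : Type*} [CommRing R] {α β γ : Type*}

theorem map_mem_supported {f : (α →₀ R) →ₗ[R] (β →₀ R)} {s : Set α} {t : Set β}
    (h : ∀ a ∈ s, f (Finsupp.single a 1) ∈ Finsupp.supported R R t) {x : α →₀ R}
    (hx : x ∈ Finsupp.supported R R s) : f x ∈ Finsupp.supported R R t := by
  rw [Finsupp.supported_eq_span_single] at hx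
  have : Submodule.span R ((fun i => Finsupp.single i (1 : R)) '' s) ≤
      (Finsupp.supported R R t).comap f := by
    rw [Submodule.span_le]
    rintro _ ⟨a, ha, rfl⟩
    exact h a ha
  exact this hx

/-- The block of the linear map `f` with rows in `t` and columns in `s`. -/
def compress (s : Set α) (t : Set β) (f : (α →₀ R) →ₗ[R] (β →₀ R)) : (s →₀ R) →ₗ[R] (t →₀ R) :=
  (Finsupp.lsubtypeDomain t).comp (f.comp (Finsupp.lmapDomain R R Subtype.val))

theorem compress_single (s : Set α) (t : Set β) (f : (α →₀ R) →ₗ[R] (β →₀ R)) (a : s) :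
    compress s t f (Finsupp.single a 1) =
      Finsupp.lsubtypeDomain (R := R) t (f (Finsupp.single a.1 1)) := by
  simp [compress]

theorem lsubtypeDomain_eq_zero {t : Set β} {x : β →₀ R} (hx : x ∈ Finsupp.supported R R tᶜ) :
    Finsupp.lsubtypeDomain (R := R) t x = 0 := by
  ext b
  exact (Finsupp.mem_supported' R x).mp hx b.1 fun h => h b.2

theorem lmapDomain_lsubtypeDomain_apply (t : Set β) (x : β →₀ R) (b : β) [Decidable (b ∈ t)] :
    Finsupp.lmapDomain R R Subtype.val (Finsupp.lsubtypeDomain (R := R) t x) b =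
      if b ∈ t then x b else 0 := by
  split_ifs with hb
  · exact Finsupp.mapDomain_apply Subtype.val_injective _ (⟨b, hb⟩ : t)
  · refine Finsupp.mapDomain_of_notMem_range _ _ ?_
    simpa using hb

theorem sub_lmapDomain_mem_supported {s t : Set β} {x : β →₀ R}
    (hx : x ∈ Finsupp.supported R R s) :
    x - Finsupp.lmapDomain R R Subtype.val (Finsupp.lsubtypeDomain (R := R) t x) ∈
      Finsupp.supported R R (s \ t) := by
  classical
  rw [Finsupp.mem_supported']
  intro b hb
  rw [Finsupp.sub_apply, lmapDomain_lsubtypeDomain_apply]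
  split_ifs with h
  · exact sub_self _
  · rw [sub_zero]
    exact (Finsupp.mem_supported' R x).mp hx b fun hs => hb ⟨hs, h⟩

/-- The two sides differ by what passes through basis elements outside `t`. Since `f` only reaches
`Z` from `s`, these lie in `Z \ t`, and `g` sends them away from `k`. -/
theorem compress_comp {s : Set α} {t : Set β} {k : Set γ} {f : (α →₀ R) →ₗ[R] (β →₀ R)}
    {g : (β →₀ R) →ₗ[R] (γ →₀ R)} (Z : Set β)
    (hf : ∀ a ∈ s, f (Finsupp.single a 1) ∈ Finsupp.supported R R Z)
    (hg : ∀ b ∈ Z \ t, g (Finsupp.single b 1) ∈ Finsupp.supported R R kᶜ) :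
    compress t k g ∘ₗ compress s t f = compress s k (g ∘ₗ f) := by
  ext a : 2
  simp only [LinearMap.comp_apply, Finsupp.lsingle_apply, compress_single]
  rw [compress, LinearMap.comp_apply, LinearMap.comp_apply, ← sub_eq_zero, ← map_sub, ← map_sub,
    ← neg_sub, map_neg, map_neg, neg_eq_zero]
  exact lsubtypeDomain_eq_zero
    (map_mem_supported hg (sub_lmapDomain_mem_supported (hf a.1 a.2)))

theorem compress_id (s : Set α) :
    compress s s (LinearMap.id : (α →₀ R) →ₗ[R] (α →₀ R)) = LinearMap.id := by
  ext a : 2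
  simp only [LinearMap.comp_apply, Finsupp.lsingle_apply, compress_single]
  ext b
  classical
  change Finsupp.single a.1 (1 : R) b.1 = Finsupp.single a 1 b
  simp [Finsupp.single_apply, Subtype.ext_iff]

theorem compress_id_comp {s t k : Set α} (h : s ⊆ t ∨ k ⊆ t) :
    compress t k (LinearMap.id : (α →₀ R) →ₗ[R] (α →₀ R)) ∘ₗ compress s t LinearMap.id =
      compress s k LinearMap.id :=
  compress_comp s (fun _ ha => Finsupp.single_mem_supported R _ ha) fun _ hb =>
    Finsupp.single_mem_supported R _ fun hk => hb.2 (h.elim (fun h => h hb.1) fun h => h hk)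

theorem compress_add (s : Set α) (t : Set β) (f g : (α →₀ R) →ₗ[R] (β →₀ R)) :
    compress s t (f + g) = compress s t f + compress s t g := by
  simp [compress, LinearMap.add_comp, LinearMap.comp_add]

theorem compress_congr {s : Set α} {t : Set β} {f g : (α →₀ R) →ₗ[R] (β →₀ R)}
    (h : ∀ a ∈ s, f (Finsupp.single a 1) = g (Finsupp.single a 1)) :
    compress s t f = compress s t g := by
  ext a : 2
  simp only [LinearMap.comp_apply, Finsupp.lsingle_apply, compress_single, h a.1 a.2]

theorem compress_eq_zero {s : Set α} {t : Set β} {f : (α →₀ R) →ₗ[R] (β →₀ R)}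
    (h : ∀ a ∈ s, f (Finsupp.single a 1) ∈ Finsupp.supported R R tᶜ) : compress s t f = 0 := by
  ext a : 2
  simp only [LinearMap.comp_apply, Finsupp.lsingle_apply, compress_single,
    lsubtypeDomain_eq_zero (h a.1 a.2), LinearMap.zero_apply]

theorem compress_split (s L : Set α) :
    compress (s ∩ L) s (LinearMap.id : (α →₀ R) →ₗ[R] (α →₀ R)) ∘ₗ
        compress s (s ∩ L) LinearMap.id +
      compress (s \ L) s LinearMap.id ∘ₗ compress s (s \ L) LinearMap.id = LinearMap.id := by
  classical
  refine Finsupp.lhom_ext' fun a => LinearMap.ext_ring ?_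
  simp only [LinearMap.comp_apply, Finsupp.lsingle_apply, LinearMap.add_apply,
    LinearMap.id_apply]
  ext b
  simp only [compress, LinearMap.comp_apply, LinearMap.id_apply, Finsupp.add_apply,
    Finsupp.lsubtypeDomain_apply s, Finsupp.subtypeDomain_apply, lmapDomain_lsubtypeDomain_apply]
  have h2 : (Finsupp.lmapDomain R R Subtype.val (Finsupp.single a (1 : R))) b.1 =
      Finsupp.single a (1 : R) b := Finsupp.mapDomain_apply Subtype.val_injective _ b
  rw [h2]
  by_cases hb : b.1 ∈ L
  · rw [if_pos ⟨b.2, hb⟩, if_neg fun h => h.2 hb, add_zero]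
  · rw [if_neg fun h => hb h.2, if_pos ⟨b.2, hb⟩, zero_add]

/-- If `f` is locally nilpotent, then `1 - f` is bijective. -/
theorem bijective_one_sub {M : Type*} [AddCommGroup M] [Module R M] (f : Module.End R M)
    (hf : ∀ x, ∃ m : ℕ, (f ^ m) x = 0) : Function.Bijective ⇑(1 - f) := by
  constructor
  · rw [injective_iff_map_eq_zero]
    intro x hx
    have h1 : f x = x := by
      rw [LinearMap.sub_apply, Module.End.one_apply, sub_eq_zero] at hx
      exact hx.symm
    obtain ⟨m, hm⟩ := hf x
    have h2 : ∀ k : ℕ, (f ^ k) x = x := by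
      intro k
      induction k with
      | zero => rfl
      | succ k ih => rw [pow_succ, Module.End.mul_apply, h1, ih]
    rw [← h2 m, hm]
  · intro y
    obtain ⟨m, hm⟩ := hf y
    -- The geometric series for the inverse, cut off where it stops on `y`.
    refine ⟨(∑ i ∈ Finset.range m, f ^ i) y, ?_⟩
    rw [← Module.End.mul_apply, mul_neg_geom_sum, LinearMap.sub_apply, hm, sub_zero,
      Module.End.one_apply]

/-- The exponents need not be bounded over the basis; finite supports suffice. -/
theorem locally_nilpotent_of_single (f : Module.End R (α →₀ R))
    (hf : ∀ a, ∃ m : ℕ, (f ^ m) (Finsupp.single a 1) = 0) (x : α →₀ R) :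
    ∃ m : ℕ, (f ^ m) x = 0 := by
  induction x using Finsupp.induction_linear with
  | zero => exact ⟨0, map_zero _⟩
  | add x y hx hy =>
    obtain ⟨m, hm⟩ := hx
    obtain ⟨k, hk⟩ := hy
    refine ⟨m + k, ?_⟩
    rw [map_add, pow_add, Module.End.mul_apply, Module.End.mul_apply, hk, map_zero, add_zero,
      ← Module.End.mul_apply, ← pow_add, add_comm, pow_add, Module.End.mul_apply, hm, map_zero]
  | single a r =>
    obtain ⟨m, hm⟩ := hf a
    refine ⟨m, ?_⟩
    rw [← mul_one r, ← smul_eq_mul, ← Finsupp.smul_single, map_smul, hm, smul_zero]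

/-- Both `Z` and `W` span invariant submodules, so the block on `s = Z \ W` is the operator induced
on the quotient, and powers pass to quotients. -/
theorem compress_pow (s Z W : Set α) (f : Module.End R (α →₀ R)) (hs : s = Z \ W)
    (hZ : ∀ a ∈ Z, f (Finsupp.single a 1) ∈ Finsupp.supported R R Z)
    (hW : ∀ a ∈ W, f (Finsupp.single a 1) ∈ Finsupp.supported R R W) (m : ℕ) :
    (compress s s f ^ m : Module.End R (s →₀ R)) = compress s s (f ^ m) := by
  induction m with
  | zero => exact (compress_id s).symm
  | succ m ih =>
    rw [pow_succ', ih, pow_succ']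
    refine compress_comp Z (fun a ha => ?_) fun b hb => ?_
    · have : ∀ k : ℕ, (f ^ k) (Finsupp.single a 1) ∈ Finsupp.supported R R Z := by
        intro k
        induction k with
        | zero => exact Finsupp.single_mem_supported R _ (hs ▸ ha : a ∈ Z \ W).1
        | succ k ihk =>
          rw [pow_succ', Module.End.mul_apply]
          exact map_mem_supported hZ ihk
      exact this m
    · subst hs
      have hbW : b ∈ W := by
        by_contra h
        exact hb.2 ⟨hb.1, h⟩
      exact Finsupp.supported_mono (fun c hc h => h.2 hc) (hW b hbW)

end Compress

/-- The cancellation behind `d ∘ d = 0`, needed both for singular chains and for vertical faces of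
prisms: a pair `(j, i)` with `i ≤ j` is matched with `(i, j + 1)`, which carries the opposite sign.
-/
theorem alternating_sum_eq_zero {A : Type*} [AddCommGroup A] {n : ℕ}
    (F : Fin (n + 2) → Fin (n + 3) → A)
    (hF : ∀ i j : Fin (n + 2), i ≤ j → F i j.succ = F j i.castSucc) :
    ∑ i : Fin (n + 3), ∑ j : Fin (n + 2), (-1 : ℤ) ^ (i.val + j.val) • F j i = 0 := by
  rw [Finset.sum_comm, ← Finset.sum_product']
  let P := Fin (n + 2) × Fin (n + 3)
  let S : Finset P := Finset.univ.filter fun ij : P => (ij.2 : ℕ) ≤ (ij.1 : ℕ)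
  rw [Finset.univ_product_univ, ← Finset.sum_add_sum_compl S, ← eq_neg_iff_add_eq_zero,
    ← Finset.sum_neg_distrib]
  let φ : ∀ ij : P, ij ∈ S → P := fun ij hij =>
    (Fin.castLT ij.2 (lt_of_le_of_lt (Finset.mem_filter.mp hij).right (Fin.is_lt ij.1)), ij.1.succ)
  apply Finset.sum_bij φ
  · intro ij hij
    simp_rw [S, φ, Finset.compl_filter, Finset.mem_filter_univ, Fin.val_succ,
      Fin.val_castLT] at hij ⊢
    lia
  · rintro ⟨i, j⟩ hij ⟨i', j'⟩ hij' h
    rw [Prod.mk_inj]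
    exact ⟨by simpa [φ] using! congr_arg Prod.snd h,
      by simpa [φ, Fin.castSucc_castLT] using! congr_arg Fin.castSucc (congr_arg Prod.fst h)⟩
  · rintro ⟨i', j'⟩ hij'
    simp_rw [S, Finset.compl_filter, Finset.mem_filter_univ, not_le] at hij'
    refine ⟨(j'.pred <| ?_, Fin.castSucc i'), ?_, ?_⟩
    · rintro rfl
      simp only [Fin.val_zero, not_lt_zero] at hij'
    · simpa [S] using! Nat.le_sub_one_of_lt hij'
    · simp only [φ, Fin.castLT_castSucc, Fin.succ_pred]
  · rintro ⟨i, j⟩ hij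
    have hij' : j.val ≤ i.val := (Finset.mem_filter.mp hij).2
    simp only [φ]
    rw [hF _ i (by simpa [Fin.le_def] using hij'), Fin.castSucc_castLT, ← neg_smul]
    congr 1
    simp only [Fin.val_succ, Fin.val_castLT]
    ring

/-! ## Singular chains with weights -/

section Weights

variable {X : Type u} [TopologicalSpace X] {R : Type w} [CommRing R]

/-- A multiplicative function on homotopy classes of paths. -/
structure Weight (R : Type w) [CommRing R] (X : Type u) [TopologicalSpace X] where
  /-- The weight of a path class. -/
  val : ∀ {x y : X}, Path.Homotopic.Quotient x y → R
  val_refl : ∀ x : X, val (Path.Homotopic.Quotient.refl x) = 1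
  val_trans : ∀ {x y z : X} (p : Path.Homotopic.Quotient x y) (q : Path.Homotopic.Quotient y z),
    val (p.trans q) = val p * val q

/-- The weight of the image under `g` of a path from `a` to `b` in a simply connected space. -/
def Weight.along (ω : Weight R X) {M : Type*} [TopologicalSpace M] [SimplyConnectedSpace M]
    (g : C(M, X)) (a b : M) : R :=
  ω.val ((Path.Homotopic.Quotient.mk (PathConnectedSpace.somePath a b)).map g)

namespace Weight

variable (ω : Weight R X) {M N : Type*} [TopologicalSpace M] [SimplyConnectedSpace M]
  [TopologicalSpace N] [SimplyConnectedSpace N]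

/-- In a simply connected space there is only one path class between two points, so the chosen path
is immaterial. -/
theorem along_eq (g : C(M, X)) {a b : M} (p : Path.Homotopic.Quotient a b) :
    ω.along g a b = ω.val (p.map g) :=
  congrArg (fun p => ω.val (Path.Homotopic.Quotient.map p g)) (Subsingleton.elim _ p)

theorem along_self (g : C(M, X)) (a : M) : ω.along g a a = 1 :=
  (ω.along_eq g (Path.Homotopic.Quotient.refl a)).trans (ω.val_refl (g a))

theorem along_mul (g : C(M, X)) (a b c : M) :
    ω.along g a b * ω.along g b c = ω.along g a c := by
  have p : Path.Homotopic.Quotient a b := .mk (PathConnectedSpace.somePath a b)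
  have q : Path.Homotopic.Quotient b c := .mk (PathConnectedSpace.somePath b c)
  rw [ω.along_eq g p, ω.along_eq g q, ω.along_eq g (p.trans q), ← ω.val_trans]
  exact congrArg ω.val ((FundamentalGroupoid.map g).map_comp
    (FundamentalGroupoid.fromPath p) (FundamentalGroupoid.fromPath q)).symm

theorem along_comp (g : C(N, X)) (φ : C(M, N)) (a b : M) :
    ω.along (g.comp φ) a b = ω.along g (φ a) (φ b) := by
  have p : Path.Homotopic.Quotient a b := .mk (PathConnectedSpace.somePath a b)
  rw [ω.along_eq _ p, ω.along_eq g (p.map φ), Path.Homotopic.Quotient.map_comp]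

theorem along_const (x : X) (a b : M) : ω.along (ContinuousMap.const M x) a b = 1 := by
  have h : ContinuousMap.const M x = (ContinuousMap.const M x).comp (ContinuousMap.const M a) := rfl
  rw [h, along_comp]
  exact ω.along_self _ a

end Weight

/-- The `i`-th face of the topological `(n + 1)`-simplex. -/
def face {n : ℕ} (i : Fin (n + 2)) : C(Simp n, Simp (n + 1)) := simpMap (SimplexCategory.δ i)

theorem face_comp_face {n : ℕ} {i j : Fin (n + 2)} (h : i ≤ j) :
    (face j.succ).comp (face i) = (face i.castSucc).comp (face j) := by
  have := congrArg simpMap (SimplexCategory.δ_comp_δ h)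
  rwa [simpMap_comp, simpMap_comp] at this

/-- Singular chains. -/
abbrev Chains (R : Type w) [CommRing R] (X : Type u) [TopologicalSpace X] (n : ℕ) :
    Type (max u w) :=
  C(Simp n, X) →₀ R

/-- The differential of singular chains, twisted by a weight. -/
def Weight.d (ω : Weight R X) (n : ℕ) : Chains R X (n + 1) →ₗ[R] Chains R X n :=
  Finsupp.linearCombination R fun σ => ∑ i : Fin (n + 2), (-1 : ℤ) ^ i.val •
    Finsupp.single (σ.comp (face i)) (ω.along σ (center (n + 1)) (face i (center n)))

theorem Weight.d_single (ω : Weight R X) {n : ℕ} (σ : C(Simp (n + 1), X)) :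
    ω.d n (Finsupp.single σ 1) = ∑ i : Fin (n + 2), (-1 : ℤ) ^ i.val •
      Finsupp.single (σ.comp (face i)) (ω.along σ (center (n + 1)) (face i (center n))) := by
  rw [Weight.d, Finsupp.linearCombination_single, one_smul]

/-- The weights of two successive faces multiply to one that depends only on the composite face, so
the simplicial identities cancel the terms as in the untwisted case. -/
theorem Weight.d_comp_d (ω : Weight R X) (n : ℕ) : ω.d n ∘ₗ ω.d (n + 1) = 0 := by
  ext σ : 2
  simp only [LinearMap.comp_apply, Finsupp.lsingle_apply, LinearMap.zero_apply]
  rw [Weight.d_single, map_sum]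
  refine Eq.trans ?_ (alternating_sum_eq_zero (n := n) (fun j i => Finsupp.single
    (σ.comp ((face i).comp (face j)))
    (ω.along σ (center (n + 2)) (((face i).comp (face j)) (center n)))) ?_)
  · refine Finset.sum_congr rfl fun i _ => ?_
    rw [map_zsmul]
    have (τ : C(Simp (n + 1), X)) (r : R) :
        (Finsupp.single τ r : Chains R X (n + 1)) = r • Finsupp.single τ 1 := by
      rw [Finsupp.smul_single, smul_eq_mul, mul_one]
    rw [this, map_smul, Weight.d_single, Finset.smul_sum, Finset.smul_sum]
    refine Finset.sum_congr rfl fun j _ => ?_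
    rw [pow_add, mul_smul, smul_comm _ ((-1 : ℤ) ^ j.val), Finsupp.smul_single, smul_eq_mul,
      along_comp, along_mul]
    rfl
  · intro i j hij
    simp only [face_comp_face hij]

/-! ## Complexes attached to sets of singular simplices -/

/-- The family of sets of simplices is closed under faces. -/
def FaceClosed (D : ∀ n, Set C(Simp n, X)) : Prop :=
  ∀ ⦃n : ℕ⦄ (σ : C(Simp (n + 1), X)) (i : Fin (n + 2)), σ ∈ D (n + 1) → σ.comp (face i) ∈ D n

theorem FaceClosed.d_mem {D : ∀ n, Set C(Simp n, X)} (hD : FaceClosed D) (ω : Weight R X) {n : ℕ}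
    {σ : C(Simp (n + 1), X)} (hσ : σ ∈ D (n + 1)) :
    ω.d n (Finsupp.single σ 1) ∈ Finsupp.supported R R (D n) := by
  rw [Weight.d_single]
  exact Submodule.sum_mem _ fun i _ =>
    zsmul_mem (Finsupp.single_mem_supported R _ (hD σ i hσ)) _

variable (X) in
/-- A difference of two families of simplices closed under faces. -/
structure Piece where
  /-- The set of simplices of dimension `n`. -/
  carrier : ∀ n, Set C(Simp n, X)
  exists_eq : ∃ D₁ D₀ : ∀ n, Set C(Simp n, X), FaceClosed D₁ ∧ FaceClosed D₀ ∧
    ∀ n, carrier n = D₁ n \ D₀ n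

/-- The two closed families are only asserted to exist, so a piece is determined by its simplices;
pieces reached by different intersections and differences can thus be identified. -/
theorem Piece.ext' {E E' : Piece X} (h : ∀ n σ, σ ∈ E.carrier n ↔ σ ∈ E'.carrier n) : E = E' := by
  obtain ⟨c, _⟩ := E
  obtain ⟨c', _⟩ := E'
  obtain rfl : c = c' := funext fun n => Set.ext (h n)
  rfl

/-- The differential on the chains of a piece. -/
def Piece.d (E : Piece X) (ω : Weight R X) (n : ℕ) :
    (E.carrier (n + 1) →₀ R) →ₗ[R] (E.carrier n →₀ R) :=
  compress _ _ (ω.d n)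

/-- These are relative chains: a simplex of `D₁` missing from the piece lies in `D₀`, and its
boundary stays in `D₀`, which the compression discards. -/
theorem Piece.d_comp_d (E : Piece X) (ω : Weight R X) (n : ℕ) :
    E.d ω n ∘ₗ E.d ω (n + 1) = 0 := by
  obtain ⟨c, D₁, D₀, h₁, h₀, h⟩ := E
  unfold Piece.d
  dsimp only
  rw [compress_comp (D₁ (n + 1)) (fun σ hσ => h₁.d_mem ω (by rw [h] at hσ; exact hσ.1)) ?_,
    ω.d_comp_d]
  · exact compress_eq_zero fun σ _ => zero_mem _
  · intro σ hσ
    refine Finsupp.supported_mono (fun τ hτ hτ' => ?_) (h₀.d_mem ω (σ := σ) ?_)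
    · rw [h] at hτ'
      exact hτ'.2 hτ
    · by_contra hn
      exact hσ.2 (by rw [h]; exact ⟨hσ.1, hn⟩)

/-- The chain complex of a piece. -/
def Piece.complex (E : Piece X) (ω : Weight R X) : ChainComplex (ModuleCat.{max u w} R) ℕ :=
  ChainComplex.of (fun n => ModuleCat.of R (E.carrier n →₀ R))
    (fun n => ModuleCat.ofHom (E.d ω n)) fun n => by
      rw [← ModuleCat.ofHom_comp, E.d_comp_d]
      rfl

theorem Piece.complex_d (E : Piece X) (ω : Weight R X) (n : ℕ) :
    (E.complex ω).d (n + 1) n = ModuleCat.ofHom (E.d ω n) :=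
  ChainComplex.of_d (fun n => ModuleCat.of R (E.carrier n →₀ R))
    (fun n => ModuleCat.ofHom (E.d ω n)) n

/-- Under the hypothesis both composites equal the block of `ω.d n` from `E` to `E'`. It covers the
inclusion of a part closed under faces and the projection to its complement at once. -/
theorem Piece.d_comp_compress (E E' : Piece X) (ω : Weight R X)
    (h : ∀ (n : ℕ) (σ : C(Simp (n + 1), X)) (i : Fin (n + 2)), σ ∈ E.carrier (n + 1) →
      σ.comp (face i) ∈ E'.carrier n → σ ∈ E'.carrier (n + 1) ∧ σ.comp (face i) ∈ E.carrier n)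
    (n : ℕ) : E'.d ω n ∘ₗ compress (E.carrier (n + 1)) (E'.carrier (n + 1)) LinearMap.id =
      compress (E.carrier n) (E'.carrier n) LinearMap.id ∘ₗ E.d ω n := by
  have hd (σ : C(Simp (n + 1), X)) :
      ω.d n (Finsupp.single σ 1) ∈
        Finsupp.supported R R (Set.range fun i => σ.comp (face i)) := by
    rw [Weight.d_single]
    exact Submodule.sum_mem _ fun i _ =>
      zsmul_mem (Finsupp.single_mem_supported R _ (Set.mem_range_self i)) _
  have h₁ : E'.d ω n ∘ₗ compress (E.carrier (n + 1)) (E'.carrier (n + 1)) LinearMap.id =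
      compress (E.carrier (n + 1)) (E'.carrier n) (ω.d n ∘ₗ LinearMap.id) := by
    refine compress_comp (E.carrier (n + 1))
      (fun σ hσ => Finsupp.single_mem_supported R _ hσ) ?_
    rintro σ ⟨hσ, hσ'⟩
    refine Finsupp.supported_mono ?_ (hd σ)
    rintro _ ⟨i, rfl⟩ hi
    exact hσ' (h n σ i hσ hi).1
  have h₂ : compress (E.carrier n) (E'.carrier n) LinearMap.id ∘ₗ E.d ω n =
      compress (E.carrier (n + 1)) (E'.carrier n) (LinearMap.id ∘ₗ ω.d n) := by
    -- A piece need not contain the faces of its simplices, so the intermediate set consists of all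
    -- these faces.
    refine compress_comp (⋃ σ ∈ E.carrier (n + 1), Set.range fun i => σ.comp (face i)) ?_ ?_
    · intro σ hσ
      exact Finsupp.supported_mono (Set.subset_biUnion_of_mem
        (u := fun σ : C(Simp (n + 1), X) => Set.range fun i => σ.comp (face i)) hσ) (hd σ)
    · rintro τ ⟨hτ, hτ'⟩
      obtain ⟨σ, hσ, i, rfl⟩ := Set.mem_iUnion₂.mp hτ
      exact Finsupp.single_mem_supported R _ fun hi => hτ' (h n σ i hσ hi).2
  rw [h₁, h₂, LinearMap.id_comp, LinearMap.comp_id]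

/-- The inclusion or projection of chains of pieces. -/
def Piece.map (E E' : Piece X) (ω : Weight R X)
    (h : ∀ (n : ℕ) (σ : C(Simp (n + 1), X)) (i : Fin (n + 2)), σ ∈ E.carrier (n + 1) →
      σ.comp (face i) ∈ E'.carrier n → σ ∈ E'.carrier (n + 1) ∧ σ.comp (face i) ∈ E.carrier n) :
    E.complex ω ⟶ E'.complex ω :=
  ChainComplex.ofHom
    (fun n => ModuleCat.ofHom (compress (E.carrier n) (E'.carrier n) LinearMap.id)) fun n => by
      rw [Piece.complex_d, Piece.complex_d]
      exact ModuleCat.hom_ext (Piece.d_comp_compress E E' ω h n)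

/-- The piece of simplices of `E` which lie in a family closed under faces. -/
def Piece.inter (E : Piece X) {L : ∀ n, Set C(Simp n, X)} (hL : FaceClosed L) : Piece X where
  carrier n := E.carrier n ∩ L n
  exists_eq := by
    obtain ⟨D₁, D₀, h₁, h₀, h⟩ := E.exists_eq
    refine ⟨fun n => D₁ n ∩ L n, D₀, fun n σ i hσ => ⟨h₁ σ i hσ.1, hL σ i hσ.2⟩, h₀, fun n => ?_⟩
    rw [h]
    ext σ
    simp only [Set.mem_inter_iff, Set.mem_sdiff]
    tauto

/-- The piece of simplices of `E` which do not lie in a family closed under faces. -/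
def Piece.sdiff (E : Piece X) {L : ∀ n, Set C(Simp n, X)} (hL : FaceClosed L) : Piece X where
  carrier n := E.carrier n \ L n
  exists_eq := by
    obtain ⟨D₁, D₀, h₁, h₀, h⟩ := E.exists_eq
    refine ⟨D₁, fun n => D₀ n ∪ L n, h₁,
      fun n σ i hσ => hσ.imp (h₀ σ i) (hL σ i), fun n => ?_⟩
    rw [h, Set.sdiff_sdiff]

/-- The degreewise split short exact sequence of the two parts of a piece. -/
def Piece.shortComplex (E : Piece X) (ω : Weight R X) {L : ∀ n, Set C(Simp n, X)}
    (hL : FaceClosed L) : ShortComplex (ChainComplex (ModuleCat.{max u w} R) ℕ) where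
  X₁ := (E.inter hL).complex ω
  X₂ := E.complex ω
  X₃ := (E.sdiff hL).complex ω
  f := Piece.map _ _ ω fun n σ i hσ hi => ⟨hσ.1, hi, hL σ i hσ.2⟩
  g := Piece.map _ _ ω fun n σ i hσ hi => ⟨⟨hσ, fun h => hi.2 (hL σ i h)⟩, hi.1⟩
  zero := by
    ext n : 1
    refine ModuleCat.hom_ext ((compress_id_comp (Or.inl Set.inter_subset_left)).trans ?_)
    exact compress_eq_zero fun σ hσ => Finsupp.single_mem_supported R _ fun h => h.2 hσ.2

/-- The degreewise splitting of `Piece.shortComplex`. -/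
def Piece.splitting (E : Piece X) (ω : Weight R X) {L : ∀ n, Set C(Simp n, X)}
    (hL : FaceClosed L) (n : ℕ) :
    ((E.shortComplex ω hL).map (HomologicalComplex.eval _ _ n)).Splitting where
  r := ModuleCat.ofHom (compress (E.carrier n) (E.carrier n ∩ L n) LinearMap.id)
  s := ModuleCat.ofHom (compress (E.carrier n \ L n) (E.carrier n) LinearMap.id)
  f_r := ModuleCat.hom_ext
    ((compress_id_comp (Or.inl Set.inter_subset_left)).trans (compress_id _))
  s_g := ModuleCat.hom_ext
    ((compress_id_comp (Or.inl Set.sdiff_subset)).trans (compress_id _))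
  id := ModuleCat.hom_ext (compress_split (E.carrier n) (L n))

/-- The chain complex of the piece is homotopy equivalent to a degreewise finite free one. -/
def Piece.IsFiniteFree (E : Piece X) (ω : Weight R X) : Prop :=
  IsFiniteFreeUpToHomotopy (E.complex ω)

theorem Piece.IsFiniteFree.sdiff {E : Piece X} {ω : Weight R X} {L : ∀ n, Set C(Simp n, X)}
    (hL : FaceClosed L) (h : (E.inter hL).IsFiniteFree ω) (hE : E.IsFiniteFree ω) :
    (E.sdiff hL).IsFiniteFree ω :=
  IsFiniteFreeUpToHomotopy.X₃ (E.shortComplex ω hL) (E.splitting ω hL) h hE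

theorem Piece.IsFiniteFree.of_inter_of_sdiff {E : Piece X} {ω : Weight R X}
    {L : ∀ n, Set C(Simp n, X)} (hL : FaceClosed L) (h : (E.inter hL).IsFiniteFree ω)
    (h' : (E.sdiff hL).IsFiniteFree ω) : E.IsFiniteFree ω :=
  IsFiniteFreeUpToHomotopy.X₂ (E.shortComplex ω hL) (E.splitting ω hL) h h'

theorem Piece.isFiniteFree_of_finite (E : Piece X) (ω : Weight R X)
    (h : ∀ n, Finite (E.carrier n)) : E.IsFiniteFree ω := by
  refine isFiniteFreeUpToHomotopy_of_finite_free _ fun n => ?_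
  have := h n
  exact ⟨inferInstanceAs (Module.Finite R (E.carrier n →₀ R)),
    inferInstanceAs (Module.Free R (E.carrier n →₀ R))⟩

/-- A piece is contractible if it has a homotopy from the identity to a locally nilpotent
operator. -/
theorem Piece.isFiniteFree_of_homotopy (E : Piece X) (ω : Weight R X)
    {D₁ D₀ : ∀ n, Set C(Simp n, X)} (h₁ : FaceClosed D₁) (h₀ : FaceClosed D₀)
    (hE : ∀ n, E.carrier n = D₁ n \ D₀ n)
    (T : ∀ n, Chains R X n →ₗ[R] Chains R X (n + 1)) (ρ : ∀ n, Module.End R (Chains R X n))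
    (hT₁ : ∀ n, ∀ σ ∈ D₁ n, T n (Finsupp.single σ 1) ∈ Finsupp.supported R R (D₁ (n + 1)))
    (hT₀ : ∀ n, ∀ σ ∈ D₀ n, T n (Finsupp.single σ 1) ∈ Finsupp.supported R R (D₀ (n + 1)))
    (hρ₁ : ∀ n, ∀ σ ∈ D₁ n, ρ n (Finsupp.single σ 1) ∈ Finsupp.supported R R (D₁ n))
    (hρ₀ : ∀ n, ∀ σ ∈ D₀ n, ρ n (Finsupp.single σ 1) ∈ Finsupp.supported R R (D₀ n))
    (hz : ∀ σ ∈ D₁ 0, ω.d 0 (T 0 (Finsupp.single σ 1)) =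
      Finsupp.single σ 1 - ρ 0 (Finsupp.single σ 1))
    (hs : ∀ n, ∀ σ ∈ D₁ (n + 1), ω.d (n + 1) (T (n + 1) (Finsupp.single σ 1)) +
      T n (ω.d n (Finsupp.single σ 1)) = Finsupp.single σ 1 - ρ (n + 1) (Finsupp.single σ 1))
    (hnil : ∀ n, ∀ σ ∈ D₁ n, ∃ m : ℕ,
      (ρ n ^ m) (Finsupp.single σ 1) ∈ Finsupp.supported R R (D₀ n)) :
    E.IsFiniteFree ω := by
  have hD₁ (n : ℕ) (σ) (hσ : σ ∈ E.carrier n) : σ ∈ D₁ n := by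
    rw [hE] at hσ
    exact hσ.1
  have hcompl (n : ℕ) : D₀ n ⊆ (E.carrier n)ᶜ := fun σ hσ h => by
    rw [hE] at h
    exact h.2 hσ
  have hD₀ (n : ℕ) (σ) (hσ : σ ∈ D₁ n \ E.carrier n) : σ ∈ D₀ n := by
    by_contra h
    exact hσ.2 (by rw [hE]; exact ⟨hσ.1, h⟩)
  -- On relative chains `f` becomes `1 - ρ`, and `ρ` is locally nilpotent there because its powers
  -- push each simplex into `D₀`.
  have hbij (n : ℕ) (f : Chains R X n →ₗ[R] Chains R X n)
      (hf : ∀ σ ∈ D₁ n, f (Finsupp.single σ 1) =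
        Finsupp.single σ 1 - ρ n (Finsupp.single σ 1)) :
      Function.Bijective (compress (E.carrier n) (E.carrier n) f) := by
    have e : compress (E.carrier n) (E.carrier n) f =
        1 - (compress (E.carrier n) (E.carrier n) (ρ n) : Module.End R (E.carrier n →₀ R)) := by
      refine (eq_sub_of_add_eq ?_ : (compress _ _ f : Module.End R (E.carrier n →₀ R)) = _)
      rw [← compress_add]
      refine (compress_congr fun σ hσ => ?_).trans (compress_id _)
      rw [LinearMap.add_apply, hf σ (hD₁ n σ hσ), sub_add_cancel, LinearMap.id_apply]
    rw [e]
    refine bijective_one_sub _ (locally_nilpotent_of_single _ fun σ => ?_)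
    obtain ⟨m, hm⟩ := hnil n σ.1 (hD₁ n _ σ.2)
    refine ⟨m, ?_⟩
    rw [compress_pow _ _ _ _ (hE n) (hρ₁ n) (hρ₀ n), compress_single]
    exact lsubtypeDomain_eq_zero (Finsupp.supported_mono (hcompl n) hm)
  -- Since `T` and the differential preserve both `D₁` and `D₀`, compression respects their
  -- composites.
  have hdT (n : ℕ) : E.d ω n ∘ₗ compress (E.carrier n) (E.carrier (n + 1)) (T n) =
      compress _ _ (ω.d n ∘ₗ T n) :=
    compress_comp (D₁ (n + 1)) (fun σ hσ => hT₁ n σ (hD₁ n σ hσ)) fun σ hσ =>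
      Finsupp.supported_mono (hcompl n) (h₀.d_mem ω (hD₀ _ σ hσ))
  have hTd (n : ℕ) : compress (E.carrier n) (E.carrier (n + 1)) (T n) ∘ₗ E.d ω n =
      compress _ _ (T n ∘ₗ ω.d n) :=
    compress_comp (D₁ n) (fun σ hσ => h₁.d_mem ω (hD₁ _ σ hσ)) fun σ hσ =>
      Finsupp.supported_mono (hcompl (n + 1)) (hT₀ n σ (hD₀ n σ hσ))
  refine isFiniteFreeUpToHomotopy_of_bijective
    (fun n => ModuleCat.ofHom (compress (E.carrier n) (E.carrier (n + 1)) (T n))) ?_ fun n => ?_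
  · rw [Piece.complex_d]
    change Function.Bijective (E.d ω 0 ∘ₗ compress (E.carrier 0) (E.carrier 1) (T 0))
    rw [hdT]
    exact hbij 0 _ hz
  · rw [Piece.complex_d, Piece.complex_d]
    change Function.Bijective (compress (E.carrier n) (E.carrier (n + 1)) (T n) ∘ₗ E.d ω n +
      E.d ω (n + 1) ∘ₗ compress (E.carrier (n + 1)) (E.carrier (n + 2)) (T (n + 1)))
    rw [hdT, hTd, ← compress_add]
    refine hbij (n + 1) _ fun σ hσ => ?_
    exact (add_comm _ _).trans (hs n σ hσ)

end Weights

end TwistedHomology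

end

noncomputable section

namespace TwistedHomology

/-! ## Ordered chains -/

section OrderedChains

/-- Formal sums of ordered `m`-simplices with vertices in `K`. -/
abbrev OrderedChains (K : Type*) (m : ℕ) : Type _ := (Fin (m + 1) → K) →₀ ℤ

namespace OrderedChains

variable {K L : Type*}

/-- The boundary of ordered chains. -/
def bdry (m : ℕ) : OrderedChains K (m + 1) →ₗ[ℤ] OrderedChains K m :=
  Finsupp.linearCombination ℤ fun v => ∑ i : Fin (m + 2), (-1 : ℤ) ^ i.val •
    Finsupp.single (fun j => v (i.succAbove j)) 1

theorem bdry_single (m : ℕ) (v : Fin (m + 2) → K) :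
    bdry m (Finsupp.single v 1) = ∑ i : Fin (m + 2), (-1 : ℤ) ^ i.val •
      Finsupp.single (fun j => v (i.succAbove j)) 1 := by
  rw [bdry, Finsupp.linearCombination_single, one_smul]

/-- The sum of the coefficients. -/
def aug : OrderedChains K 0 →ₗ[ℤ] ℤ := Finsupp.linearCombination ℤ fun _ => 1

theorem aug_single (v : Fin 1 → K) : aug (Finsupp.single v 1) = 1 := by
  rw [aug, Finsupp.linearCombination_single, one_smul]

/-- The cone with apex `b`. -/
def cone (b : K) (m : ℕ) : OrderedChains K m →ₗ[ℤ] OrderedChains K (m + 1) :=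
  Finsupp.lmapDomain ℤ ℤ fun v => Fin.cons b v

theorem cone_single (b : K) (m : ℕ) (v : Fin (m + 1) → K) :
    cone b m (Finsupp.single v 1) = Finsupp.single (Fin.cons b v) 1 :=
  Finsupp.mapDomain_single

/-- Omitting the apex returns `c`; omitting any other vertex gives a cone over a face, with the sign
shifted by one. -/
theorem bdry_cone_succ (b : K) (m : ℕ) (c : OrderedChains K (m + 1)) :
    bdry (m + 1) (cone b (m + 1) c) = c - cone b m (bdry m c) := by
  suffices h : bdry (m + 1) ∘ₗ cone b (m + 1) = LinearMap.id - cone b m ∘ₗ bdry m from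
    congrArg (fun f => f c) h
  ext v : 2
  simp only [LinearMap.comp_apply, Finsupp.lsingle_apply, LinearMap.sub_apply,
    LinearMap.id_apply]
  rw [cone_single, bdry_single, bdry_single, Fin.sum_univ_succ, map_sum, sub_eq_add_neg,
    ← Finset.sum_neg_distrib]
  congr 1
  · simp
  · refine Finset.sum_congr rfl fun i _ => ?_
    rw [map_zsmul, cone_single, Fin.val_succ, pow_succ, mul_neg_one, neg_smul]
    congr 3
    funext j
    refine Fin.cases ?_ (fun j => ?_) j
    · simp
    · simp

/-- In degree zero, omitting the only base vertex leaves the apex, once per vertex counted with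
coefficient. -/
theorem bdry_cone_zero (b : K) (c : OrderedChains K 0) :
    bdry 0 (cone b 0 c) = c - aug c • Finsupp.single (fun _ => b) 1 := by
  suffices h : bdry 0 ∘ₗ cone b 0 =
      LinearMap.id - aug.smulRight (Finsupp.single (fun _ => b) 1) from
    congrArg (fun f => f c) h
  ext v : 2
  simp only [LinearMap.comp_apply, Finsupp.lsingle_apply, LinearMap.sub_apply,
    LinearMap.id_apply, LinearMap.smulRight_apply]
  rw [cone_single, bdry_single, aug_single, Fin.sum_univ_two, one_smul, sub_eq_add_neg]
  congr 1
  · simp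
  · simp only [Fin.val_one, pow_one, neg_smul, one_smul]
    congr 2
    funext j
    fin_cases j
    rfl

/-- The image of an ordered chain under a map of the vertices. -/
def map (φ : K → L) (m : ℕ) : OrderedChains K m →ₗ[ℤ] OrderedChains L m :=
  Finsupp.lmapDomain ℤ ℤ fun v j => φ (v j)

theorem map_single (φ : K → L) (m : ℕ) (v : Fin (m + 1) → K) :
    map φ m (Finsupp.single v 1) = Finsupp.single (fun j => φ (v j)) 1 :=
  Finsupp.mapDomain_single

theorem bdry_map (φ : K → L) (m : ℕ) (c : OrderedChains K (m + 1)) :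
    bdry m (map φ (m + 1) c) = map φ m (bdry m c) := by
  suffices h : bdry m ∘ₗ map φ (m + 1) = map φ m ∘ₗ bdry m from congrArg (fun f => f c) h
  ext v : 2
  simp only [LinearMap.comp_apply, Finsupp.lsingle_apply]
  simp only [map_single, bdry_single, map_sum, map_zsmul]

theorem aug_map (φ : K → L) (c : OrderedChains K 0) : aug (map φ 0 c) = aug c := by
  suffices h : aug ∘ₗ map φ 0 = aug from congrArg (fun f => f c) h
  ext v : 2
  simp only [LinearMap.comp_apply, Finsupp.lsingle_apply, map_single, aug_single]

end OrderedChains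

end OrderedChains

/-! ## Prisms over simplices -/

section Prisms

/-- The product of the topological `n`-simplex and the unit interval. -/
def prismSet (n : ℕ) : Set ((Fin (n + 1) → ℝ) × ℝ) :=
  stdSimplex ℝ (Fin (n + 1)) ×ˢ Set.Icc 0 1

theorem convex_prismSet (n : ℕ) : Convex ℝ (prismSet n) :=
  (convex_stdSimplex ℝ _).prod (convex_Icc 0 1)

/-- The product of the topological `n`-simplex and the unit interval. -/
abbrev Prism (n : ℕ) : Type := prismSet n

/-- The horizontal section of the prism at height `t`. -/
def level (n : ℕ) (t : unitInterval) : C(Simp n, Prism n) :=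
  ⟨fun s => ⟨(s.1, t.1), s.2, t.2⟩, by fun_prop⟩

instance simplyConnectedSpace_prism (n : ℕ) : SimplyConnectedSpace (Prism n) :=
  haveI : ContractibleSpace (Prism n) :=
    (convex_prismSet n).contractibleSpace ⟨_, (level n 0 (center n)).2⟩
  inferInstance

/-- The base point of the prism. -/
def prismCenter (n : ℕ) : Prism n := level n 0 (center n)

/-- The projection of the prism to the simplex. -/
def prismProj (n : ℕ) : C(Prism n, Simp n) := ⟨fun p => ⟨p.1.1, p.2.1⟩, by fun_prop⟩

/-- The `i`-th vertical face of the prism. -/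
def prismFace {n : ℕ} (i : Fin (n + 2)) : C(Prism n, Prism (n + 1)) :=
  ⟨fun p => ⟨((face i (prismProj n p)).1, p.1.2), (face i (prismProj n p)).2, p.2.2⟩, by fun_prop⟩

theorem prismFace_level {n : ℕ} (i : Fin (n + 2)) (t : unitInterval) (s : Simp n) :
    prismFace i (level n t s) = level (n + 1) t (face i s) := rfl

theorem prismFace_comp_prismFace {n : ℕ} {i j : Fin (n + 2)} (h : i ≤ j) (p : Prism n) :
    prismFace j.succ (prismFace i p) = prismFace i.castSucc (prismFace j p) := by
  have := congrArg (fun f => f (prismProj n p)) (face_comp_face h)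
  exact Subtype.ext (Prod.ext (congrArg Subtype.val this) rfl)

/-- The affine simplex in the prism with the given vertices. -/
def prismAffine {n m : ℕ} (v : Fin (m + 1) → Prism n) : C(Simp m, Prism n) :=
  ⟨fun s => ⟨affine (fun i => (v i).1) s,
    (convex_prismSet n).sum_mem (fun i _ => s.2.1 i) s.2.2 fun i _ => (v i).2⟩,
    (affine fun i => (v i).1).continuous.subtype_mk _⟩

theorem prismAffine_face {n m : ℕ} (v : Fin (m + 2) → Prism n) (i : Fin (m + 2)) :
    (prismAffine v).comp (face i) = prismAffine fun j => v (i.succAbove j) := by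
  ext1 s
  exact Subtype.ext (congrArg (fun f => f s)
    (affine_comp (fun i => (v i).1) (SimplexCategory.δ i)))

/-- The vertices of the horizontal section at height `t`. -/
def levelVertex (n : ℕ) (t : unitInterval) (i : Fin (n + 1)) : Prism n :=
  level n t (stdSimplex.vertex i)

theorem prismAffine_levelVertex (n : ℕ) (t : unitInterval) :
    prismAffine (levelVertex n t) = level n t := by
  ext1 s
  refine Subtype.ext (Prod.ext ?_ ?_)
  · funext j
    change (∑ i, s.1 i • (levelVertex n t i).1).1 j = s.1 j
    rw [Prod.fst_sum, Finset.sum_apply]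
    simp [levelVertex, level, stdSimplex.vertex, Pi.single_apply]
  · change (∑ i, s.1 i • (levelVertex n t i).1).2 = t.1
    rw [Prod.snd_sum]
    have := s.2.2
    simp [levelVertex, level, ← Finset.sum_mul, this]

theorem prismFace_levelVertex (n : ℕ) (t : unitInterval) (i : Fin (n + 2)) (j : Fin (n + 1)) :
    prismFace i (levelVertex n t j) = levelVertex (n + 1) t (i.succAbove j) := by
  rw [levelVertex, prismFace_level, levelVertex]
  congr 1
  exact stdSimplex.map_vertex _ _

theorem face_apply_eq_affine {E : Type*} [AddCommGroup E] [Module ℝ E] [TopologicalSpace E]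
    [ContinuousAdd E] [ContinuousSMul ℝ E] {n : ℕ} (v : Fin (n + 2) → E) (i : Fin (n + 2))
    (s : Simp n) : affine v (face i s) = affine (fun j => v (i.succAbove j)) s :=
  congrArg (fun f => f s) (affine_comp v (SimplexCategory.δ i))

/-- The affine map to the simplex with the given vertices commutes with affine simplices. -/
theorem affine_prismProj_prismAffine {E : Type*} [AddCommGroup E] [Module ℝ E]
    [TopologicalSpace E] [ContinuousAdd E] [ContinuousSMul ℝ E] {n m : ℕ} (u : Fin (n + 1) → E)
    (v : Fin (m + 1) → Prism n) (s : Simp m) :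
    affine u (prismProj n (prismAffine v s)) = affine (fun j => affine u (prismProj n (v j))) s := by
  change ∑ i, (∑ j, s.1 j • (v j).1).1 i • u i = ∑ j, s.1 j • ∑ i, (v j).1.1 i • u i
  simp only [Prod.fst_sum, Finset.sum_apply, Finset.sum_smul, Finset.smul_sum]
  rw [Finset.sum_comm]
  simp [mul_smul]

theorem face_eq_affine {n : ℕ} (i : Fin (n + 2)) (s : Simp n) :
    (face i s).1 = affine (fun j => (stdSimplex.vertex (S := ℝ) (i.succAbove j)).1) s := by
  refine Eq.trans ?_ (face_apply_eq_affine
    (fun j : Fin (n + 2) => (stdSimplex.vertex (S := ℝ) j).1) i s)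
  funext j
  change _ = (∑ k, (face i s).1 k • (stdSimplex.vertex (S := ℝ) k).1) j
  rw [Finset.sum_apply]
  simp [Pi.single_apply]

theorem prismFace_comp_prismAffine {n m : ℕ} (i : Fin (n + 2)) (v : Fin (m + 1) → Prism n) :
    (prismFace i).comp (prismAffine v) = prismAffine fun j => prismFace i (v j) := by
  ext1 s
  refine Subtype.ext (Prod.ext ?_ ?_)
  · change (face i (prismProj n (prismAffine v s))).1 =
      (∑ j, s.1 j • (prismFace i (v j)).1 : (Fin (n + 2) → ℝ) × ℝ).1
    rw [face_eq_affine, affine_prismProj_prismAffine, Prod.fst_sum]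
    exact Finset.sum_congr (M := Fin (n + 2) → ℝ) (s₁ := Finset.univ) rfl fun j _ =>
      congrArg (s.1 j • ·) (face_eq_affine i (prismProj n (v j))).symm
  · change (∑ j, s.1 j • (v j).1 : (Fin (n + 1) → ℝ) × ℝ).2 =
      (∑ j, s.1 j • (prismFace i (v j)).1 : (Fin (n + 2) → ℝ) × ℝ).2
    rw [Prod.snd_sum, Prod.snd_sum]
    rfl

/-- The alternating sum of the vertical faces of the prism. -/
def faces (n m : ℕ) : OrderedChains (Prism n) m →ₗ[ℤ] OrderedChains (Prism (n + 1)) m :=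
  ∑ i : Fin (n + 2), (-1 : ℤ) ^ i.val • OrderedChains.map (prismFace i) m

theorem faces_apply (n m : ℕ) (c : OrderedChains (Prism n) m) :
    faces n m c = ∑ i : Fin (n + 2), (-1 : ℤ) ^ i.val • OrderedChains.map (prismFace i) m c := by
  simp [faces, LinearMap.sum_apply]

theorem faces_faces (n m : ℕ) (c : OrderedChains (Prism n) m) :
    faces (n + 1) m (faces n m c) = 0 := by
  rw [faces_apply]
  refine Eq.trans ?_ (alternating_sum_eq_zero (n := n) (fun j i =>
    OrderedChains.map (fun p => prismFace i (prismFace j p)) m c) ?_)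
  · refine Finset.sum_congr rfl fun i _ => ?_
    rw [faces_apply, map_sum, Finset.smul_sum]
    refine Finset.sum_congr rfl fun j _ => ?_
    rw [map_zsmul, smul_smul, ← pow_add]
    congr 1
    exact Finsupp.mapDomain_comp.symm
  · intro i j hij
    simp only [prismFace_comp_prismFace hij]

theorem bdry_faces (n m : ℕ) (c : OrderedChains (Prism n) (m + 1)) :
    OrderedChains.bdry m (faces n (m + 1) c) = faces n m (OrderedChains.bdry m c) := by
  simp only [faces_apply, map_sum, map_zsmul, OrderedChains.bdry_map]

theorem aug_faces (c : OrderedChains (Prism 0) 0) :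
    OrderedChains.aug (faces 0 0 c) = 0 := by
  simp [faces_apply, OrderedChains.aug_map, Fin.sum_univ_two]

/-- The horizontal simplex of the prism at height `t`. -/
def levelChain (t : unitInterval) (n : ℕ) : OrderedChains (Prism n) n :=
  Finsupp.single (levelVertex n t) 1

/-- An equation `bdry (c (n + 1)) = faces (c n)` is the universal form of "the operator given by `c`
commutes with the differential"; see `d_push` and `prismOp_d`. -/
theorem bdry_levelChain (t : unitInterval) (n : ℕ) :
    OrderedChains.bdry n (levelChain t (n + 1)) = faces n n (levelChain t n) := by
  rw [levelChain, OrderedChains.bdry_single, faces_apply]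
  refine Finset.sum_congr rfl fun i _ => ?_
  rw [levelChain, OrderedChains.map_single]
  simp only [prismFace_levelVertex]

/-- The barycentric subdivision of the bottom of the prism. -/
def subdivChain (n : ℕ) : OrderedChains (Prism n) n :=
  Nat.rec (levelChain 0 0)
    (fun n c => OrderedChains.cone (prismCenter (n + 1)) n (faces n n c)) n

theorem subdivChain_succ (n : ℕ) : subdivChain (n + 1) =
    OrderedChains.cone (prismCenter (n + 1)) n (faces n n (subdivChain n)) := rfl

/-- The chain being coned is a cycle, because `bdry` commutes with `faces` and `faces` squares to
zero; in the lowest degree its augmentation vanishes instead. -/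
theorem bdry_subdivChain (n : ℕ) :
    OrderedChains.bdry n (subdivChain (n + 1)) = faces n n (subdivChain n) := by
  cases n with
  | zero => rw [subdivChain_succ, OrderedChains.bdry_cone_zero, aug_faces, zero_smul, sub_zero]
  | succ n =>
    rw [subdivChain_succ, OrderedChains.bdry_cone_succ, bdry_faces, bdry_subdivChain n, faces_faces,
      map_zero, sub_zero]

/-- The chains which bound the compatible family of cycles `a`. -/
def fillChain (a : ∀ n, OrderedChains (Prism n) n) (n : ℕ) : OrderedChains (Prism n) (n + 1) :=
  Nat.rec (OrderedChains.cone (prismCenter 0) 0 (a 0))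
    (fun n c => OrderedChains.cone (prismCenter (n + 1)) (n + 1)
      (a (n + 1) - faces n (n + 1) c)) n

theorem fillChain_succ (a : ∀ n, OrderedChains (Prism n) n) (n : ℕ) : fillChain a (n + 1) =
    OrderedChains.cone (prismCenter (n + 1)) (n + 1)
      (a (n + 1) - faces n (n + 1) (fillChain a n)) := rfl

theorem bdry_fillChain_zero {a : ∀ n, OrderedChains (Prism n) n}
    (h0 : OrderedChains.aug (a 0) = 0) : OrderedChains.bdry 0 (fillChain a 0) = a 0 := by
  exact (OrderedChains.bdry_cone_zero _ _).trans (by rw [h0, zero_smul, sub_zero])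

/-- Acyclic models with explicit cones. The right-hand side is a cycle: by induction its boundary
reduces to two applications of `faces`, and the cone over a cycle bounds it. -/
theorem bdry_fillChain_succ {a : ∀ n, OrderedChains (Prism n) n}
    (h0 : OrderedChains.aug (a 0) = 0)
    (ha : ∀ n, OrderedChains.bdry n (a (n + 1)) = faces n n (a n)) (n : ℕ) :
    OrderedChains.bdry (n + 1) (fillChain a (n + 1)) =
      a (n + 1) - faces n (n + 1) (fillChain a n) := by
  rw [fillChain_succ, OrderedChains.bdry_cone_succ, map_sub (OrderedChains.bdry n), ha, bdry_faces]
  cases n with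
  | zero => rw [bdry_fillChain_zero h0, sub_self, map_zero, sub_zero]
  | succ n =>
    rw [bdry_fillChain_succ h0 ha n, map_sub (faces (n + 1) (n + 1)), faces_faces, sub_zero,
      sub_self, map_zero, sub_zero]

end Prisms

/-! ## Operators on singular chains defined by chains of prisms -/

section Operators

variable {X : Type u} [TopologicalSpace X] {R : Type w} [CommRing R] (ω : Weight R X)

/-- The image in `X` of a chain in the prism. -/
def push {n : ℕ} (g : C(Prism n, X)) (m : ℕ) : OrderedChains (Prism n) m →ₗ[ℤ] Chains R X m :=
  Finsupp.linearCombination ℤ fun v => Finsupp.single (g.comp (prismAffine v))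
    (ω.along g (prismCenter n) (prismAffine v (center m)))

theorem push_single {n : ℕ} (g : C(Prism n, X)) (m : ℕ) (v : Fin (m + 1) → Prism n) :
    push ω g m (Finsupp.single v 1) = Finsupp.single (g.comp (prismAffine v))
      (ω.along g (prismCenter n) (prismAffine v (center m))) := by
  rw [push, Finsupp.linearCombination_single, one_smul]

theorem push_mem_supported {n : ℕ} (g : C(Prism n, X)) (m : ℕ) (c : OrderedChains (Prism n) m)
    {D : Set C(Simp m, X)} (h : ∀ v ∈ c.support, g.comp (prismAffine v) ∈ D) :
    push ω g m c ∈ Finsupp.supported R R D := by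
  rw [push, Finsupp.linearCombination_apply]
  exact Submodule.sum_mem _ fun v hv =>
    zsmul_mem (Finsupp.single_mem_supported R _ (h v hv)) _

theorem Weight.d_single' {n : ℕ} (σ : C(Simp (n + 1), X)) (r : R) :
    ω.d n (Finsupp.single σ r) = ∑ i : Fin (n + 2), (-1 : ℤ) ^ i.val •
      Finsupp.single (σ.comp (face i)) (r * ω.along σ (center (n + 1)) (face i (center n))) := by
  rw [← mul_one r, ← smul_eq_mul, ← Finsupp.smul_single, map_smul, Weight.d_single,
    Finset.smul_sum]
  refine Finset.sum_congr rfl fun i _ => ?_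
  rw [smul_comm, Finsupp.smul_single, smul_eq_mul, smul_eq_mul, mul_one]

/-- Coefficients are transported from the base point of the prism to the barycenter of each simplex;
a further step to the barycenter of a face composes by `along_mul`. -/
theorem d_push {n : ℕ} (g : C(Prism n, X)) (m : ℕ) (c : OrderedChains (Prism n) (m + 1)) :
    ω.d m (push ω g (m + 1) c) = push ω g m (OrderedChains.bdry m c) := by
  suffices h : (ω.d m).toAddMonoidHom.toIntLinearMap ∘ₗ push ω g (m + 1) =
      push ω g m ∘ₗ OrderedChains.bdry m from congrArg (fun f => f c) h
  ext v : 2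
  simp only [LinearMap.comp_apply, Finsupp.lsingle_apply]
  rw [push_single, OrderedChains.bdry_single, map_sum]
  refine (ω.d_single' _ _).trans (Finset.sum_congr rfl fun i _ => ?_)
  rw [map_zsmul, push_single, Weight.along_comp, Weight.along_mul, ← prismAffine_face]
  rfl

theorem push_comp_prismFace {n : ℕ} (g : C(Prism (n + 1), X)) (i : Fin (n + 2)) (m : ℕ)
    (c : OrderedChains (Prism n) m) :
    ω.along g (prismCenter (n + 1)) (prismFace i (prismCenter n)) •
      push ω (g.comp (prismFace i)) m c = push ω g m (OrderedChains.map (prismFace i) m c) := by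
  suffices h : (ω.along g (prismCenter (n + 1)) (prismFace i (prismCenter n)) •
      (LinearMap.id : Chains R X m →ₗ[R] Chains R X m)).toAddMonoidHom.toIntLinearMap ∘ₗ
      push ω (g.comp (prismFace i)) m = push ω g m ∘ₗ OrderedChains.map (prismFace i) m from
    congrArg (fun f => f c) h
  ext v : 2
  simp only [LinearMap.comp_apply, Finsupp.lsingle_apply]
  rw [push_single, OrderedChains.map_single, push_single]
  change ω.along g (prismCenter (n + 1)) (prismFace i (prismCenter n)) •
    Finsupp.single ((g.comp (prismFace i)).comp (prismAffine v)) _ = _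
  rw [Finsupp.smul_single, smul_eq_mul, Weight.along_comp, Weight.along_mul,
    ← prismFace_comp_prismAffine]
  rfl

theorem push_levelChain_zero {n : ℕ} (g : C(Prism n, X)) :
    push ω g n (levelChain 0 n) = Finsupp.single (g.comp (level n 0)) 1 := by
  rw [levelChain, push_single, prismAffine_levelVertex]
  congr 1
  exact ω.along_self g _

/-- The operator on singular chains given by a chain in the prism, for a choice `G` of
homotopies of singular simplices. -/
def prismOp {n : ℕ} (G : C(Simp n, X) → C(Prism n, X)) {m : ℕ} (c : OrderedChains (Prism n) m) :
    Chains R X n →ₗ[R] Chains R X m :=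
  Finsupp.linearCombination R fun σ => push ω (G σ) m c

theorem prismOp_single {n : ℕ} (G : C(Simp n, X) → C(Prism n, X)) {m : ℕ}
    (c : OrderedChains (Prism n) m) (σ : C(Simp n, X)) :
    prismOp ω G c (Finsupp.single σ 1) = push ω (G σ) m c := by
  rw [prismOp, Finsupp.linearCombination_single, one_smul]

/-- By `hG` the homotopy of a face is the restriction of that of `σ`; by `hσ` the weight in the
differential is the change of base point inside the prism, which `push_comp_prismFace` absorbs. -/
theorem prismOp_d {n : ℕ} (G : C(Simp n, X) → C(Prism n, X)) {m : ℕ}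
    (c : OrderedChains (Prism n) m) {σ : C(Simp (n + 1), X)} {g : C(Prism (n + 1), X)}
    (hσ : g.comp (level (n + 1) 0) = σ)
    (hG : ∀ i, G (σ.comp (face i)) = g.comp (prismFace i)) :
    prismOp ω G c (ω.d n (Finsupp.single σ 1)) = push ω g m (faces n m c) := by
  rw [Weight.d_single, map_sum, faces_apply, map_sum]
  refine Finset.sum_congr rfl fun i _ => ?_
  rw [map_zsmul, map_zsmul, prismOp, Finsupp.linearCombination_single, hG, ← hσ,
    Weight.along_comp, ← push_comp_prismFace]
  rfl

/-- The homotopy operator between the operators of a compatible family of chains. -/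
theorem prismOp_fillChain {a : ∀ n, OrderedChains (Prism n) n}
    (h0 : OrderedChains.aug (a 0) = 0)
    (ha : ∀ n, OrderedChains.bdry n (a (n + 1)) = faces n n (a n))
    (G : ∀ n, C(Simp n, X) → C(Prism n, X)) {n : ℕ} {σ : C(Simp (n + 1), X)}
    (hσ : (G (n + 1) σ).comp (level (n + 1) 0) = σ)
    (hG : ∀ i, G n (σ.comp (face i)) = (G (n + 1) σ).comp (prismFace i)) :
    ω.d (n + 1) (prismOp ω (G (n + 1)) (fillChain a (n + 1)) (Finsupp.single σ 1)) +
      prismOp ω (G n) (fillChain a n) (ω.d n (Finsupp.single σ 1)) =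
    prismOp ω (G (n + 1)) (a (n + 1)) (Finsupp.single σ 1) := by
  rw [prismOp_single, prismOp_single, d_push, prismOp_d ω (G n) _ hσ hG, ← map_add,
    bdry_fillChain_succ h0 ha, sub_add_cancel]

theorem prismOp_fillChain_zero {a : ∀ n, OrderedChains (Prism n) n}
    (h0 : OrderedChains.aug (a 0) = 0) (G : C(Simp 0, X) → C(Prism 0, X)) (σ : C(Simp 0, X)) :
    ω.d 0 (prismOp ω G (fillChain a 0) (Finsupp.single σ 1)) =
      prismOp ω G (a 0) (Finsupp.single σ 1) := by
  rw [prismOp_single, prismOp_single, d_push, bdry_fillChain_zero h0]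

end Operators

end TwistedHomology

end

noncomputable section

namespace TwistedHomology

/-! ## Chains in subsets: homotopy invariance, Mayer-Vietoris, points -/

section Subsets

variable {X : Type u} [TopologicalSpace X] {R : Type w} [CommRing R] (ω : Weight R X)

/-- The singular simplices with image in `B`. -/
def simplicesIn (B : Set X) (n : ℕ) : Set C(Simp n, X) := {σ | ∀ s, σ s ∈ B}

theorem faceClosed_simplicesIn (B : Set X) : FaceClosed (simplicesIn B) :=
  fun _ _ i hσ s => hσ (face i s)

/-- The piece of singular simplices with image in `B`. -/
def Piece.ofSet (B : Set X) : Piece X where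
  carrier := simplicesIn B
  exists_eq := ⟨simplicesIn B, fun _ => ∅, faceClosed_simplicesIn B, fun _ _ _ h => h.elim,
    fun _ => Set.sdiff_empty.symm⟩

theorem Piece.ofSet_inter (B A : Set X) :
    (Piece.ofSet B).inter (faceClosed_simplicesIn A) = Piece.ofSet (B ∩ A) :=
  Piece.ext' fun _ _ => forall_and.symm

theorem push_mem_simplicesIn {n : ℕ} (g : C(Prism n, X)) (m : ℕ) (c : OrderedChains (Prism n) m)
    {B : Set X} (h : ∀ p, g p ∈ B) :
    push ω g m c ∈ Finsupp.supported R R (simplicesIn B m) :=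
  push_mem_supported ω g m c fun _ _ _ => h _

/-- If `B` can be deformed in `B` into `A`, then the chains in `B` relative to `A` are
contractible. -/
theorem Piece.IsFiniteFree.of_deformation {A B : Set X} (hAB : A ⊆ B) (H : X × unitInterval → X)
    (hH : ContinuousOn H (B ×ˢ Set.univ)) (h0 : ∀ x ∈ B, H (x, 0) = x)
    (hB : ∀ x ∈ B, ∀ t, H (x, t) ∈ B) (hA : ∀ x ∈ A, ∀ t, H (x, t) ∈ A)
    (h1 : ∀ x ∈ B, H (x, 1) ∈ A) (h : (Piece.ofSet A).IsFiniteFree ω) :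
    (Piece.ofSet B).IsFiniteFree ω := by
  classical
  have hc {n : ℕ} (σ : C(Simp n, X)) (hσ : σ ∈ simplicesIn B n) :
      Continuous fun p : Prism n => H (σ (prismProj n p), ⟨p.1.2, p.2.2⟩) :=
    hH.comp_continuous (by fun_prop) fun p => ⟨hσ _, trivial⟩
  let G (n : ℕ) (σ : C(Simp n, X)) : C(Prism n, X) :=
    if hσ : σ ∈ simplicesIn B n then
      ⟨fun p => H (σ (prismProj n p), ⟨p.1.2, p.2.2⟩), hc σ hσ⟩
    else σ.comp (prismProj n)
  have hG {n : ℕ} {σ : C(Simp n, X)} (hσ : σ ∈ simplicesIn B n) (p : Prism n) :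
      G n σ p = H (σ (prismProj n p), ⟨p.1.2, p.2.2⟩) := by
    simp only [G, dif_pos hσ]
    rfl
  have hG0 {n : ℕ} {σ : C(Simp n, X)} (hσ : σ ∈ simplicesIn B n) :
      (G n σ).comp (level n 0) = σ := by
    ext1 s
    exact (hG hσ _).trans (h0 _ (hσ s))
  have hGf {n : ℕ} {σ : C(Simp (n + 1), X)} (hσ : σ ∈ simplicesIn B (n + 1)) (i : Fin (n + 2)) :
      G n (σ.comp (face i)) = (G (n + 1) σ).comp (prismFace i) := by
    ext1 p
    exact (hG (faceClosed_simplicesIn B σ i hσ) p).trans (hG hσ (prismFace i p)).symm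
  -- Bottom minus top: filling this family gives the chain homotopy from the identity to the end of
  -- the deformation.
  let a (n : ℕ) : OrderedChains (Prism n) n := levelChain 0 n - levelChain 1 n
  have ha0 : OrderedChains.aug (a 0) = 0 := by
    simp only [a, map_sub, levelChain, OrderedChains.aug_single, sub_self]
  have ha (n : ℕ) : OrderedChains.bdry n (a (n + 1)) = faces n n (a n) := by
    simp only [a, map_sub, bdry_levelChain]
  have hd (n : ℕ) (σ : C(Simp n, X)) (hσ : σ ∈ simplicesIn B n) :
      prismOp ω (G n) (a n) (Finsupp.single σ 1) =
        Finsupp.single σ 1 - prismOp ω (G n) (levelChain 1 n) (Finsupp.single σ 1) := by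
    simp only [prismOp_single, a, map_sub, push_levelChain_zero, hG0 hσ]
  have hop {n m : ℕ} (c : OrderedChains (Prism n) m) (C : Set X) (hCB : C ⊆ B)
      (hC : ∀ x ∈ C, ∀ t, H (x, t) ∈ C) (σ : C(Simp n, X)) (hσ : σ ∈ simplicesIn C n) :
      prismOp ω (G n) c (Finsupp.single σ 1) ∈ Finsupp.supported R R (simplicesIn C m) := by
    rw [prismOp_single]
    refine push_mem_simplicesIn ω _ _ _ fun p => ?_
    rw [hG fun s => hCB (hσ s)]
    exact hC _ (hσ _) _
  refine Piece.IsFiniteFree.of_inter_of_sdiff (faceClosed_simplicesIn A) ?_ ?_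
  · rw [Piece.ofSet_inter, Set.inter_eq_right.mpr hAB]
    exact h
  · refine Piece.isFiniteFree_of_homotopy _ ω (faceClosed_simplicesIn B)
      (faceClosed_simplicesIn A) (fun n => rfl) (fun n => prismOp ω (G n) (fillChain a n))
      (fun n => prismOp ω (G n) (levelChain 1 n))
      (fun n => hop _ B subset_rfl hB) (fun n => hop _ A hAB hA)
      (fun n => hop _ B subset_rfl hB) (fun n => hop _ A hAB hA)
      (fun σ hσ => ?_) (fun n σ hσ => ?_) fun n σ hσ => ⟨1, ?_⟩
    · exact (prismOp_fillChain_zero ω ha0 (G 0) σ).trans (hd 0 σ hσ)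
    · exact (prismOp_fillChain ω ha0 ha G (hG0 hσ) (hGf hσ)).trans (hd (n + 1) σ hσ)
    -- One application suffices, since the deformation ends in `A`.
    · rw [pow_one, prismOp_single, levelChain, push_single, prismAffine_levelVertex]
      refine Finsupp.single_mem_supported R _ fun s => ?_
      exact (hG hσ _).symm ▸ h1 _ (hσ s)

/-! ### Points -/

theorem eq_const_of_mem_simplicesIn {x : X} {n : ℕ} {σ : C(Simp n, X)}
    (hσ : σ ∈ simplicesIn {x} n) : σ = ContinuousMap.const _ x :=
  ContinuousMap.ext hσ

/-- All `n + 2` faces are the same constant simplex with weight `1`, so only the parity of their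
number matters. -/
theorem Weight.d_const (x : X) (n : ℕ) :
    ω.d n (Finsupp.single (ContinuousMap.const _ x) 1) =
      if Even n then 0 else Finsupp.single (ContinuousMap.const _ x) 1 := by
  rw [Weight.d_single]
  have (i : Fin (n + 2)) : Finsupp.single ((ContinuousMap.const (Simp (n + 1)) x).comp (face i))
      (ω.along (ContinuousMap.const (Simp (n + 1)) x) (center (n + 1)) (face i (center n))) =
      Finsupp.single (ContinuousMap.const (Simp n) x) 1 := by
    rw [Weight.along_const]
    rfl
  simp only [this, ← Finset.sum_smul]
  rw [Fin.sum_neg_one_pow]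
  simp only [Nat.even_add_one, not_not]
  split_ifs
  · exact zero_smul _ _
  · exact one_smul _ _

/-- Degree zero is split off. In positive degrees the differentials from even to odd degrees are
isomorphisms, and their inverses form the contraction. -/
theorem Piece.isFiniteFree_singleton (x : X) : (Piece.ofSet {x}).IsFiniteFree ω := by
  classical
  have hL : FaceClosed (X := X) fun n => {_σ | n = 0} := fun n σ i h => (Nat.succ_ne_zero n h).elim
  refine Piece.IsFiniteFree.of_inter_of_sdiff hL (Piece.isFiniteFree_of_finite _ ω fun n => ?_) ?_
  · have : Subsingleton ((Piece.ofSet {x}).inter hL |>.carrier n) :=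
      ⟨fun σ τ => Subtype.ext ((eq_const_of_mem_simplicesIn σ.2.1).trans
        (eq_const_of_mem_simplicesIn τ.2.1).symm)⟩
    infer_instance
  · have hc (n : ℕ) : ContinuousMap.const _ x ∈ simplicesIn {x} n := fun s => rfl
    refine Piece.isFiniteFree_of_homotopy _ ω (faceClosed_simplicesIn {x}) hL (fun n => rfl)
      (fun n => Finsupp.linearCombination R fun _ =>
        if Even n then 0 else Finsupp.single (ContinuousMap.const _ x) 1)
      -- The identity in degree zero is harmless: the relative chains vanish there.
      (fun n => if n = 0 then 1 else 0) (fun n σ hσ => ?_) (fun n σ hσ => ?_)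
      (fun n σ hσ => ?_) (fun n σ hσ => ?_) (fun σ hσ => ?_) (fun n σ hσ => ?_)
      fun n σ hσ => ⟨1, ?_⟩
    · rw [Finsupp.linearCombination_single, one_smul]
      split_ifs
      · exact zero_mem _
      · exact Finsupp.single_mem_supported R _ (hc _)
    · have hn : n = 0 := hσ
      rw [Finsupp.linearCombination_single, one_smul, if_pos (by simp [hn])]
      exact zero_mem _
    · split_ifs
      · exact Finsupp.single_mem_supported R _ hσ
      · exact zero_mem _
    · split_ifs
      · exact Finsupp.single_mem_supported R _ hσ
      · exact zero_mem _
    · simp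
    · obtain rfl := eq_const_of_mem_simplicesIn hσ
      rw [Finsupp.linearCombination_single, one_smul, Weight.d_const, if_neg (Nat.succ_ne_zero n),
        LinearMap.zero_apply, sub_zero]
      by_cases hn : Even n
      · simp [hn, Nat.even_add_one, Weight.d_const]
      · simp [hn, Nat.even_add_one, Finsupp.linearCombination_single]
    · rw [pow_one]
      split_ifs with hn
      · exact Finsupp.single_mem_supported R _ hn
      · exact zero_mem _

theorem Piece.isFiniteFree_empty : (Piece.ofSet (∅ : Set X)).IsFiniteFree ω := by
  refine Piece.isFiniteFree_of_finite _ ω fun n => ?_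
  have : IsEmpty ((Piece.ofSet (∅ : Set X)).carrier n) := ⟨fun σ => σ.2 (center n)⟩
  infer_instance

/-! ### Barycentric subdivision -/

/-- Ordered simplices in the prism which shrink distances by the factor `n / (n + 1)`. -/
def shrinking (n m : ℕ) : Set (Fin (m + 1) → Prism n) :=
  {v | ∀ (k : ℕ) (u : Fin (n + 1) → Fin k → ℝ) (δ : ℝ), (∀ a b, dist (u a) (u b) ≤ δ) →
    ∀ i j, dist (affine u (prismProj n (v i))) (affine u (prismProj n (v j))) ≤ n / (n + 1) * δ}

theorem affine_mem_of_convex {E : Type*} [AddCommGroup E] [Module ℝ E] [TopologicalSpace E]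
    [ContinuousAdd E] [ContinuousSMul ℝ E] {K : Set E} (hK : Convex ℝ K) {n : ℕ}
    (u : Fin (n + 1) → E) (hu : ∀ i, u i ∈ K) (s : Simp n) : affine u s ∈ K :=
  hK.sum_mem (fun i _ => s.2.1 i) s.2.2 fun i _ => hu i

/-- The vector from `u a` to the barycenter is the mean of the `n + 1` differences `u i - u a`, one
of which is zero. -/
theorem dist_affine_center_le {k n : ℕ} (u : Fin (n + 1) → Fin k → ℝ) {δ : ℝ}
    (hu : ∀ a b, dist (u a) (u b) ≤ δ) (a : Fin (n + 1)) :
    dist (u a) (affine u (center n)) ≤ n / (n + 1) * δ := by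
  have hn : (0 : ℝ) < n + 1 := by positivity
  have hc (i : Fin (n + 1)) : (center n).1 i = ((n : ℝ) + 1)⁻¹ := by
    refine (stdSimplex.barycenter_apply i).trans ?_
    simp
  have e : affine u (center n) - u a = ∑ i ∈ Finset.univ.erase a, ((n : ℝ) + 1)⁻¹ • (u i - u a) := by
    have h1 : affine u (center n) = ∑ i, ((n : ℝ) + 1)⁻¹ • u i := by
      change ∑ i, (center n).1 i • u i = _
      exact Finset.sum_congr rfl fun i _ => by rw [hc]
    have h2 : u a = ∑ _i : Fin (n + 1), ((n : ℝ) + 1)⁻¹ • u a := by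
      rw [Finset.sum_const, Finset.card_univ, Fintype.card_fin, ← Nat.cast_smul_eq_nsmul ℝ,
        smul_smul, Nat.cast_add_one, mul_inv_cancel₀ hn.ne', one_smul]
    rw [h1]
    nth_rw 1 [h2]
    rw [← Finset.sum_sub_distrib, ← Finset.add_sum_erase _ _ (Finset.mem_univ a), sub_self,
      zero_add]
    exact Finset.sum_congr rfl fun i _ => (smul_sub _ _ _).symm
  rw [dist_comm, dist_eq_norm, e]
  refine (norm_sum_le_of_le _ (f := fun i => ((n : ℝ) + 1)⁻¹ • (u i - u a))
    (n := fun _ => ((n : ℝ) + 1)⁻¹ * δ) fun i _ => ?_).trans ?_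
  · rw [norm_smul, Real.norm_of_nonneg (by positivity), ← dist_eq_norm]
    exact mul_le_mul_of_nonneg_left (hu i a) (by positivity)
  · rw [Finset.sum_const, Finset.card_erase_of_mem (Finset.mem_univ a), Finset.card_univ,
      Fintype.card_fin, Nat.add_sub_cancel, nsmul_eq_mul, div_eq_mul_inv, mul_assoc]

/-- Each simplex is a cone from the barycenter over a simplex of a subdivided face. Edges at the
apex are bounded by `dist_affine_center_le`, the others by induction, as `n / (n + 1)` increases
with `n`. The bound for every affine image `u` is what allows iteration. -/
theorem subdivChain_mem_supported (n : ℕ) :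
    subdivChain n ∈ Finsupp.supported ℤ ℤ (shrinking n n) := by
  induction n with
  | zero =>
    refine Finsupp.single_mem_supported ℤ _ fun k u δ _ i j => ?_
    rw [Subsingleton.elim (α := Fin 1) i j, dist_self]
    simp
  | succ n ih =>
    rw [subdivChain_succ]
    refine map_mem_supported (f := OrderedChains.cone (prismCenter (n + 1)) n ∘ₗ faces n n)
      (fun v hv => ?_) ih
    rw [LinearMap.comp_apply, faces_apply, map_sum]
    refine Submodule.sum_mem _ fun l _ => ?_
    rw [map_zsmul, OrderedChains.map_single, OrderedChains.cone_single]
    refine zsmul_mem (Finsupp.single_mem_supported ℤ _ fun k u δ hu i j => ?_) _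
    have hδ : 0 ≤ δ := dist_nonneg.trans (hu 0 0)
    have hcone (s : Simp (n + 1)) : dist (affine u s) (affine u (center (n + 1))) ≤
        (n + 1 : ℕ) / ((n + 1 : ℕ) + 1) * δ :=
      affine_mem_of_convex (convex_closedBall _ _) u (fun a => dist_affine_center_le u hu a) s
    have hbase (i j : Fin (n + 1)) :
        dist (affine u (prismProj _ (prismFace l (v i))))
          (affine u (prismProj _ (prismFace l (v j)))) ≤ (n + 1 : ℕ) / ((n + 1 : ℕ) + 1) * δ := by
      have := hv k (fun a => u (l.succAbove a)) δ (fun a b => hu _ _) i j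
      rw [← face_apply_eq_affine, ← face_apply_eq_affine] at this
      refine this.trans (mul_le_mul_of_nonneg_right ?_ hδ)
      rw [div_le_div_iff₀ (by positivity) (by positivity)]
      push_cast
      nlinarith
    refine Fin.cases ?_ (fun i => ?_) i <;> refine Fin.cases ?_ (fun j => ?_) j
    · simp only [Fin.cons_zero, dist_self]
      positivity
    · simp only [Fin.cons_zero, Fin.cons_succ]
      rw [dist_comm]
      exact hcone _
    · simp only [Fin.cons_zero, Fin.cons_succ]
      exact hcone _
    · simp only [Fin.cons_succ]
      exact hbase i j

/-- The affine simplices of diameter at most `δ` inside the singular simplex `σ`. -/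
def affineIn {n : ℕ} (σ : C(Simp n, X)) (δ : ℝ) : Set C(Simp n, X) :=
  {τ | ∃ v : Fin (n + 1) → Prism n, (∀ a b, dist (prismProj n (v a)) (prismProj n (v b)) ≤ δ) ∧
    τ = σ.comp ((prismProj n).comp (prismAffine v))}

/-- The barycentric subdivision operator. -/
def subdiv (n : ℕ) : Module.End R (Chains R X n) :=
  prismOp ω (fun σ => σ.comp (prismProj n)) (subdivChain n)

theorem prismProj_prismAffine {n m : ℕ} (v : Fin (m + 1) → Prism n) (s : Simp m) :
    (prismProj n (prismAffine v s)).1 = affine (fun i => (prismProj n (v i)).1) s := by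
  change (∑ i, s.1 i • (v i).1 : (Fin (n + 1) → ℝ) × ℝ).1 = _
  rw [Prod.fst_sum]
  rfl

theorem subdiv_mem_supported {n : ℕ} (σ : C(Simp n, X)) (δ : ℝ) {τ : C(Simp n, X)}
    (hτ : τ ∈ affineIn σ δ) : subdiv ω n (Finsupp.single τ 1) ∈
      Finsupp.supported R R (affineIn σ (n / (n + 1) * δ)) := by
  obtain ⟨v, hv, rfl⟩ := hτ
  rw [subdiv, prismOp_single]
  refine push_mem_supported ω _ _ _ fun v' hv' => ?_
  -- The vertices of a subdivision simplex, carried into the affine simplex with vertices `v`.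
  refine ⟨fun j => prismAffine v (prismProj n (v' j)), fun a b => ?_, ?_⟩
  · have := (Finsupp.mem_supported ℤ _).mp (subdivChain_mem_supported n) hv'
    have := this (n + 1) (fun i => (prismProj n (v i)).1) δ (fun a b => hv a b) a b
    rwa [← prismProj_prismAffine, ← prismProj_prismAffine] at this
  · ext1 s
    exact congrArg σ (congrArg (prismProj n) (Subtype.ext
      (affine_prismProj_prismAffine (fun i => (v i).1) v' s)))

theorem subdiv_pow_mem_supported {n : ℕ} (σ : C(Simp n, X)) (δ : ℝ)
    (hσ : σ ∈ affineIn σ δ) (m : ℕ) : (subdiv ω n ^ m) (Finsupp.single σ 1) ∈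
      Finsupp.supported R R (affineIn σ ((n / (n + 1)) ^ m * δ)) := by
  induction m with
  | zero => exact Finsupp.single_mem_supported R _ (by simpa using hσ)
  | succ m ih =>
    rw [pow_succ' (subdiv ω n), Module.End.mul_apply, pow_succ' ((n : ℝ) / (n + 1)), mul_assoc]
    exact map_mem_supported (fun τ hτ => subdiv_mem_supported ω σ _ hτ) ih

theorem exists_mem_affineIn {n : ℕ} (σ : C(Simp n, X)) : ∃ δ, σ ∈ affineIn σ δ := by
  obtain ⟨C, hC⟩ := Metric.isBounded_iff.mp (bounded_stdSimplex (Fin (n + 1)))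
  refine ⟨C, levelVertex n 0, fun a b => hC (prismProj n _).2 (prismProj n _).2, ?_⟩
  rw [prismAffine_levelVertex]
  rfl

/-- The mesh `(n / (n + 1)) ^ m * δ` tends to zero, hence drops below a Lebesgue number of the cover
of the simplex by the preimages of `O₁` and `O₂`. The exponent depends on `σ`; local nilpotency asks
for no more. -/
theorem exists_subdiv_pow_mem {n : ℕ} (σ : C(Simp n, X)) {B O₁ O₂ : Set X} (h₁ : IsOpen O₁)
    (h₂ : IsOpen O₂) (hB : B ⊆ O₁ ∪ O₂) (hσ : σ ∈ simplicesIn B n) :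
    ∃ m : ℕ, (subdiv ω n ^ m) (Finsupp.single σ 1) ∈
      Finsupp.supported R R (simplicesIn (B ∩ O₁) n ∪ simplicesIn (B ∩ O₂) n) := by
  have : CompactSpace (Simp n) := isCompact_iff_compactSpace.mp (isCompact_stdSimplex ℝ _)
  obtain ⟨ε, hε, hball⟩ := lebesgue_number_lemma_of_metric (s := (Set.univ : Set (Simp n)))
    (c := fun b : Bool => if b then σ ⁻¹' O₁ else σ ⁻¹' O₂) isCompact_univ
    (by
      intro b
      cases b
      · exact h₂.preimage σ.continuous
      · exact h₁.preimage σ.continuous)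
    (by
      intro s _
      rcases hB (hσ s) with h | h
      · exact Set.mem_iUnion.mpr ⟨true, h⟩
      · exact Set.mem_iUnion.mpr ⟨false, h⟩)
  obtain ⟨δ, hδ⟩ := exists_mem_affineIn σ
  have hlim : Filter.Tendsto (fun m : ℕ => ((n : ℝ) / (n + 1)) ^ m * δ) Filter.atTop (nhds 0) := by
    rw [← zero_mul δ]
    exact (tendsto_pow_atTop_nhds_zero_of_lt_one (by positivity)
      (by rw [div_lt_one (by positivity)]; linarith)).mul_const δ
  obtain ⟨m, hm⟩ := (hlim.eventually_lt_const hε).exists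
  refine ⟨m, Finsupp.supported_mono ?_ (subdiv_pow_mem_supported ω σ δ hδ m)⟩
  rintro _ ⟨v, hv, rfl⟩
  obtain ⟨b, hb⟩ := hball (prismProj n (v 0)) trivial
  have hmem (s : Simp n) : σ (prismProj n (prismAffine v s)) ∈ if b then O₁ else O₂ := by
    have : prismProj n (prismAffine v s) ∈ Metric.ball (prismProj n (v 0)) ε := by
      have h := affine_mem_of_convex (convex_closedBall (prismProj n (v 0)).1 _)
        (fun i => (prismProj n (v i)).1) (fun i => hv i 0) s
      rw [← prismProj_prismAffine] at h
      exact lt_of_le_of_lt h hm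
    have := hb this
    cases b <;> exact this
  cases b
  · exact Or.inr fun s => ⟨hσ _, hmem s⟩
  · exact Or.inl fun s => ⟨hσ _, hmem s⟩

/-- The Mayer-Vietoris property. -/
theorem Piece.IsFiniteFree.of_cover {B O₁ O₂ : Set X} (h₁ : IsOpen O₁) (h₂ : IsOpen O₂)
    (hB : B ⊆ O₁ ∪ O₂) (g₁ : (Piece.ofSet (B ∩ O₁)).IsFiniteFree ω)
    (g₂ : (Piece.ofSet (B ∩ O₂)).IsFiniteFree ω)
    (g : (Piece.ofSet (B ∩ O₁ ∩ (B ∩ O₂))).IsFiniteFree ω) :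
    (Piece.ofSet B).IsFiniteFree ω := by
  have hS : FaceClosed fun n => simplicesIn (B ∩ O₁) n ∪ simplicesIn (B ∩ O₂) n :=
    fun n σ i h => h.imp (faceClosed_simplicesIn _ σ i) (faceClosed_simplicesIn _ σ i)
  have hdiff : ((Piece.ofSet (B ∩ O₁)).sdiff (faceClosed_simplicesIn (B ∩ O₂))).IsFiniteFree ω :=
    Piece.IsFiniteFree.sdiff (faceClosed_simplicesIn (B ∩ O₂))
      (by rw [Piece.ofSet_inter]; exact g) g₁
  -- Modulo the chains in `B ∩ O₂`, the small chains are those in `B ∩ O₁` modulo the chains in the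
  -- intersection.
  have hsmall : ((Piece.ofSet B).inter hS).IsFiniteFree ω := by
    refine Piece.IsFiniteFree.of_inter_of_sdiff (faceClosed_simplicesIn (B ∩ O₂)) ?_ ?_
    · convert g₂ using 1
      refine Piece.ext' fun n σ => ⟨fun h => h.2, fun h => ⟨⟨fun s => (h s).1, Or.inr h⟩, h⟩⟩
    · convert hdiff using 1
      exact Piece.ext' fun n σ => ⟨fun h => ⟨h.1.2.resolve_right h.2, h.2⟩,
        fun h => ⟨⟨fun s => (h.1 s).1, Or.inl h.1⟩, h.2⟩⟩
  refine Piece.IsFiniteFree.of_inter_of_sdiff hS hsmall ?_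
  let G (n : ℕ) (σ : C(Simp n, X)) : C(Prism n, X) := σ.comp (prismProj n)
  -- Filling this family gives a homotopy from the identity to a single subdivision, which is
  -- locally nilpotent modulo small chains.
  let a (n : ℕ) : OrderedChains (Prism n) n := levelChain 0 n - subdivChain n
  have ha0 : OrderedChains.aug (a 0) = 0 := by
    have : a 0 = 0 := sub_self _
    rw [this, map_zero]
  have ha (n : ℕ) : OrderedChains.bdry n (a (n + 1)) = faces n n (a n) := by
    simp only [a, map_sub, bdry_levelChain, bdry_subdivChain]
  have hd (n : ℕ) (σ : C(Simp n, X)) :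
      prismOp ω (G n) (a n) (Finsupp.single σ 1) =
        Finsupp.single σ 1 - subdiv ω n (Finsupp.single σ 1) := by
    simp only [subdiv, prismOp_single, a, map_sub, push_levelChain_zero]
    rfl
  have hop {n m : ℕ} (c : OrderedChains (Prism n) m) (C : Set X) (σ : C(Simp n, X))
      (hσ : σ ∈ simplicesIn C n) : prismOp ω (G n) c (Finsupp.single σ 1) ∈
        Finsupp.supported R R (simplicesIn C m) := by
    rw [prismOp_single]
    exact push_mem_simplicesIn ω _ _ _ fun p => hσ _
  have hop' {n m : ℕ} (c : OrderedChains (Prism n) m) (σ : C(Simp n, X))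
      (hσ : σ ∈ simplicesIn (B ∩ O₁) n ∪ simplicesIn (B ∩ O₂) n) :
      prismOp ω (G n) c (Finsupp.single σ 1) ∈
        Finsupp.supported R R (simplicesIn (B ∩ O₁) m ∪ simplicesIn (B ∩ O₂) m) := by
    rcases hσ with hσ | hσ
    · exact Finsupp.supported_mono Set.subset_union_left (hop c _ σ hσ)
    · exact Finsupp.supported_mono Set.subset_union_right (hop c _ σ hσ)
  refine Piece.isFiniteFree_of_homotopy _ ω (faceClosed_simplicesIn B) hS (fun n => rfl)
    (fun n => prismOp ω (G n) (fillChain a n)) (fun n => subdiv ω n)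
    (fun n => hop _ B) (fun n => hop' _) (fun n => hop _ B) (fun n => hop' _)
    (fun σ _ => ?_) (fun n σ _ => ?_) fun n σ hσ => exists_subdiv_pow_mem ω σ h₁ h₂ hB hσ
  · exact (prismOp_fillChain_zero ω ha0 (G 0) σ).trans (hd 0 σ)
  · exact (prismOp_fillChain ω ha0 ha G rfl fun i => rfl).trans (hd (n + 1) σ)

end Subsets

end TwistedHomology

end

noncomputable section

namespace TwistedHomology

/-! ## Cells -/

/-! ### Continuity criteria for glued maps. -/

section Topology

/-- A set imposes no condition at a point outside its closure. -/
theorem continuousOn_union_of_separated {Y Z : Type*} [TopologicalSpace Y] [TopologicalSpace Z]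
    {f : Y → Z} {s t : Set Y} (hs : ContinuousOn f s) (ht : ContinuousOn f t)
    (hst : closure s ∩ t ⊆ s) (hts : closure t ∩ s ⊆ t) : ContinuousOn f (s ∪ t) := by
  intro x hx
  refine ContinuousWithinAt.union ?_ ?_
  · by_cases h : x ∈ closure s
    · exact hs x (hx.elim id fun ht => hst ⟨h, ht⟩)
    · exact continuousWithinAt_of_notMem_closure h
  · by_cases h : x ∈ closure t
    · exact ht x (hx.elim (fun hs => hts ⟨h, hs⟩) id)
    · exact continuousWithinAt_of_notMem_closure h

/-- A continuous map from a compact space to a Hausdorff one is closed, so its restriction over `D`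
is a quotient map. -/
theorem continuousOn_of_comp_of_isCompact {Y Z W : Type*} [TopologicalSpace Y] [TopologicalSpace Z]
    [T2Space Z] [TopologicalSpace W] {q : Y → Z} {f : Z → W} {K : Set Y} {D : Set Z}
    (hK : IsCompact K) (hq : ContinuousOn q K) (hD : D ⊆ q '' K)
    (hf : ContinuousOn (f ∘ q) (K ∩ q ⁻¹' D)) : ContinuousOn f D := by
  have : CompactSpace K := isCompact_iff_compactSpace.mp hK
  have hq' : Continuous (K.domRestrict q) := continuousOn_iff_continuous_domRestrict.mp hq
  have hquot : Topology.IsQuotientMap (D.restrictPreimage (K.domRestrict q)) := by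
    refine (hq'.isClosedMap.restrictPreimage D).isQuotientMap (hq'.restrictPreimage) ?_
    rintro ⟨z, hz⟩
    obtain ⟨y, hy, rfl⟩ := hD hz
    exact ⟨⟨⟨y, hy⟩, hz⟩, rfl⟩
  rw [continuousOn_iff_continuous_domRestrict, hquot.continuous_iff]
  exact hf.comp_continuous (f := fun y : (K.domRestrict q) ⁻¹' D => y.1.1) (by fun_prop)
    fun y => ⟨y.1.2, y.2⟩

end Topology

/-! ### Open cells, punctured cells and cell attachment. -/

section Cells

variable {X : Type u} [TopologicalSpace X] {R : Type w} [CommRing R] (ω : Weight R X)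
  {n : ℕ} {φ : PartialEquiv (Fin n → ℝ) X}

/-- The straight-line contraction to `p`, carried into `X`, deforms the image onto a point. -/
theorem Piece.IsFiniteFree.image_of_starConvex (hs : φ.source = Metric.ball 0 1)
    (hc : ContinuousOn φ (Metric.closedBall 0 1)) (hi : ContinuousOn φ.symm φ.target)
    {S : Set (Fin n → ℝ)} (hS : S ⊆ Metric.ball 0 1) {p : Fin n → ℝ} (hp : p ∈ S)
    (hstar : StarConvex ℝ p S) : (Piece.ofSet (φ '' S)).IsFiniteFree ω := by
  have hl {y : Fin n → ℝ} (hy : y ∈ S) : φ.symm (φ y) = y := φ.left_inv (hs ▸ hS hy)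
  have hmem {y : Fin n → ℝ} (hy : y ∈ S) (t : unitInterval) :
      (1 - (t : ℝ)) • y + (t : ℝ) • p ∈ S := by
    rw [add_comm]
    exact hstar hy t.2.1 (sub_nonneg.mpr t.2.2) (by ring)
  have hcS : ContinuousOn φ.symm (φ '' S) := hi.mono (by
    rintro _ ⟨y, hy, rfl⟩
    exact φ.map_source (hs ▸ hS hy))
  refine Piece.IsFiniteFree.of_deformation (A := {φ p}) ω
    (Set.singleton_subset_iff.mpr ⟨p, hp, rfl⟩)
    (fun q => φ ((1 - (q.2 : ℝ)) • φ.symm q.1 + (q.2 : ℝ) • p)) ?_ ?_ ?_ ?_ ?_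
    (Piece.isFiniteFree_singleton ω _)
  · refine hc.comp (t := Metric.closedBall 0 1) ?_ ?_
    · refine ContinuousOn.add (ContinuousOn.smul (f := fun q : X × unitInterval => 1 - (q.2 : ℝ))
        (Continuous.continuousOn (by fun_prop)) ?_) (Continuous.continuousOn (by fun_prop))
      exact hcS.comp continuousOn_fst fun q hq => hq.1
    · rintro ⟨_, t⟩ ⟨⟨y, hy, rfl⟩, -⟩
      refine Metric.ball_subset_closedBall (hS ?_)
      simp only [hl hy]
      exact hmem hy t
  · rintro _ ⟨y, hy, rfl⟩
    simp [hl hy]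
  · rintro _ ⟨y, hy, rfl⟩ t
    refine ⟨_, ?_, rfl⟩
    simp only [hl hy]
    exact hmem hy t
  · rintro _ rfl t
    simp only [hl hp, ← add_smul, sub_add_cancel, one_smul]
    rfl
  · rintro _ ⟨y, hy, rfl⟩
    simp

/-- Mayer-Vietoris in cell coordinates: by continuity of `φ.symm`, open subsets of the ball are
traces of open subsets of `X`, although the cell need not be open in `X`. -/
theorem Piece.IsFiniteFree.image_of_cover (hs : φ.source = Metric.ball 0 1)
    (hi : ContinuousOn φ.symm φ.target) {S W₁ W₂ : Set (Fin n → ℝ)} (hS : S ⊆ Metric.ball 0 1)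
    (h₁ : IsOpen W₁) (h₂ : IsOpen W₂) (hW : S ⊆ W₁ ∪ W₂)
    (g₁ : (Piece.ofSet (φ '' (S ∩ W₁))).IsFiniteFree ω)
    (g₂ : (Piece.ofSet (φ '' (S ∩ W₂))).IsFiniteFree ω)
    (g : (Piece.ofSet (φ '' (S ∩ W₁ ∩ (S ∩ W₂)))).IsFiniteFree ω) :
    (Piece.ofSet (φ '' S)).IsFiniteFree ω := by
  have hinj : Set.InjOn φ S := φ.injOn.mono (hs ▸ hS)
  have hopen {W : Set (Fin n → ℝ)} (hW : IsOpen W) :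
      ∃ O, IsOpen O ∧ ∀ y ∈ S, φ y ∈ O ↔ y ∈ W := by
    obtain ⟨O, hO, h⟩ := continuousOn_iff'.mp hi W hW
    refine ⟨O, hO, fun y hy => ?_⟩
    have ht : φ y ∈ φ.target := φ.map_source (hs ▸ hS hy)
    have := Set.ext_iff.mp h (φ y)
    simpa [ht, φ.left_inv (hs ▸ hS hy : y ∈ φ.source)] using this.symm
  obtain ⟨O₁, hO₁, e₁⟩ := hopen h₁
  obtain ⟨O₂, hO₂, e₂⟩ := hopen h₂
  have key {O W : Set _} (e : ∀ y ∈ S, φ y ∈ O ↔ y ∈ W) : φ '' S ∩ O = φ '' (S ∩ W) := by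
    ext x
    constructor
    · rintro ⟨⟨y, hy, rfl⟩, hO⟩
      exact ⟨y, ⟨hy, (e y hy).mp hO⟩, rfl⟩
    · rintro ⟨y, ⟨hy, hW⟩, rfl⟩
      exact ⟨⟨y, hy, rfl⟩, (e y hy).mpr hW⟩
  refine Piece.IsFiniteFree.of_cover ω hO₁ hO₂ ?_ ?_ ?_ ?_
  · rintro _ ⟨y, hy, rfl⟩
    exact (hW hy).imp (e₁ y hy).mpr (e₂ y hy).mpr
  · rwa [key e₁]
  · rwa [key e₂]
  · rwa [key e₁, key e₂, ← hinj.image_inter Set.inter_subset_left Set.inter_subset_left]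

/-- The points of the ball which have a nonzero coordinate among the first `k`. -/
def ballOff (n k : ℕ) : Set (Fin n → ℝ) := Metric.ball 0 1 ∩ {y | ∃ i : Fin n, i.val < k ∧ y i ≠ 0}

/-- The points which have a nonzero coordinate among the first `k`, or whose next coordinate has
the sign of `ε`. -/
def halfOff {n k : ℕ} (hk : k < n) (ε : ℝ) : Set (Fin n → ℝ) :=
  {y | (∃ i : Fin n, i.val < k ∧ y i ≠ 0) ∨ (0 : ℝ) < ε * y ⟨k, hk⟩}

/-- The center has zeros in its first `k` coordinates, so moving towards it only rescales those of
`y`; if instead `y` has the right sign at `k`, so does every point of the segment. -/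
theorem starConvex_ballOff {k : ℕ} (hk : k < n) {ε : ℝ} (hε : ε = 1 ∨ ε = -1) :
    StarConvex ℝ (Pi.single (M := fun _ => ℝ) ⟨k, hk⟩ (ε / 2))
      (Metric.ball 0 1 ∩ halfOff hk ε) := by
  have hε2 : ε * ε = 1 := by rcases hε with rfl | rfl <;> norm_num
  rintro y ⟨hy, hy'⟩ a b ha hb hab
  refine ⟨(convex_ball 0 1) ?_ hy ha hb hab, ?_⟩
  · rw [mem_ball_zero_iff, Pi.norm_single]
    rcases hε with rfl | rfl <;> norm_num
  · have hkk : (a • (Pi.single ⟨k, hk⟩ (ε / 2) : Fin n → ℝ) + b • y) ⟨k, hk⟩ =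
        a * (ε / 2) + b * y ⟨k, hk⟩ := by
      simp
    have hki {i : Fin n} (hi : i.val < k) :
        (a • (Pi.single ⟨k, hk⟩ (ε / 2) : Fin n → ℝ) + b • y) i = b * y i := by
      have : i ≠ ⟨k, hk⟩ := fun h => by simp [h] at hi
      simp [Pi.single_eq_of_ne this]
    have hpos {c : ℝ} (h : 0 < a * (1 / 2) + b * (ε * c)) : 0 < ε * (a * (ε / 2) + b * c) := by
      have : ε * (a * (ε / 2) + b * c) = a * (1 / 2) * (ε * ε) + b * (ε * c) := by ring
      rwa [this, hε2, mul_one]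
    rcases hb.eq_or_lt with rfl | hb
    · refine Or.inr ?_
      rw [hkk]
      refine hpos ?_
      rw [add_zero] at hab
      rw [hab]
      norm_num
    · rcases hy' with ⟨i, hi, hyi⟩ | h
      · refine Or.inl ⟨i, hi, ?_⟩
        rw [hki hi]
        exact mul_ne_zero hb.ne' hyi
      · refine Or.inr ?_
        rw [hkk]
        exact hpos (by positivity)

/-- Two star-convex open halves cover `ballOff n (k + 1)` and meet in `ballOff n k`, just as two
hemispheres meet around an equator. For `k = n` this is the punctured ball. -/
theorem Piece.isFiniteFree_image_ballOff (hs : φ.source = Metric.ball 0 1)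
    (hc : ContinuousOn φ (Metric.closedBall 0 1)) (hi : ContinuousOn φ.symm φ.target) (k : ℕ)
    (hk : k ≤ n) : (Piece.ofSet (φ '' ballOff n k)).IsFiniteFree ω := by
  induction k with
  | zero =>
    have : ballOff n 0 = ∅ := by
      ext y
      simp [ballOff]
    rw [this, Set.image_empty]
    exact Piece.isFiniteFree_empty ω
  | succ k ih =>
    have hk' : k < n := hk
    let W (ε : ℝ) : Set (Fin n → ℝ) := halfOff hk' ε
    have hW (ε : ℝ) : IsOpen (W ε) := by
      refine IsOpen.union ?_ (isOpen_lt continuous_const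
        (continuous_const.mul (continuous_apply _)))
      have : ({y | ∃ i : Fin n, i.val < k ∧ y i ≠ 0} : Set (Fin n → ℝ)) =
          ⋃ (i : Fin n) (_ : i.val < k), {y | y i ≠ 0} := by
        ext y
        simp
      exact this.symm.subst (motive := IsOpen) (isOpen_iUnion fun i => isOpen_iUnion fun _ =>
        isOpen_ne_fun (continuous_apply i) continuous_const)
    have hsub {ε : ℝ} : Metric.ball 0 1 ∩ W ε ⊆ ballOff n (k + 1) := by
      rintro y ⟨hy, ⟨i, hi, hyi⟩ | h⟩
      · exact ⟨hy, i, by lia, hyi⟩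
      · exact ⟨hy, ⟨k, hk'⟩, Nat.lt_succ_self k, right_ne_zero_of_mul h.ne'⟩
    have hinter (ε : ℝ) : ballOff n (k + 1) ∩ W ε = Metric.ball 0 1 ∩ W ε :=
      Set.Subset.antisymm (fun y hy => ⟨hy.1.1, hy.2⟩) fun y hy => ⟨hsub hy, hy.2⟩
    have hgood {ε : ℝ} (hε : ε = 1 ∨ ε = -1) :
        (Piece.ofSet (φ '' (ballOff n (k + 1) ∩ W ε))).IsFiniteFree ω := by
      rw [hinter]
      refine Piece.IsFiniteFree.image_of_starConvex ω hs hc hi Set.inter_subset_left ?_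
        (starConvex_ballOff hk' hε)
      refine ⟨?_, Or.inr ?_⟩
      · rw [mem_ball_zero_iff, Pi.norm_single]
        rcases hε with rfl | rfl <;> norm_num
      · rw [Pi.single_eq_same]
        rcases hε with rfl | rfl <;> norm_num
    refine Piece.IsFiniteFree.image_of_cover ω hs hi Set.inter_subset_left (hW 1) (hW (-1)) ?_
      (hgood (Or.inl rfl)) (hgood (Or.inr rfl)) ?_
    · rintro y ⟨-, i, hi, hyi⟩
      rcases (Nat.lt_succ_iff.mp hi).lt_or_eq with h | h
      · exact Or.inl (Or.inl ⟨i, h, hyi⟩)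
      · obtain rfl : i = ⟨k, hk'⟩ := Fin.ext h
        rcases hyi.lt_or_gt with h | h
        · exact Or.inr (Or.inr (by linarith))
        · exact Or.inl (Or.inr (by linarith))
    · convert ih hk'.le using 3
      rw [hinter, hinter]
      ext y
      constructor
      · rintro ⟨⟨hy, h⟩, -, h'⟩
        refine ⟨hy, ?_⟩
        rcases h with h | h
        · exact h
        · rcases h' with h' | h'
          · exact h'
          · linarith
      · rintro ⟨hy, h⟩
        exact ⟨⟨hy, Or.inl h⟩, hy, Or.inl h⟩

theorem ballOff_self : ballOff n n = Metric.ball 0 1 \ {0} := by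
  ext y
  simp [ballOff, funext_iff]

/-- Attaching a cell. -/
theorem Piece.IsFiniteFree.union_cell [T2Space X] (hs : φ.source = Metric.ball 0 1)
    (hc : ContinuousOn φ (Metric.closedBall 0 1)) (hi : ContinuousOn φ.symm φ.target)
    {A : Set X} (hA : IsClosed A) (hf : φ '' Metric.sphere 0 1 ⊆ A)
    (hd : Disjoint A (φ '' Metric.ball 0 1)) (h : (Piece.ofSet A).IsFiniteFree ω) :
    (Piece.ofSet (A ∪ φ '' Metric.ball 0 1)).IsFiniteFree ω := by
  classical
  have h0 : (0 : Fin n → ℝ) ∈ Metric.ball 0 1 := Metric.mem_ball_self one_pos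
  have hinj : Set.InjOn φ (Metric.ball 0 1) := hs ▸ φ.injOn
  have hl {y : Fin n → ℝ} (hy : y ∈ Metric.ball 0 1) : φ.symm (φ y) = y := φ.left_inv (hs ▸ hy)
  have hnA {y : Fin n → ℝ} (hy : y ∈ Metric.ball 0 1) : φ y ∉ A :=
    fun hyA => Set.disjoint_left.mp hd hyA ⟨y, hy, rfl⟩
  have hball : (Piece.ofSet (φ '' Metric.ball 0 1)).IsFiniteFree ω :=
    Piece.IsFiniteFree.image_of_starConvex ω hs hc hi subset_rfl h0
      ((convex_ball 0 1).starConvex h0)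
  have hoff : (Piece.ofSet (φ '' (Metric.ball 0 1 \ {0}))).IsFiniteFree ω := by
    rw [← ballOff_self]
    exact Piece.isFiniteFree_image_ballOff ω hs hc hi n le_rfl
  have e₁ : (A ∪ φ '' Metric.ball 0 1) ∩ {φ 0}ᶜ = A ∪ φ '' (Metric.ball 0 1 \ {0}) := by
    ext x
    constructor
    · rintro ⟨hx | ⟨y, hy, rfl⟩, hx'⟩
      · exact Or.inl hx
      · refine Or.inr ⟨y, ⟨hy, fun h => hx' ?_⟩, rfl⟩
        rw [Set.mem_singleton_iff.mp h]
        rfl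
    · rintro (hx | ⟨y, ⟨hy, hy0⟩, rfl⟩)
      · exact ⟨Or.inl hx, fun h => hnA h0 (Set.mem_singleton_iff.mp h ▸ hx)⟩
      · exact ⟨Or.inr ⟨y, hy, rfl⟩, fun h => hy0 (hinj hy h0 h)⟩
  have e₂ : (A ∪ φ '' Metric.ball 0 1) ∩ Aᶜ = φ '' Metric.ball 0 1 := by
    ext x
    constructor
    · rintro ⟨hx | hx, hx'⟩
      · exact (hx' hx).elim
      · exact hx
    · exact fun hx => ⟨Or.inr hx, fun h => Set.disjoint_left.mp hd h hx⟩
  -- The complement of the cell's center deforms onto `A`, the complement of `A` is the open cell,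
  -- and they meet in the punctured cell.
  refine Piece.IsFiniteFree.of_cover ω (isOpen_compl_singleton (x := φ 0)) hA.isOpen_compl ?_ ?_
    ?_ ?_
  · intro x _
    by_cases hx : x ∈ A
    · exact Or.inl fun h => hnA h0 (Set.mem_singleton_iff.mp h ▸ hx)
    · exact Or.inr hx
  · rw [e₁]
    -- Radial motion to the unit sphere. It fixes the sphere, so it is compatible with the identity
    -- on `A`.
    let r (y : Fin n → ℝ) (t : ℝ) : Fin n → ℝ := (1 - t) • y + t • ‖y‖⁻¹ • y
    have hr0 (y : Fin n → ℝ) : r y 0 = y := by simp [r]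
    have hr1 {y : Fin n → ℝ} (hy : y ≠ 0) : ‖r y 1‖ = 1 := by
      simp [r, norm_smul, norm_ne_zero_iff.mpr hy]
    have hrs {y : Fin n → ℝ} (hy : ‖y‖ = 1) (t : ℝ) : r y t = y := by
      simp [r, hy, ← add_smul]
    have hr {y : Fin n → ℝ} (hy : y ≠ 0) (hy1 : ‖y‖ ≤ 1) (t : unitInterval) :
        r y t ≠ 0 ∧ ‖r y t‖ ≤ 1 := by
      have hpos : 0 < ‖y‖ := norm_pos_iff.mpr hy
      have e : r y t = ((1 - (t : ℝ)) + t * ‖y‖⁻¹) • y := by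
        simp only [r, add_smul, smul_smul]
      have h1 : 0 ≤ 1 - (t : ℝ) := sub_nonneg.mpr t.2.2
      have h2 : 0 ≤ (t : ℝ) := t.2.1
      have h3 : 1 ≤ ‖y‖⁻¹ := (one_le_inv₀ hpos).mpr hy1
      have h4 : 0 < (1 - (t : ℝ)) + t * ‖y‖⁻¹ := by nlinarith
      refine ⟨e ▸ smul_ne_zero h4.ne' hy, ?_⟩
      rw [e, norm_smul, Real.norm_of_nonneg h4.le, add_mul, mul_assoc, inv_mul_cancel₀ hpos.ne']
      nlinarith
    let H (q : X × unitInterval) : X := if q.1 ∈ A then q.1 else φ (r (φ.symm q.1) q.2)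
    have HA {x : X} (hx : x ∈ A) (t : unitInterval) : H (x, t) = x := if_pos hx
    have Hφ {y : Fin n → ℝ} (hy : ‖y‖ ≤ 1) (t : unitInterval) : H (φ y, t) = φ (r y t) := by
      rcases hy.lt_or_eq with hy | hy
      · have hy : y ∈ Metric.ball 0 1 := mem_ball_zero_iff.mpr hy
        simp only [H, if_neg (hnA hy), hl hy]
      · rw [HA (hf ⟨y, mem_sphere_zero_iff_norm.mpr hy, rfl⟩), hrs hy]
    have hmem {y : Fin n → ℝ} (hy0 : y ≠ 0) (hy : ‖y‖ ≤ 1) :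
        φ y ∈ A ∪ φ '' (Metric.ball 0 1 \ {0}) := by
      rcases hy.lt_or_eq with hy | hy
      · exact Or.inr ⟨y, ⟨mem_ball_zero_iff.mpr hy, hy0⟩, rfl⟩
      · exact Or.inl (hf ⟨y, mem_sphere_zero_iff_norm.mpr hy, rfl⟩)
    -- The boundary sphere is included so that continuity on `D` can be tested on the compact closed
    -- ball; its image already lies in `A`.
    let D : Set X := φ '' (Metric.closedBall 0 1 \ {0})
    have hB : A ∪ φ '' (Metric.ball 0 1 \ {0}) = A ∪ D := by
      refine Set.Subset.antisymm (Set.union_subset_union_right _ (Set.image_mono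
        (Set.sdiff_subset_sdiff_left Metric.ball_subset_closedBall)))
        (Set.union_subset Set.subset_union_left ?_)
      rintro _ ⟨y, ⟨hy, hy0⟩, rfl⟩
      exact hmem hy0 (mem_closedBall_zero_iff.mp hy)
    have hnD : φ 0 ∉ D := by
      rintro ⟨y, ⟨hy, hy0⟩, e⟩
      rcases hmem hy0 (mem_closedBall_zero_iff.mp hy) with h | ⟨z, ⟨hz, hz0⟩, e'⟩
      · exact hnA h0 (e ▸ h)
      · exact hz0 (hinj hz h0 (e'.trans e))
    have hcomp : IsCompact (φ '' Metric.closedBall 0 1) :=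
      (isCompact_closedBall 0 1).image_of_continuousOn hc
    have hHD : ContinuousOn H (D ×ˢ Set.univ) := by
      refine continuousOn_of_comp_of_isCompact
        (q := Prod.map φ (id : unitInterval → unitInterval))
        (K := Metric.closedBall 0 1 ×ˢ Set.univ) ((isCompact_closedBall 0 1).prod isCompact_univ)
        (hc.prodMap continuousOn_id) ?_ ?_
      · rintro ⟨_, t⟩ ⟨⟨y, ⟨hy, hy0⟩, rfl⟩, -⟩
        exact ⟨(y, t), ⟨hy, trivial⟩, rfl⟩
      · have hne {q : (Fin n → ℝ) × unitInterval} (hq : q ∈ (Metric.closedBall 0 1 ×ˢ Set.univ) ∩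
            Prod.map φ (id : unitInterval → unitInterval) ⁻¹' (D ×ˢ Set.univ)) : q.1 ≠ 0 :=
          fun h => hnD (h ▸ hq.2.1)
        have hle {q : (Fin n → ℝ) × unitInterval} (hq : q ∈ (Metric.closedBall 0 1 ×ˢ Set.univ) ∩
            Prod.map φ (id : unitInterval → unitInterval) ⁻¹' (D ×ˢ Set.univ)) : ‖q.1‖ ≤ 1 :=
          mem_closedBall_zero_iff.mp hq.1.1
        refine ContinuousOn.congr (f := fun q : (Fin n → ℝ) × unitInterval => φ (r q.1 q.2)) ?_
          fun q hq => Hφ (hle hq) q.2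
        refine hc.comp ?_ fun q hq => mem_closedBall_zero_iff.mpr (hr (hne hq) (hle hq) q.2).2
        refine ContinuousOn.add (Continuous.continuousOn (by fun_prop)) ?_
        refine ContinuousOn.smul (f := fun q : (Fin n → ℝ) × unitInterval => (q.2 : ℝ))
          (Continuous.continuousOn (by fun_prop)) ?_
        refine ContinuousOn.smul (f := fun q : (Fin n → ℝ) × unitInterval => ‖q.1‖⁻¹) ?_
          continuousOn_fst
        exact ContinuousOn.inv₀ (Continuous.continuousOn (by fun_prop))
          fun q hq => norm_ne_zero_iff.mpr (hne hq)
    refine Piece.IsFiniteFree.of_deformation ω Set.subset_union_left H ?_ ?_ ?_ ?_ ?_ h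
    · rw [hB, Set.union_prod]
      -- `A` is closed, and a limit point of `D` in `A` is the image of a point of the closed ball
      -- other than the center.
      refine continuousOn_union_of_separated
        (continuousOn_fst.congr fun q hq => HA hq.1 q.2) hHD ?_ ?_
      · rintro q ⟨hq, -⟩
        rwa [closure_prod_eq, hA.closure_eq, closure_univ] at hq
      · rintro q ⟨hq, hqA⟩
        rw [closure_prod_eq] at hq
        obtain ⟨y, hy, e⟩ := closure_minimal (Set.image_mono Set.sdiff_subset) hcomp.isClosed hq.1
        refine ⟨⟨y, ⟨hy, ?_⟩, e⟩, trivial⟩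
        rintro rfl
        exact hnA h0 (e ▸ hqA.1)
    · rintro x (hx | ⟨y, ⟨hy, hy0⟩, rfl⟩)
      · exact HA hx 0
      · rw [Hφ (mem_ball_zero_iff.mp hy).le]
        exact congrArg φ (hr0 y)
    · rintro x (hx | ⟨y, ⟨hy, hy0⟩, rfl⟩) t
      · exact (HA hx t).symm ▸ Or.inl hx
      · have hy := (mem_ball_zero_iff.mp hy).le
        rw [Hφ hy]
        exact hmem (hr hy0 hy t).1 (hr hy0 hy t).2
    · exact fun x hx t => (HA hx t).symm ▸ hx
    · rintro x (hx | ⟨y, ⟨hy, hy0⟩, rfl⟩)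
      · exact (HA hx 1).symm ▸ hx
      · rw [Hφ (mem_ball_zero_iff.mp hy).le]
        exact hf ⟨_, mem_sphere_zero_iff_norm.mpr (hr1 hy0), rfl⟩
  · rw [e₂]
    exact hball
  · rw [e₁, e₂]
    convert hoff using 2
    refine Set.Subset.antisymm ?_ fun x hx => ⟨Or.inr hx, Set.image_mono Set.sdiff_subset hx⟩
    rintro x ⟨hx | hx, hx'⟩
    · exact (Set.disjoint_left.mp hd hx hx').elim
    · exact hx

end Cells

/-! ### Induction over skeleta and their cells. -/

section CWComplex

open Topology

variable {X : Type u} [TopologicalSpace X] [T2Space X] {R : Type w} [CommRing R] (ω : Weight R X)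

/-- The singular chains of a finite CW complex, twisted by a weight, are homotopy equivalent to a
complex of finite free modules. -/
theorem Piece.isFiniteFree_univ [CWComplex (Set.univ : Set X)]
    [RelCWComplex.Finite (Set.univ : Set X)] :
    (Piece.ofSet (Set.univ : Set X)).IsFiniteFree ω := by
  classical
  have hskel (n : ℕ) : (Piece.ofSet (RelCWComplex.skeletonLT (Set.univ : Set X) n :
      Set X)).IsFiniteFree ω := by
    induction n with
    | zero =>
      convert Piece.isFiniteFree_empty ω using 2
      exact CWComplex.skeletonLT_zero_eq_empty
    | succ n ih =>
      have : Finite (RelCWComplex.cell (Set.univ : Set X) n) :=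
        RelCWComplex.FiniteType.finite_cell n
      have := Fintype.ofFinite (RelCWComplex.cell (Set.univ : Set X) n)
      -- The finitely many `n`-cells are attached one by one. A new open cell misses the earlier
      -- closed ones: their frontiers lie in the lower skeleton and distinct open cells are
      -- disjoint.
      have key (T : Finset (RelCWComplex.cell (Set.univ : Set X) n)) :
          (Piece.ofSet ((RelCWComplex.skeletonLT (Set.univ : Set X) n : Set X) ∪
            ⋃ j ∈ T, RelCWComplex.closedCell n j)).IsFiniteFree ω := by
        induction T using Finset.induction_on with
        | empty => simpa using ih
        | insert j T hj hT =>
          have hsub := RelCWComplex.cellFrontier_subset_skeletonLT (C := (Set.univ : Set X)) n j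
          convert Piece.IsFiniteFree.union_cell ω (RelCWComplex.source_eq n j)
            (RelCWComplex.continuousOn n j) (RelCWComplex.continuousOn_symm n j) ?_
            (hsub.trans Set.subset_union_left) ?_ hT using 2
          · rw [Finset.set_biUnion_insert,
              ← RelCWComplex.cellFrontier_union_openCell_eq_closedCell n j]
            ext x
            have := @hsub x
            simp only [Set.mem_union]
            tauto
          · exact (RelCWComplex.Subcomplex.closed _).union
              (T.finite_toSet.isClosed_biUnion fun j _ => RelCWComplex.isClosed_closedCell)
          · have hdis := RelCWComplex.disjoint_skeletonLT_openCell (C := (Set.univ : Set X))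
              (n := n) (j := j) le_rfl
            refine Set.disjoint_left.mpr ?_
            rintro x (hx | hx) hxj
            · exact Set.disjoint_left.mp hdis hx hxj
            · obtain ⟨i, hi, hx⟩ := Set.mem_iUnion₂.mp hx
              rw [← RelCWComplex.cellFrontier_union_openCell_eq_closedCell n i] at hx
              rcases hx with hx | hx
              · exact Set.disjoint_left.mp hdis
                  (RelCWComplex.cellFrontier_subset_skeletonLT n i hx) hxj
              · refine Set.disjoint_left.mp (RelCWComplex.disjoint_openCell_of_ne
                  (C := (Set.univ : Set X)) (i := i) (j := j) ?_) hx hxj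
                rintro ⟨⟩
                exact hj hi
      convert key Finset.univ using 2
      push_cast
      rw [← RelCWComplex.skeletonLT_union_iUnion_closedCell_eq_skeletonLT_succ]
      simp
  -- There are no cells of dimension `N` or more, so `skeletonLT N` is all of `X`.
  obtain ⟨N, hN⟩ := Filter.eventually_atTop.mp
    (RelCWComplex.FiniteDimensional.eventually_isEmpty_cell (C := (Set.univ : Set X)) (D := ∅))
  convert hskel N using 2
  refine (Set.eq_univ_of_forall fun x => ?_).symm
  have hx : x ∈ ⋃ (n : ℕ) (j : RelCWComplex.cell (Set.univ : Set X) n),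
      RelCWComplex.openCell n j := by
    rw [CWComplex.iUnion_openCell_eq_complex]
    trivial
  obtain ⟨m, j, hx⟩ := Set.mem_iUnion₂.mp hx
  refine RelCWComplex.closedCell_subset_skeletonLT m j
    (RelCWComplex.openCell_subset_closedCell m j hx) |> fun h =>
      RelCWComplex.skeletonLT_mono ?_ h
  by_contra hlt
  have hmN : N ≤ m := by
    norm_cast at hlt
    lia
  exact (hN m hmN).false j

end CWComplex

end TwistedHomology

end

noncomputable section

namespace TwistedHomology

/-! ## Base change of complexes -/

section BaseChange

universe v' w'

open TensorProduct Limits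

/-- Base change of modules along `R → S`. -/
def baseChange (R : Type w) [CommRing R] (S : Type w') [CommRing S] [Algebra R S] :
    ModuleCat.{v} R ⥤ ModuleCat.{max w' v} S where
  obj M := ModuleCat.of S (S ⊗[R] M)
  map g := ModuleCat.ofHom (g.hom.baseChange S)
  map_id _ := ModuleCat.hom_ext LinearMap.baseChange_id
  map_comp _ _ := ModuleCat.hom_ext (LinearMap.baseChange_comp _ _)

instance (R : Type w) [CommRing R] (S : Type w') [CommRing S] [Algebra R S] :
    (baseChange.{v} R S).Additive where
  map_add {_ _ f g} := ModuleCat.hom_ext (LinearMap.baseChange_add f.hom g.hom)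

/-- Additive functors commute with the extension of complexes by zero. -/
def mapExtendIso {C D : Type*} [Category C] [Category D] [Preadditive C] [Preadditive D]
    [HasZeroObject C] [HasZeroObject D] (T : C ⥤ D) [T.Additive]
    {ι ι' : Type*} {c : ComplexShape ι} {c' : ComplexShape ι'} (e : c.Embedding c')
    (K : HomologicalComplex C c) :
    (T.mapHomologicalComplex c').obj (K.extend e) ≅
      ((T.mapHomologicalComplex c).obj K).extend e := by
  classical
  have hz {i' : ι'} (h : ¬ ∃ i, e.f i = i') : IsZero (T.obj ((K.extend e).X i')) :=
    T.map_isZero (K.isZero_extend_X e i' fun i hi => h ⟨i, hi⟩)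
  have hz' {i' : ι'} (h : ¬ ∃ i, e.f i = i') :
      IsZero ((((T.mapHomologicalComplex c).obj K).extend e).X i') :=
    HomologicalComplex.isZero_extend_X _ e i' fun i hi => h ⟨i, hi⟩
  have hα : ∃ α : ∀ {i : ι} {i' : ι'} (_ : e.f i = i'),
      (((T.mapHomologicalComplex c).obj K).extend e).X i' ≅ T.obj (K.X i),
      ∀ {i j : ι} {i' j' : ι'} (hi : e.f i = i') (hj : e.f j = j'),
        (((T.mapHomologicalComplex c).obj K).extend e).d i' j' =
          (α hi).hom ≫ T.map (K.d i j) ≫ (α hj).inv :=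
    ⟨fun h => ((T.mapHomologicalComplex c).obj K).extendXIso e h,
      fun hi hj => HomologicalComplex.extend_d_eq _ e hi hj⟩
  let α := @hα.choose
  have hα := @hα.choose_spec
  let φ (i' : ι') : T.obj ((K.extend e).X i') ≅
      (((T.mapHomologicalComplex c).obj K).extend e).X i' :=
    if h : ∃ i, e.f i = i' then
      T.mapIso (K.extendXIso e h.choose_spec) ≪≫ (α h.choose_spec).symm
    else (hz h).iso (hz' h)
  -- Injectivity of `e.f` makes the component independent of the chosen preimage.
  have hφ {i : ι} {i' : ι'} (h : e.f i = i') :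
      φ i' = T.mapIso (K.extendXIso e h) ≪≫ (α h).symm := by
    have h' : ∃ i, e.f i = i' := ⟨i, h⟩
    have key (j : ι) (hj : e.f j = i') (hji : j = i) :
        T.mapIso (K.extendXIso e hj) ≪≫ (α hj).symm =
          T.mapIso (K.extendXIso e h) ≪≫ (α h).symm := by
      subst hji
      rfl
    exact (dif_pos h').trans (key _ h'.choose_spec (e.injective_f (h'.choose_spec.trans h.symm)))
  refine HomologicalComplex.Hom.isoOfComponents φ fun i' j' _ => ?_
  by_cases hi : ∃ i, e.f i = i'
  · by_cases hj : ∃ j, e.f j = j'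
    · obtain ⟨i, hi⟩ := hi
      obtain ⟨j, hj⟩ := hj
      change (φ i').hom ≫ (((T.mapHomologicalComplex c).obj K).extend e).d i' j' =
        T.map ((K.extend e).d i' j') ≫ (φ j').hom
      rw [hφ hi, hφ hj, hα hi hj, HomologicalComplex.extend_d_eq _ e hi hj]
      simp [α]
    · exact (hz' hj).eq_of_tgt _ _
  · exact (hz hi).eq_of_src _ _

/-- If `K` is homotopy equivalent to `F`, then the homology of the base change of `K` is that of
the base change of `F`. -/
theorem exists_homology_iso {R : Type w} [CommRing R] {K : ChainComplex (ModuleCat.{v} R) ℕ}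
    {F : CochainComplex (ModuleCat.{v} R) ℤ}
    (i : (HomotopyCategory.quotient _ _).obj (K.extend ComplexShape.embeddingDownNat) ≅
      (HomotopyCategory.quotient _ _).obj F)
    (S : Type w') [CommRing S] [Algebra R S] {L : ChainComplex (ModuleCat.{max w' v} S) ℕ}
    (j : ((baseChange R S).mapHomologicalComplex _).obj K ≅ L) :
    (∀ n : ℕ, Nonempty (L.homology n ≅
      (((baseChange R S).mapHomologicalComplex _).obj F).homology (-n))) ∧
    ∀ n : ℤ, 0 < n → IsZero ((((baseChange R S).mapHomologicalComplex _).obj F).homology n) := by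
  -- This is why a homotopy equivalence over `R` is required: any additive functor preserves it,
  -- with no flatness assumption.
  have e : HomotopyEquiv
      (((baseChange R S).mapHomologicalComplex _).obj (K.extend ComplexShape.embeddingDownNat))
      (((baseChange R S).mapHomologicalComplex _).obj F) :=
    (baseChange R S).mapHomotopyEquiv (HomotopyCategory.homotopyEquivOfIso i)
  have j' : ((baseChange R S).mapHomologicalComplex _).obj
      (K.extend ComplexShape.embeddingDownNat) ≅ L.extend ComplexShape.embeddingDownNat :=
    mapExtendIso (baseChange R S) _ K ≪≫
      (ComplexShape.embeddingDownNat.extendFunctor (ModuleCat.{max w' v} S)).mapIso j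
  refine ⟨fun n => ⟨?_⟩, fun n hn => ?_⟩
  · exact (L.extendHomologyIso ComplexShape.embeddingDownNat (j' := -(n : ℤ)) rfl).symm ≪≫
      (HomologicalComplex.homologyFunctor _ _ _).mapIso j'.symm ≪≫ e.toHomologyIso _
  · refine IsZero.of_iso ?_ ((e.toHomologyIso n).symm ≪≫
      (HomologicalComplex.homologyFunctor _ _ _).mapIso j')
    refine ShortComplex.isZero_homology_of_isZero_X₂ _ ?_
    refine HomologicalComplex.isZero_extend_X _ _ _ fun m hm => ?_
    have : -(m : ℤ) = n := hm
    lia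

end BaseChange

/-! ## Ranks and alternating sums of Betti numbers -/

section Ranks

theorem exists_linearIndependent_cols {S m n : Type*} [Field S] [Fintype m] [Fintype n]
    (A : Matrix m n S) : ∃ c : Fin A.rank → n, LinearIndependent S fun i => A.col (c i) := by
  rw [A.rank_eq_finrank_span_cols]
  obtain ⟨f, hf, -, hli⟩ := Submodule.exists_fun_fin_finrank_span_eq S (Set.range A.col)
  choose c hc using hf
  exact ⟨c, by simpa only [hc] using hli⟩

/-- Independent columns are chosen first, then independent rows of the resulting submatrix, which
still has full rank. -/
theorem exists_submatrix_det_ne_zero {S m n : Type*} [Field S] [Fintype m] [Fintype n]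
    (A : Matrix m n S) : ∃ (r : Fin A.rank → m) (c : Fin A.rank → n), (A.submatrix r c).det ≠ 0 := by
  obtain ⟨c, hc⟩ := exists_linearIndependent_cols A
  have hB : (Matrix.transpose (A.submatrix id c)).rank = A.rank :=
    (LinearIndependent.rank_matrix (M := Matrix.transpose (A.submatrix id c)) hc).trans (Fintype.card_fin _)
  have h := exists_linearIndependent_cols (Matrix.transpose (A.submatrix id c))
  rw [hB] at h
  obtain ⟨r, hr⟩ := h
  refine ⟨r, c, ?_⟩
  rw [← Matrix.det_transpose]
  exact ((Matrix.isUnit_iff_isUnit_det _).mp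
    (Matrix.linearIndependent_cols_iff_isUnit (A := Matrix.transpose (A.submatrix r c)).mp hr)).ne_zero

/-- A minor of maximal size that is nonzero after `f` is nonzero in `R`, hence nonzero after the
injective `g`. -/
theorem rank_map_le {R S S' m n : Type*} [CommRing R] [Field S] [Field S'] [Fintype m] [Fintype n]
    (A : Matrix m n R) (f : R →+* S) (g : R →+* S') (hg : Function.Injective g) :
    (A.map f).rank ≤ (A.map g).rank := by
  obtain ⟨r, c, h⟩ := exists_submatrix_det_ne_zero (A.map f)
  have h' : ((A.map g).submatrix r c).det ≠ 0 := by
    have hf : ((A.map f).submatrix r c).det = f (A.submatrix r c).det :=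
      (RingHom.map_det f (A.submatrix r c)).symm
    have hg' : ((A.map g).submatrix r c).det = g (A.submatrix r c).det :=
      (RingHom.map_det g (A.submatrix r c)).symm
    rw [hf] at h
    rw [hg']
    exact (map_ne_zero_iff g hg).mpr fun h0 => h (by rw [h0, map_zero])
  calc (A.map f).rank = ((A.map g).submatrix r c).rank := by
        rw [Matrix.rank_of_isUnit _ ((Matrix.isUnit_iff_isUnit_det _).mpr h'.isUnit),
          Fintype.card_fin]
    _ ≤ _ := Matrix.rank_submatrix_le _ _ _

theorem rank_map_toMatrix {R T M N ι κ : Type*} [CommRing R] [Field T] [Algebra R T]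
    [AddCommGroup M] [Module R M] [AddCommGroup N] [Module R N] [Fintype ι] [DecidableEq ι]
    [Fintype κ] (b : Module.Basis ι R M) (c : Module.Basis κ R N) (g : M →ₗ[R] N) :
    ((LinearMap.toMatrix b c g).map (algebraMap R T)).rank =
      Module.finrank T (LinearMap.range (g.baseChange T)) := by
  rw [← LinearMap.toMatrix_baseChange, Matrix.rank_eq_finrank_range_toLin _
    (Algebra.TensorProduct.basis T c) (Algebra.TensorProduct.basis T b), Matrix.toLin_toMatrix]

theorem finrank_range_baseChange_le {R S S' M N : Type*} [CommRing R] [Nontrivial R] [Field S]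
    [Field S'] [Algebra R S] [Algebra R S'] [AddCommGroup M] [Module R M] [Module.Finite R M]
    [Module.Free R M] [AddCommGroup N] [Module R N] [Module.Finite R N] [Module.Free R N]
    (h : Function.Injective (algebraMap R S')) (g : M →ₗ[R] N) :
    Module.finrank S (LinearMap.range (g.baseChange S)) ≤
      Module.finrank S' (LinearMap.range (g.baseChange S')) := by
  classical
  rw [← rank_map_toMatrix (Module.Free.chooseBasis R M) (Module.Free.chooseBasis R N),
    ← rank_map_toMatrix (Module.Free.chooseBasis R M) (Module.Free.chooseBasis R N)]
  exact rank_map_le _ _ _ h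

theorem finrank_ker_quotient_range {S V₁ V₂ V₃ : Type*} [Field S] [AddCommGroup V₁] [Module S V₁]
    [AddCommGroup V₂] [Module S V₂] [AddCommGroup V₃] [Module S V₃] [Module.Finite S V₂]
    (f : V₁ →ₗ[S] V₂) (g : V₂ →ₗ[S] V₃) (h : ∀ x, f x ∈ LinearMap.ker g) :
    (Module.finrank S (LinearMap.ker g ⧸ LinearMap.range (f.codRestrict (LinearMap.ker g) h)) : ℤ) =
      Module.finrank S V₂ - Module.finrank S (LinearMap.range f) -
        Module.finrank S (LinearMap.range g) := by
  have h1 := (LinearMap.range (f.codRestrict (LinearMap.ker g) h)).finrank_quotient_add_finrank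
  have h2 := g.finrank_range_add_finrank_ker
  have h3 : Module.finrank S (LinearMap.range (f.codRestrict (LinearMap.ker g) h)) =
      Module.finrank S (LinearMap.range f) := by
    have e : LinearMap.range f = (LinearMap.range (f.codRestrict (LinearMap.ker g) h)).map
        (LinearMap.ker g).subtype := by
      rw [← LinearMap.range_comp, LinearMap.subtype_comp_codRestrict]
    rw [e]
    exact LinearEquiv.finrank_eq
      (Submodule.equivMapOfInjective _ (Submodule.subtype_injective _) _)
  lia

theorem finrank_homology {S : Type w} [Field S] (M : CochainComplex (ModuleCat.{v} S) ℤ)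
    (hM : ∀ i, Module.Finite S (M.X i)) (i : ℤ) :
    Module.Finite S (M.homology i) ∧
      (Module.finrank S (M.homology i) : ℤ) = Module.finrank S (M.X i) -
        Module.finrank S (LinearMap.range (M.d (i - 1) i).hom) -
        Module.finrank S (LinearMap.range (M.d i (i + 1)).hom) := by
  have := hM i
  have h (x : M.X (i - 1)) : (M.d (i - 1) i).hom x ∈ LinearMap.ker (M.d i (i + 1)).hom :=
    LinearMap.congr_fun (congrArg ModuleCat.Hom.hom (M.d_comp_d (i - 1) i (i + 1))) x
  have e : M.homology i ≃ₗ[S] (LinearMap.ker (M.d i (i + 1)).hom ⧸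
      LinearMap.range ((M.d (i - 1) i).hom.codRestrict (LinearMap.ker (M.d i (i + 1)).hom) h)) :=
    (M.homologyIsoSc' (i - 1) i (i + 1) (by simp) (by simp) ≪≫
      (M.sc' (i - 1) i (i + 1)).moduleCatHomologyIso).toLinearEquiv
  refine ⟨Module.Finite.equiv e.symm, ?_⟩
  rw [e.finrank_eq]
  exact finrank_ker_quotient_range _ _ h

/-- The truncated alternating sum telescopes. -/
theorem alternating_sum_betti (c ρ : ℤ → ℤ) (n : ℕ) (r : ℤ) :
    ∑ s ∈ Finset.Icc r (2 * n + r), ((s - r).negOnePow : ℤ) * (c s - ρ s - ρ (s + 1)) =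
      ∑ s ∈ Finset.Icc r (2 * n + r), ((s - r).negOnePow : ℤ) * c s - ρ r - ρ (2 * n + r + 1) := by
  have hI (k : ℤ) (hk : r ≤ k + 1) : Finset.Icc r (k + 1) = insert (k + 1) (Finset.Icc r k) := by
    ext s
    simp only [Finset.mem_Icc, Finset.mem_insert]
    lia
  induction n with
  | zero => simp
  | succ n ih =>
    have e : (2 * (n + 1 : ℕ) + r : ℤ) = 2 * n + r + 1 + 1 := by push_cast; ring
    have hodd : (2 * n + r + 1 - r : ℤ).negOnePow = -1 := Int.negOnePow_odd _ ⟨n, by ring⟩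
    have heven : (2 * n + r + 1 + 1 - r : ℤ).negOnePow = 1 :=
      Int.negOnePow_even _ ⟨n + 1, by ring⟩
    rw [e, hI _ (by lia), Finset.sum_insert (by simp), Finset.sum_insert (by simp),
      hI _ (by lia), Finset.sum_insert (by simp), Finset.sum_insert (by simp), ih, hodd, heven]
    push_cast
    ring

/-- The number `2 * n + 1` of terms is odd, so both surviving end ranks carry a minus sign. -/
theorem alternating_sum_betti_le {c ρ ρ' : ℤ → ℤ} (h : ∀ s, ρ' s ≤ ρ s) (n : ℕ) (r : ℤ) :
    ∑ s ∈ Finset.Icc r (2 * n + r), ((s - r).negOnePow : ℤ) * (c s - ρ s - ρ (s + 1)) ≤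
      ∑ s ∈ Finset.Icc r (2 * n + r), ((s - r).negOnePow : ℤ) * (c s - ρ' s - ρ' (s + 1)) := by
  rw [alternating_sum_betti, alternating_sum_betti]
  linarith [h r, h (2 * n + r + 1)]

end Ranks

end TwistedHomology

end

noncomputable section

namespace TwistedHomology

/-! ## Comparison of chain complexes -/

section Comparison

universe w'

open TensorProduct

variable {X : Type u} [TopologicalSpace X]

theorem mem_simplicesIn_univ {n : ℕ} (σ : C(Simp n, X)) :
    σ ∈ (Piece.ofSet (Set.univ : Set X)).carrier n := fun _ => trivial

variable {R : Type w} [CommRing R] (ω : Weight R X) {S : Type w'} [CommRing S] [Algebra R S]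

variable (R S) in
/-- The chains on all simplices, after base change, have a basis indexed by the simplices. -/
def baseChangeBasis (n : ℕ) : Module.Basis ((Piece.ofSet (Set.univ : Set X)).carrier n) S
    (S ⊗[R] ((Piece.ofSet (Set.univ : Set X)).carrier n →₀ R)) :=
  Algebra.TensorProduct.basis S Finsupp.basisSingleOne

theorem baseChangeBasis_apply {n : ℕ} (σ : (Piece.ofSet (Set.univ : Set X)).carrier n) :
    baseChangeBasis R S n σ = 1 ⊗ₜ Finsupp.single σ 1 := by
  rw [baseChangeBasis, Algebra.TensorProduct.basis_apply, Finsupp.coe_basisSingleOne]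

/-- The linear equivalence between chains given by a basis. -/
def baseChangeEquiv {n : ℕ} {M : Type*} [AddCommGroup M] [Module S M]
    (b : Module.Basis C(Simp n, X) S M) :
    (S ⊗[R] ((Piece.ofSet (Set.univ : Set X)).carrier n →₀ R)) ≃ₗ[S] M :=
  (baseChangeBasis R S n).equiv b (Equiv.subtypeUnivEquiv mem_simplicesIn_univ)

theorem baseChangeEquiv_single {n : ℕ} {M : Type*} [AddCommGroup M] [Module S M]
    (b : Module.Basis C(Simp n, X) S M) (σ : (Piece.ofSet (Set.univ : Set X)).carrier n) (r : R) :
    baseChangeEquiv b (1 ⊗ₜ Finsupp.single σ r) = algebraMap R S r • b σ.1 := by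
  have : (1 : S) ⊗ₜ[R] Finsupp.single σ r =
      algebraMap R S r • ((1 : S) ⊗ₜ[R] Finsupp.single σ (1 : R)) := by
    rw [TensorProduct.smul_tmul', smul_eq_mul, mul_one, Algebra.algebraMap_eq_smul_one,
      TensorProduct.smul_tmul, Finsupp.smul_single, smul_eq_mul, mul_one]
  rw [this, map_smul, ← baseChangeBasis_apply, baseChangeEquiv, Module.Basis.equiv_apply]
  rfl

theorem Piece.d_univ_single {n : ℕ}
    (σ : (Piece.ofSet (Set.univ : Set X)).carrier (n + 1)) :
    (Piece.ofSet (Set.univ : Set X)).d ω n (Finsupp.single σ 1) = ∑ i : Fin (n + 2),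
      (-1 : ℤ) ^ i.val • Finsupp.single ⟨σ.1.comp (face i), mem_simplicesIn_univ _⟩
        (ω.along σ.1 (center (n + 1)) (face i (center n))) := by
  classical
  rw [Piece.d, compress_single, Weight.d_single, map_sum]
  refine Finset.sum_congr rfl fun i _ => ?_
  rw [map_zsmul]
  congr 1
  ext τ
  refine (Finsupp.single_apply).trans ((if_congr ?_ rfl rfl).trans Finsupp.single_apply.symm)
  exact ⟨fun h => Subtype.ext h, fun h => congrArg Subtype.val h⟩

/-- The base change of the complex of all singular chains is isomorphic to any complex with a basis
on which the differential is given by the same formula. -/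
def Piece.baseChangeIso {L : ChainComplex (ModuleCat.{max w' u w} S) ℕ}
    (b : ∀ n, Module.Basis C(Simp n, X) S (L.X n))
    (hb : ∀ (n : ℕ) (σ : C(Simp (n + 1), X)), (L.d (n + 1) n).hom (b (n + 1) σ) =
      ∑ i : Fin (n + 2), (-1 : ℤ) ^ i.val •
        algebraMap R S (ω.along σ (center (n + 1)) (face i (center n))) • b n (σ.comp (face i))) :
    ((baseChange.{max u w} R S).mapHomologicalComplex _).obj
      ((Piece.ofSet (Set.univ : Set X)).complex ω) ≅ L :=
  HomologicalComplex.Hom.isoOfComponents (fun n => (baseChangeEquiv (b n)).toModuleIso) (by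
    rintro _ n rfl
    have key : (L.d (n + 1) n).hom ∘ₗ (baseChangeEquiv (b (n + 1))).toLinearMap =
        (baseChangeEquiv (b n)).toLinearMap ∘ₗ
          ((Piece.ofSet (Set.univ : Set X)).d ω n).baseChange S := by
      refine (baseChangeBasis R S (n + 1)).ext fun σ => ?_
      simp only [LinearMap.comp_apply, LinearEquiv.coe_coe, baseChangeBasis_apply,
        LinearMap.baseChange_tmul, Piece.d_univ_single, baseChangeEquiv_single, map_one, one_smul,
        hb, TensorProduct.tmul_sum, map_sum]
      refine Finset.sum_congr rfl fun i _ => ?_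
      rw [← baseChangeEquiv_single (b n) ⟨σ.1.comp (face i), mem_simplicesIn_univ _⟩,
        ← map_zsmul]
      congr 1
      exact (map_zsmul (TensorProduct.mk R S ((Piece.ofSet (Set.univ : Set X)).carrier n →₀ R) 1)
        _ _).symm
    rw [Functor.mapHomologicalComplex_obj_d, Piece.complex_d]
    exact ModuleCat.hom_ext key)

end Comparison

theorem hom_alternating_sum {S : Type w} [Ring S] {M N : ModuleCat.{v} S} {k : ℕ}
    (f : Fin k → (M ⟶ N)) (x : M) : (∑ i, (-1 : ℤ) ^ i.val • f i).hom x =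
      ∑ i, (-1 : ℤ) ^ i.val • (f i).hom x := by
  rw [ModuleCat.hom_sum, LinearMap.sum_apply]
  rfl

/-! ### Chains with coefficients in a local system -/

section LocalSystems

variable {X : Type u} [TopologicalSpace X]

/-- The weight of a path given by a character of the first homology group. -/
def monodromyWeight {R : Type w} [CommRing R] (μ : Multiplicative (H1 X) →* R) : Weight R X where
  val p := μ (Multiplicative.ofAdd (closedUpClass p))
  val_refl x := by rw [closedUpClass_refl, ofAdd_zero, map_one]
  val_trans p q := by rw [closedUpClass_trans, ofAdd_add, map_mul]

variable {K : Type v} [CommRing K] (μ : Multiplicative (H1 X) →* Kˣ)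

/-- The basis of the chains with coefficients in `K^μ`. -/
def twistedBasis (n : ℕ) :
    Module.Basis C(Simp n, X) K ((twistedChainComplex (monodromySystem μ)).X n) := by
  classical
  exact Module.Basis.ofRepr (finsuppLequivDFinsupp (ι := C(Simp n, X)) (M := K) K).symm

theorem twistedBasis_apply {n : ℕ} (σ : C(Simp n, X)) :
    twistedBasis μ n σ = single (monodromySystem μ) σ (1 : K) := by
  classical
  exact Finsupp.toDFinsupp_single σ (1 : K)

/-- Restriction to a face transports the coefficient from one barycenter to the other, along the
path that also defines `Weight.along`. -/
theorem twisted_d {n : ℕ} (σ : C(Simp (n + 1), X)) :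
    ((twistedChainComplex (monodromySystem μ)).d (n + 1) n).hom (twistedBasis μ (n + 1) σ) =
      ∑ i : Fin (n + 2), (-1 : ℤ) ^ i.val •
        ((μ (Multiplicative.ofAdd (closedUpClass
          ((simpPath (center (n + 1)) (face i (center n))).map σ))) : Kˣ) : K) •
          twistedBasis μ n (σ.comp (face i)) := by
  have h : (twistedChainComplex (monodromySystem μ)).d (n + 1) n =
      ∑ i : Fin (n + 2), (-1 : ℤ) ^ (i : ℕ) •
        ModuleCat.ofHom (restrict (monodromySystem μ) (face i)) :=
    AlternatingFaceMapComplex.obj_d_eq (twistedSimplicialModule (monodromySystem μ)) n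
  refine (LinearMap.congr_fun (congrArg ModuleCat.Hom.hom h) _).trans
    ((hom_alternating_sum _ _).trans ?_)
  refine Finset.sum_congr rfl fun i _ => ?_
  rw [twistedBasis_apply, twistedBasis_apply]
  congr 1
  refine (LinearMap.congr_fun (restrict_single (monodromySystem μ) (face i) σ) (1 : K)).trans ?_
  exact map_smul (single (monodromySystem μ) (σ.comp (face i))) _ (1 : K)

end LocalSystems

/-! ### Untwisted chains -/

section Untwisted

variable (X : Type u) [TopologicalSpace X] (P : Type v) [Field P]

/-- The singular chain complex with coefficients in `P`. -/
abbrev untwistedChains : ChainComplex (ModuleCat.{max u v} P) ℕ :=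
  ((singularChainComplexFunctor.{u} (ModuleCat.{max u v} P)).obj
    (ModuleCat.of P (ULift.{u} P))).obj (TopCat.of X)

variable {X} in
/-- The inclusion of the summand of a simplex. -/
def untwistedι {n : ℕ} (σ : C(Simp n, X)) :
    ModuleCat.of P (ULift.{u} P) ⟶ (untwistedChains X P).X n :=
  SSet.ιChainComplex _ (toSing σ)

theorem untwistedι_d {n : ℕ} (σ : C(Simp (n + 1), X)) :
    untwistedι P σ ≫ (untwistedChains X P).d (n + 1) n =
      ∑ i : Fin (n + 2), (-1) ^ i.val • untwistedι P (σ.comp (face i)) :=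
  SSet.ιChainComplex_d _ _ (toSing σ)

theorem untwisted_hom_ext {n : ℕ} {M : ModuleCat.{max u v} P} {f g : (untwistedChains X P).X n ⟶ M}
    (h : ∀ σ : C(Simp n, X), untwistedι P σ ≫ f = untwistedι P σ ≫ g) : f = g :=
  SSet.chainComplex_hom_ext fun x => by
    obtain ⟨σ, rfl⟩ := ((TopCat.of X).toSSetObjEquiv (Opposite.op ⦋n⦌)).symm.surjective x
    exact h σ

/-- The chains are a coproduct of copies of `P` indexed by simplices; its universal property
supplies the coordinate map of a basis. -/
theorem exists_untwisted_desc (n : ℕ) : ∃ f : (untwistedChains X P).X n ⟶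
    ModuleCat.of P (C(Simp n, X) →₀ P), ∀ σ, untwistedι P σ ≫ f =
      ModuleCat.ofHom (Finsupp.lsingle σ ∘ₗ ULift.moduleEquiv.toLinearMap) := by
  let c : Limits.Cofan fun _ : (TopCat.toSSet.obj (TopCat.of X)) _⦋n⦌ =>
      ModuleCat.of P (ULift.{u} P) :=
    Limits.Cofan.mk (ModuleCat.of P (C(Simp n, X) →₀ P)) fun x => ModuleCat.ofHom
      (Finsupp.lsingle ((TopCat.of X).toSSetObjEquiv (Opposite.op ⦋n⦌) x) ∘ₗ
        ULift.moduleEquiv.toLinearMap)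
  refine ⟨(SSet.isColimitChainComplexXCofan _ _ n).desc c, fun σ => ?_⟩
  refine ((SSet.isColimitChainComplexXCofan _ _ n).fac c ⟨toSing σ⟩).trans ?_
  simp [c, toSing]

/-- The basis of the singular chains with coefficients in `P`. -/
def untwistedBasis (n : ℕ) : Module.Basis C(Simp n, X) P ((untwistedChains X P).X n) :=
  Module.Basis.ofRepr (LinearEquiv.ofLinearMap (exists_untwisted_desc X P n).choose.hom
    (Finsupp.linearCombination P fun σ => (untwistedι P σ).hom (ULift.up 1))
    (by
      ext σ : 2
      have h := LinearMap.congr_fun (congrArg ModuleCat.Hom.hom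
        ((exists_untwisted_desc X P n).choose_spec σ)) (ULift.up 1)
      simp only [LinearMap.comp_apply, Finsupp.lsingle_apply, Finsupp.linearCombination_single,
        one_smul, LinearMap.id_apply]
      exact h)
    (by
      have h := untwisted_hom_ext X P (n := n) (f := (exists_untwisted_desc X P n).choose ≫
        ModuleCat.ofHom (Finsupp.linearCombination P fun σ => (untwistedι P σ).hom (ULift.up 1)))
        (g := 𝟙 _) fun σ => by
          rw [← Category.assoc, (exists_untwisted_desc X P n).choose_spec σ, Category.comp_id]
          refine ModuleCat.hom_ext (LinearMap.ext fun z => ?_)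
          change Finsupp.linearCombination P (fun σ => (untwistedι P σ).hom (ULift.up 1))
            (Finsupp.single σ z.down) = _
          rw [Finsupp.linearCombination_single, ← map_smul]
          congr 1
          exact ULift.ext _ _ (mul_one _)
      exact congrArg ModuleCat.Hom.hom h))

variable {X} in
theorem untwistedBasis_apply {n : ℕ} (σ : C(Simp n, X)) :
    untwistedBasis X P n σ = (untwistedι P σ).hom (ULift.up 1) := by
  change Finsupp.linearCombination P _ (Finsupp.single σ 1) = _
  rw [Finsupp.linearCombination_single, one_smul]

variable {X} in
theorem untwisted_d {n : ℕ} (σ : C(Simp (n + 1), X)) :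
    ((untwistedChains X P).d (n + 1) n).hom (untwistedBasis X P (n + 1) σ) =
      ∑ i : Fin (n + 2), (-1 : ℤ) ^ i.val • untwistedBasis X P n (σ.comp (face i)) := by
  have h := LinearMap.congr_fun (congrArg ModuleCat.Hom.hom (untwistedι_d X P σ)) (ULift.up 1)
  simp only [untwistedBasis_apply]
  exact h.trans (hom_alternating_sum _ _)

end Untwisted

end TwistedHomology

end

noncomputable section

namespace TwistedHomology

/-! ## Comparison of Betti numbers -/

section Betti

universe w₁ w₂

/-- The dimensions of the homology of a chain complex, which are zero in negative degrees. -/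
def betti {S : Type w} [Field S] (L : ChainComplex (ModuleCat.{v} S) ℕ) (s : ℤ) : ℕ :=
  if 0 ≤ s then Module.finrank S (L.homology s.toNat) else 0

variable {R : Type w} [CommRing R]

/-- The rank of the differential of the base change of a cochain complex. -/
def rankD (F : CochainComplex (ModuleCat.{v} R) ℤ) (S : Type w₁) [Field S] [Algebra R S]
    (s : ℤ) : ℕ :=
  Module.finrank S (LinearMap.range ((F.d (-s) (-s + 1)).hom.baseChange S))

/-- Homological degree `s` is cohomological degree `-s`, where `rankD F S s` belongs to the outgoing
differential and `rankD F S (s + 1)` to the incoming one. -/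
theorem finite_and_betti_eq [Nontrivial R] {K : ChainComplex (ModuleCat.{v} R) ℕ}
    {F : CochainComplex (ModuleCat.{v} R) ℤ} (hF : DegreewiseFiniteFree F)
    (i : (HomotopyCategory.quotient _ _).obj (K.extend ComplexShape.embeddingDownNat) ≅
      (HomotopyCategory.quotient _ _).obj F)
    {S : Type w₁} [Field S] [Algebra R S] {L : ChainComplex (ModuleCat.{max w₁ v} S) ℕ}
    (j : ((baseChange R S).mapHomologicalComplex _).obj K ≅ L) :
    (∀ n : ℕ, Module.Finite S (L.homology n)) ∧
      ∀ s : ℤ, (betti L s : ℤ) =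
        Module.finrank R (F.X (-s)) - rankD F S s - rankD F S (s + 1) := by
  let M := ((baseChange R S).mapHomologicalComplex (ComplexShape.up ℤ)).obj F
  have hM (n : ℤ) : Module.Finite S (M.X n) := by
    have := (hF n).1
    exact inferInstanceAs (Module.Finite S (TensorProduct R S (F.X n)))
  have hr (n : ℤ) : Module.finrank S (M.X n) = Module.finrank R (F.X n) := by
    have := (hF n).2
    exact Module.finrank_baseChange (R := S) (S := R) (M' := F.X n)
  obtain ⟨h₁, h₂⟩ := exists_homology_iso i S j
  refine ⟨fun n => ?_, fun s => ?_⟩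
  · have := (finrank_homology M hM (-n)).1
    exact Module.Finite.equiv (h₁ n).some.toLinearEquiv.symm
  · have e : betti L s = Module.finrank S (M.homology (-s)) := by
      unfold betti
      split_ifs with hs
      · obtain ⟨n, rfl⟩ := Int.eq_ofNat_of_zero_le hs
        exact (h₁ n).some.toLinearEquiv.finrank_eq
      -- `F` may have nonzero terms here, but its homology vanishes after base change, so the
      -- formula holds for negative `s` too.
      · have := ModuleCat.subsingleton_of_isZero (h₂ (-s) (by lia))
        exact Module.finrank_zero_of_subsingleton.symm
    have hd {a b a' b' : ℤ} (ha : a = a') (hb : b = b') :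
        Module.finrank S (LinearMap.range (M.d a b).hom) =
          Module.finrank S (LinearMap.range (M.d a' b').hom) := by
      subst ha hb
      rfl
    rw [e, (finrank_homology M hM (-s)).2, hr, hd (show -s - 1 = -(s + 1) by ring)
      (show -s = -(s + 1) + 1 by ring), sub_right_comm]
    rfl

/-- The same `F` serves both fields, so the ranks of its terms agree and only the ranks of the
differentials are compared. -/
theorem finite_and_alternating_sum_betti_le [Nontrivial R] {K : ChainComplex (ModuleCat.{v} R) ℕ}
    (hK : IsFiniteFreeUpToHomotopy K) {S : Type w₁} [Field S] [Algebra R S]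
    (hS : Function.Injective (algebraMap R S)) {L : ChainComplex (ModuleCat.{max w₁ v} S) ℕ}
    (j : ((baseChange R S).mapHomologicalComplex _).obj K ≅ L) {S' : Type w₂} [Field S']
    [Algebra R S'] {L' : ChainComplex (ModuleCat.{max w₂ v} S') ℕ}
    (j' : ((baseChange R S').mapHomologicalComplex _).obj K ≅ L') :
    (∀ n : ℕ, Module.Finite S (L.homology n) ∧ Module.Finite S' (L'.homology n)) ∧
      ∀ (n : ℕ) (r : ℤ),
        ∑ s ∈ Finset.Icc r (2 * n + r), ((s - r).negOnePow : ℤ) * (betti L s : ℤ) ≤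
          ∑ s ∈ Finset.Icc r (2 * n + r), ((s - r).negOnePow : ℤ) * (betti L' s : ℤ) := by
  obtain ⟨F, hF, ⟨i⟩⟩ := hK
  obtain ⟨h₁, h₂⟩ := finite_and_betti_eq hF i j
  obtain ⟨h₁', h₂'⟩ := finite_and_betti_eq hF i j'
  refine ⟨fun n => ⟨h₁ n, h₁' n⟩, fun n r => ?_⟩
  simp only [h₂, h₂']
  refine alternating_sum_betti_le (fun s => ?_) n r
  have := (hF (-s + 1)).1
  have := (hF (-s + 1)).2
  have := (hF (-s)).1
  have := (hF (-s)).2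
  exact Int.ofNat_le.mpr (finrank_range_baseChange_le hS _)

end Betti

/-! ### The character with values in the ring it generates. -/

section Main

variable {X : Type u} [TopologicalSpace X]

/-- A character of the first homology group, as a map to the ring generated by its values. -/
def characterClosure (μ : Multiplicative (H1 X) →* ℂˣ) :
    Multiplicative (H1 X) →* Subring.closure (Set.range fun a => ((μ a : ℂˣ) : ℂ)) where
  toFun a := ⟨((μ a : ℂˣ) : ℂ), Subring.subset_closure (Set.mem_range_self a)⟩
  map_one' := Subtype.ext (by simp)
  map_mul' a b := Subtype.ext (by simp)

end Main

end TwistedHomology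

end

theorem mainTheorem7 (X : Type u) [TopologicalSpace X] [T2Space X]
    [Topology.CWComplex (Set.univ : Set X)]
    [Topology.RelCWComplex.Finite (Set.univ : Set X)]
    (μ : Multiplicative (TwistedHomology.H1 X) →* ℂˣ)
    (P : Type v) [Field P]
    (h : Subring.closure (Set.range fun a => ((μ a : ℂˣ) : ℂ)) →+* P)
    (hμ : ∀ a, h ⟨((μ a : ℂˣ) : ℂ), Subring.subset_closure (Set.mem_range_self a)⟩ = 1) :
    (∀ s : ℕ, Module.Finite ℂ (TwistedHomology.complexTwistedHomology X μ s) ∧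
      Module.Finite P (TwistedHomology.untwistedHomology X P s)) ∧
    ∀ (n : ℕ) (r : ℤ),
      ∑ s ∈ Finset.Icc r (2 * n + r),
          ((s - r).negOnePow : ℤ) * (TwistedHomology.twistedBetti X μ s : ℤ) ≤
        ∑ s ∈ Finset.Icc r (2 * n + r),
          ((s - r).negOnePow : ℤ) * (TwistedHomology.untwistedBetti X P s : ℤ) := by
  open TwistedHomology in
  let R := Subring.closure (Set.range fun a => ((μ a : ℂˣ) : ℂ))
  let _ : Algebra R P := h.toAlgebra
  let ω : Weight R X := monodromyWeight (characterClosure μ)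
  exact finite_and_alternating_sum_betti_le (Piece.isFiniteFree_univ ω)
    (S := ℂ) (Subtype.val_injective)
    (Piece.baseChangeIso ω (twistedBasis μ) fun n σ => twisted_d μ σ)
    (Piece.baseChangeIso ω (S := P) (untwistedBasis X P) fun n σ => by
      -- Every weight is a value of `μ`, so `h` sends it to `1` and the twist disappears over `P`.
      refine (untwisted_d P σ).trans (Finset.sum_congr rfl fun i _ => ?_)
      have : algebraMap R P (ω.along σ (center (n + 1)) (face i (center n))) = 1 := hμ _
      rw [this, one_smul])
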